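/- All graphs are finite and simple, and "contains" refers to induced subgraphs; a path or hole *in* $G$ is an induced one, the interior of a path is the set of its vertices other than its two ends, and its length is its number of edges. Two disjoint vertex sets are anticomplete if there is no edge between them. A *hole* is an induced cycle of length at least four. * A *theta* is a graph consisting of two non-adjacent vertices $a,b$ and three paths from $a$ to $b$, each of length at least two, whose interiors are pairwise disjoint and anticomplete to each other. * A *pyramid* is a graph consisting of a vertex $a$, a triangle $\{b_1,b_2,b_3\}$, and paths $P_i$ from $a$ to $b_i$ ($i=1,2,3$), each of length at least one and at most one of length exactly one, such that for $i\ne j$ the sets $P_i\setminus\{a\}$ and $P_j\setminus\{a\}$ are disjoint and the only edge between them is $b_ib_j$. * A *prism* is a graph consisting of two triangles $\{a_1,a_2,a_3\}$, $\{b_1,b_2,b_3\}$ and pairwise disjoint paths $P_i$ from $a_i$ to $b_i$ ($i=1,2,3$), each of length at least one, such that for $i\ne j$ the only edges between $P_i$ and $P_j$ are $a_ia_j$ and $b_ib_j$. * A *pinched prism* is a graph consisting of a hole $W$ of length at least six and a further vertex whose neighbours in $W$ are four vertices inducing exactly two disjoint edges. A *generalized prism* is a prism or a pinched prism. For an integer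 $t\ge 1$, let $\mathcal C_t$ be the class of graphs that contain no theta, no pyramid, no generalized prism and no $K_t$. Let $W$ be a hole in a graph and $v$ a vertex not in $W$. A *long sector* of $(W,v)$ is a path of $W$ with non-empty interior, both ends of which are adjacent to $v$ and no interior vertex of which is adjacent to $v$. The pair $(W,v)$ is a *wheel* if $W$ has length at least five, $v$ has at least three neighbours in $W$, and $(W,v)$ has at least two long sectors. A vertex $v$ is a *hub* of $G$ if $G$ has a wheel $(W,v)$; write $\mathrm{Hub}(G)$ for the set of hubs. A graph is *wheel-free* if it has no wheel. Let $G$ be a graph and $v\in V(G)$. Let $D_1,\dots,D_m$ be the components of $G\setminus N[v]$. Let $H$ be the graph obtained from the subgraph of $G$ induced by $N(v)\setminus \mathrm{Hub}(G)$ by adding a stable set of new vertices $d_1,\dots,d_m$, where the neighbourhood of $d_i$ in $H$ is $N(D_i)\setminus\mathrm{Hub}(G)$, the set of vertices of $N(v)\setminus\mathrm{Hub}(G)$ that have a neighbour in $D_i$. (Equivalently, $H$ is obtained from $G$ by deleting $v$ and all hubs of $G$ that are adjacent to $v$, and contracting each $D_i$ to a single vertex $d_i$.) Let $H\cup\{v\}$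 be the graph obtained from $H$ by adding the vertex $v$, adjacent to all of $N(v)\setminus\mathrm{Hub}(G)$ and to none of $d_1,\dots,d_m$. **Theorem.** Let $t\ge 1$, let $G\in\mathcal C_t$ and let $v\in V(G)$. Then $H\cup\{v\}\in\mathcal C_t$, and $H$ is wheel-free. -/

import Mathlib

namespace HubContraction

universe u

variable {V : Type u}

/-- The vertex set of a walk. -/
def vset {G : SimpleGraph V} {x y : V} (p : G.Walk x y) : Set V :=
  {z | z ∈ p.support}

/-- The interior of a path: all of its vertices except its two ends. -/
def pathInterior {G : SimpleGraph V} {x y : V} (p : G.Walk x y) : Set V :=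
  {z | z ∈ p.support ∧ z ≠ x ∧ z ≠ y}

/-- A path in the sense of induced subgraphs: no repeated vertex, and two vertices of the path are
adjacent in `G` only if they are consecutive on the path. Its length is `p.length`. -/
def IsIndPath {G : SimpleGraph V} {x y : V} (p : G.Walk x y) : Prop :=
  p.IsPath ∧ p.IsChordless

/-- There is no edge between `X` and `Y`. -/
def Anticomplete (G : SimpleGraph V) (X Y : Set V) : Prop :=
  ∀ x ∈ X, ∀ y ∈ Y, ¬ G.Adj x y

/-- The subgraph of `G` induced by `W` is a cycle of length at least four. -/
def IsHole (G : SimpleGraph V) (W : Set V) : Prop :=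
  ∃ n : ℕ, 4 ≤ n ∧ Nonempty (SimpleGraph.cycleGraph n ≃g G.induce W)

/-- The subgraph of `G` induced by `S` is a theta: two non-adjacent vertices `a`, `b` and three
paths of length at least two from `a` to `b` whose interiors are pairwise disjoint and
anticomplete. -/
def IsTheta (G : SimpleGraph V) (S : Set V) : Prop :=
  ∃ (a b : V) (p : Fin 3 → G.Walk a b),
    a ≠ b ∧ ¬ G.Adj a b ∧
    (∀ i, IsIndPath (p i) ∧ 2 ≤ (p i).length) ∧
    (∀ i j, i ≠ j → Disjoint (pathInterior (p i)) (pathInterior (p j)) ∧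
      Anticomplete G (pathInterior (p i)) (pathInterior (p j))) ∧
    S = ⋃ i, vset (p i)

/-- The subgraph of `G` induced by `S` is a pyramid with apex `a` and base `b 0, b 1, b 2`. -/
def IsPyramid (G : SimpleGraph V) (S : Set V) : Prop :=
  ∃ (a : V) (b : Fin 3 → V) (p : ∀ i, G.Walk a (b i)),
    (∀ i j, i ≠ j → G.Adj (b i) (b j)) ∧
    (∀ i, IsIndPath (p i) ∧ 1 ≤ (p i).length) ∧
    (∀ i j, i ≠ j → Disjoint (vset (p i) \ {a}) (vset (p j) \ {a})) ∧
    (∀ i j, i ≠ j → ∀ x ∈ vset (p i) \ {a}, ∀ y ∈ vset (p j) \ {a},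
      G.Adj x y → x = b i ∧ y = b j) ∧
    (∀ i j, i ≠ j → ¬ ((p i).length = 1 ∧ (p j).length = 1)) ∧
    S = ⋃ i, vset (p i)

/-- The subgraph of `G` induced by `S` is a prism with triangles `a 0, a 1, a 2` and
`b 0, b 1, b 2`. -/
def IsPrism (G : SimpleGraph V) (S : Set V) : Prop :=
  ∃ (a b : Fin 3 → V) (p : ∀ i, G.Walk (a i) (b i)),
    (∀ i j, i ≠ j → G.Adj (a i) (a j)) ∧
    (∀ i j, i ≠ j → G.Adj (b i) (b j)) ∧
    (∀ i, IsIndPath (p i) ∧ 1 ≤ (p i).length) ∧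
    (∀ i j, i ≠ j → Disjoint (vset (p i)) (vset (p j))) ∧
    (∀ i j, i ≠ j → ∀ x ∈ vset (p i), ∀ y ∈ vset (p j),
      G.Adj x y → (x = a i ∧ y = a j) ∨ (x = b i ∧ y = b j)) ∧
    S = ⋃ i, vset (p i)

/-- The subgraph of `G` induced by `S` is a pinched prism: a hole `W` of length at least six and a
further vertex `c`, the center, whose neighbors `x, y, z, w` in `W` induce exactly the two disjoint
edges `xy` and `zw`. -/
def IsPinchedPrism (G : SimpleGraph V) (S : Set V) : Prop :=
  ∃ (W : Set V) (c : V), IsHole G W ∧ 6 ≤ W.ncard ∧ c ∉ W ∧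
    (∃ x y z w : V, G.neighborSet c ∩ W = {x, y, z, w} ∧
      G.Adj x y ∧ G.Adj z w ∧ Disjoint ({x, y} : Set V) {z, w} ∧
      Anticomplete G {x, y} {z, w}) ∧
    S = insert c W

/-- The class of (theta, pyramid, generalized prism, `K_t`)-free graphs, where a generalized prism
is a prism or a pinched prism, and freeness refers to induced subgraphs. -/
structure InClass (t : ℕ) (G : SimpleGraph V) : Prop where
  theta_free : ∀ S, ¬ IsTheta G S
  pyramid_free : ∀ S, ¬ IsPyramid G S
  prism_free : ∀ S, ¬ IsPrism G S
  pinchedPrism_free : ∀ S, ¬ IsPinchedPrism G S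
  cliqueFree : G.CliqueFree t

/-- `p` is a long sector of `(W, v)`: a path of `W` with non-empty interior (hence of length at
least two), both of whose ends are adjacent to `v`, and no interior vertex of which is adjacent
to `v`. -/
def IsLongSector (G : SimpleGraph V) (W : Set V) (v : V) {x y : V} (p : G.Walk x y) : Prop :=
  IsIndPath p ∧ vset p ⊆ W ∧ G.Adj v x ∧ G.Adj v y ∧
    (∀ z ∈ pathInterior p, ¬ G.Adj v z) ∧ (pathInterior p).Nonempty

/-- `(W, v)` is a wheel in `G`. Sectors are induced subgraphs, so two of them are different exactly
if their vertex sets are. -/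
def IsWheel (G : SimpleGraph V) (W : Set V) (v : V) : Prop :=
  IsHole G W ∧ 5 ≤ W.ncard ∧ v ∉ W ∧ 3 ≤ (G.neighborSet v ∩ W).ncard ∧
    ∃ (x y x' y' : V) (p : G.Walk x y) (q : G.Walk x' y'),
      IsLongSector G W v p ∧ IsLongSector G W v q ∧ vset p ≠ vset q

/-- The set of hubs of `G`: the vertices `v` for which there is a wheel `(W, v)`. -/
def hubs (G : SimpleGraph V) : Set V :=
  {v | ∃ W, IsWheel G W v}

def WheelFree (G : SimpleGraph V) : Prop :=
  ∀ W v, ¬ IsWheel G W v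

/-- The components of `G ∖ N[v]`. -/
abbrev FarComponent (G : SimpleGraph V) (v : V) : Type u :=
  (G.induce {x : V | x ≠ v ∧ ¬ G.Adj v x}).ConnectedComponent

/-- The vertices of the contracted graph: the neighbors of `v` that are not hubs of `G`, and one
new vertex for each component of `G ∖ N[v]`. -/
abbrev ContractedVertex (G : SimpleGraph V) (v : V) : Type u :=
  {x : V // G.Adj v x ∧ x ∉ hubs G} ⊕ FarComponent G v

/-- The graph obtained from `G` by deleting `v` and the hubs of `G` adjacent to `v`, and contracting
each component of `G ∖ N[v]` to a single vertex: the remaining neighbors of `v` are adjacent as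
in `G`, a neighbor of `v` is adjacent to a component if it has a neighbor in that component, and
no two components are adjacent. -/
def contracted (G : SimpleGraph V) (v : V) : SimpleGraph (ContractedVertex G v) where
  Adj
    | .inl x, .inl y => G.Adj x y
    | .inl x, .inr D => ∃ d ∈ D.supp, G.Adj x d
    | .inr D, .inl x => ∃ d ∈ D.supp, G.Adj x d
    | .inr _, .inr _ => False
  symm := ⟨by
    rintro (x | D) (y | E) h
    · exact G.adj_symm h
    · exact h
    · exact h
    · exact h⟩
  loopless := ⟨by
    rintro (x | D) h
    · exact G.loopless.irrefl _ h
    · exact h⟩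

/-- The contracted graph together with the vertex `v` (here `none`), which is adjacent to all
non-hub neighbors of `v` and to none of the contracted components. -/
def contractedWith (G : SimpleGraph V) (v : V) : SimpleGraph (Option (ContractedVertex G v)) where
  Adj
    | some a, some b => (contracted G v).Adj a b
    | none, some (.inl _) => True
    | some (.inl _), none => True
    | _, _ => False
  symm := ⟨by
    rintro (_ | _ | _) (_ | _ | _) h
    all_goals first | exact h | exact (contracted G v).adj_symm h⟩
  loopless := ⟨by
    rintro (_ | a) h
    · exact h
    · exact (contracted G v).loopless.irrefl _ h⟩

end HubContraction

/-! The engine is a criterion for hubs, `mem_hubs`. Let `c` have non-adjacent neighbors `a`, `b`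
that are joined through each of two anticomplete sets, and in neither set through neighbors of `c`
alone. Induced paths through the two sets form a hole, and each path contains a non-neighbor of `c`,
hence a long sector. If `c` had no third neighbor on the hole, it would be the middle of a third
path of a theta. So in a theta-free graph `c` is a hub.

The first consequence is `no_stable_triple`: a component of `G ∖ N[v]` does not attach to three
pairwise non-adjacent non-hub neighbors of `v`, because the ways of joining the three attachments
inside the component give a hub, a theta or a pyramid. Thus no contracted vertex has a stable triple
among its neighbors. In particular it is neither an end of a theta nor the apex of a pyramid.

`Contraction` records what is used about passing from `G` to `H ∪ {v}`. A contracted vertex inside a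
path is harmless, since its fiber is connected and a path lifts to a connected set. The difficulty
lies with triangles: when a triangle containing a contracted vertex is lifted, one edge may be lost.
For a pyramid, a prism or a pinched prism the lift then either contains another excluded graph or
makes a non-hub neighbor of `v` a hub. In a clique, a contracted vertex can be replaced by `v`.

For wheels, two different long sectors force the non-neighbors of the center on the hole to be
disconnected (`IsWheel.exists_not_rch`). If the center is a non-hub of `G`, lifting the hole
contradicts the hub criterion (`Contraction.rch_of_hole`). If the center is a contracted vertex, the
absence of stable triples confines its neighbors on the hole so strongly that center and hole yield
a theta, a pyramid or a pinched prism of `H ∪ {v}`, which are already excluded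
(`Contraction.rch_of_hole_of_mem`). -/

namespace HubContraction

variable {V : Type*} {G : SimpleGraph V}

/-! ### Connectivity inside a vertex set -/

/-- `s` and `t` are joined by a walk of `G` all of whose vertices lie in `A`. -/
def Rch (G : SimpleGraph V) (A : Set V) (s t : V) : Prop :=
  s ∈ A ∧ Relation.ReflTransGen (fun x y => G.Adj x y ∧ y ∈ A) s t

/-- `A` and `B` are disjoint and anticomplete. -/
def Sep (G : SimpleGraph V) (A B : Set V) : Prop :=
  ∀ x ∈ A, ∀ y ∈ B, x ≠ y ∧ ¬ G.Adj x y

theorem Sep.symm {A B : Set V} (h : Sep G A B) : Sep G B A :=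
  fun x hx y hy => ⟨(h y hy x hx).1.symm, fun e => (h y hy x hx).2 e.symm⟩

theorem Sep.mono {A B A' B' : Set V} (h : Sep G A B) (hA : A' ⊆ A) (hB : B' ⊆ B) : Sep G A' B' :=
  fun x hx y hy => h x (hA hx) y (hB hy)

theorem Rch.left_mem {A : Set V} {s t : V} (h : Rch G A s t) : s ∈ A := h.1

theorem Rch.refl {A : Set V} {s : V} (h : s ∈ A) : Rch G A s s := ⟨h, .refl⟩

theorem Rch.closed {A : Set V} {s t : V} (h : Rch G A s t) (C : Set V) (hs : s ∈ C)
    (hC : ∀ x ∈ C, ∀ y ∈ A, G.Adj x y → y ∈ C) : t ∈ C := by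
  obtain ⟨_, h⟩ := h
  induction h with
  | refl => exact hs
  | tail _ h ih => exact hC _ ih _ h.2 h.1

theorem Rch.right_mem {A : Set V} {s t : V} (h : Rch G A s t) : t ∈ A :=
  h.closed A h.1 fun _ _ _ hy _ => hy

theorem Rch.trans {A : Set V} {s t u : V} (h : Rch G A s t) (h' : Rch G A t u) : Rch G A s u :=
  ⟨h.1, h.2.trans h'.2⟩

theorem Rch.tail {A : Set V} {s t u : V} (h : Rch G A s t) (e : G.Adj t u) (hu : u ∈ A) :
    Rch G A s u := ⟨h.1, h.2.tail ⟨e, hu⟩⟩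

theorem Rch.of_adj {A : Set V} {s t : V} (hs : s ∈ A) (ht : t ∈ A) (e : G.Adj s t) :
    Rch G A s t := (Rch.refl hs).tail e ht

theorem Rch.symm {A : Set V} {s t : V} (h : Rch G A s t) : Rch G A t s :=
  (h.closed {u | u ∈ A ∧ Rch G A u s} ⟨h.1, .refl h.1⟩ fun _ hx _ hy e =>
    ⟨hy, (Rch.of_adj hy hx.1 e.symm).trans hx.2⟩).2

theorem Rch.mono {A B : Set V} {s t : V} (h : Rch G A s t) (hAB : A ⊆ B) : Rch G B s t :=
  h.closed {u | Rch G B s u} (.refl (hAB h.1)) fun _ hx _ hy e => hx.tail e (hAB hy)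

theorem Rch.head {A : Set V} {s t u : V} (hs : s ∈ A) (e : G.Adj s t) (h : Rch G A t u) :
    Rch G A s u := (Rch.of_adj hs h.1 e).trans h

/-- A walk from `s` to `t ≠ s` leaves `s` for the last time. -/
theorem Rch.exists_adj {A : Set V} {s t : V} (h : Rch G A s t) (hst : s ≠ t) :
    ∃ u ∈ A, u ≠ s ∧ G.Adj s u ∧ Rch G (A \ {s}) u t := by
  have := h.closed {u | u = s ∨ ∃ w, G.Adj s w ∧ Rch G (A \ {s}) w u} (.inl rfl) ?_
  · rcases this with h1 | ⟨w, hw, h1⟩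
    · exact absurd h1.symm hst
    · exact ⟨w, h1.1.1, h1.1.2, hw, h1⟩
  · rintro x hx y hy e
    by_cases hys : y = s
    · exact .inl hys
    · right
      rcases hx with rfl | ⟨w, hw, h1⟩
      · exact ⟨y, e, .refl ⟨hy, hys⟩⟩
      · exact ⟨w, hw, h1.tail e ⟨hy, hys⟩⟩

theorem Rch.restrict {A : Set V} {s t : V} (h : Rch G A s t) :
    Rch G {u | Rch G A s u} s t :=
  h.closed {u | Rch G {u | Rch G A s u} s u} (.refl (.refl h.1))
    fun _ ha _ hb e => ha.tail e ((show Rch G A s _ from ha.right_mem).tail e hb)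

/-- The part of a walk up to the first visit of `T`. -/
theorem Rch.first_hit {A T : Set V} {s t : V} (h : Rch G A s t) (ht : t ∈ T) :
    ∃ Q ⊆ A, ∃ q ∈ T, Rch G Q s q ∧ (∀ u ∈ Q, u ∈ T → u = q) ∧
      ∀ u ∈ Q, u ≠ q → Rch G (Q \ T) s u := by
  by_cases hs : s ∈ T
  · refine ⟨{s}, by simpa using h.1, s, hs, .refl rfl, ?_, ?_⟩
    · rintro u rfl _; rfl
    · rintro u rfl h'; exact absurd rfl h'
  -- If no such `Q` exists, no edge leads from the component of `s` in `A \ T` to a vertex of `A ∩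
  -- T`: that component plus the vertex reached would serve as `Q`. So the component is closed in
  -- `A` and contains `t`.
  by_contra hcon
  have := h.closed {u | Rch G (A \ T) s u} (.refl ⟨h.1, hs⟩) ?_
  · exact this.right_mem.2 ht
  intro x hx y hy e
  by_cases hyT : y ∈ T
  · exfalso
    apply hcon
    refine ⟨insert y {u | Rch G (A \ T) s u}, ?_, y, hyT, ?_, ?_, ?_⟩
    · rintro u (rfl | hu)
      · exact hy
      · exact hu.right_mem.1
    · exact (hx.restrict.mono (Set.subset_insert _ _)).tail e (Set.mem_insert _ _)
    · rintro u (rfl | hu) huT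
      · rfl
      · exact absurd huT hu.right_mem.2
    · rintro u (rfl | hu) huy
      · exact absurd rfl huy
      · exact Rch.mono (Rch.restrict hu) fun w hw => ⟨.inr hw, hw.right_mem.2⟩
  · exact hx.tail e ⟨hy, hyT⟩

/-- A part of a walk from `S` to `T` with only its ends in `S` and in `T`. -/
theorem Rch.two_hits {A S T : Set V} {s t : V} (h : Rch G A s t) (hs : s ∈ S) (ht : t ∈ T) :
    ∃ Q ⊆ A, ∃ p ∈ S, ∃ q ∈ T, Rch G Q p q ∧ (∀ u ∈ Q, u ∈ S → u = p) ∧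
      ∀ u ∈ Q, u ∈ T → u = q := by
  obtain ⟨Q, hQ, q, hq, hr, hu, -⟩ := h.first_hit ht
  obtain ⟨Q', hQ', p, hp, hr', hu', -⟩ := hr.symm.first_hit hs
  exact ⟨Q', hQ'.trans hQ, p, hp, q, hq, hr'.symm, hu', fun u h => hu u (hQ' h)⟩

/-! ### Minimal connecting sets -/

/-- `A` is a minimal set containing a walk from `s` to `t`. -/
def Line (G : SimpleGraph V) (A : Set V) (s t : V) : Prop :=
  Rch G A s t ∧ ∀ r ∈ A, ¬ Rch G (A \ {r}) s t

theorem Line.symm {A : Set V} {s t : V} (h : Line G A s t) : Line G A t s :=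
  ⟨h.1.symm, fun r hr h' => h.2 r hr h'.symm⟩

theorem Line.eq_of_subset {A B : Set V} {s t : V} (h : Line G A s t) (hB : B ⊆ A)
    (hr : Rch G B s t) : B = A := by
  refine Set.Subset.antisymm hB fun x hx => ?_
  by_contra hxB
  exact h.2 x hx (hr.mono fun y hy => ⟨hB hy, by rintro rfl; exact hxB hy⟩)

theorem Rch.exists_line [Finite V] {A : Set V} {s t : V} (h : Rch G A s t) :
    ∃ B ⊆ A, Line G B s t := by
  obtain ⟨B, hB, hmin⟩ := (Set.toFinite {B | B ⊆ A ∧ Rch G B s t}).exists_minimal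
    ⟨A, subset_rfl, h⟩
  refine ⟨B, hB.1, hB.2, fun r hr h' => ?_⟩
  have := hmin (y := B \ {r}) ⟨Set.sdiff_subset.trans hB.1, h'⟩ Set.sdiff_subset
  exact (this hr).2 rfl

theorem Rch.exists_adj' {A : Set V} {s t : V} (h : Rch G A s t) (hst : s ≠ t) :
    ∃ u ∈ A, u ≠ s ∧ G.Adj s u := by
  obtain ⟨u, h1, h2, h3, -⟩ := h.exists_adj hst
  exact ⟨u, h1, h2, h3⟩

theorem Rch.cut {A : Set V} {s t r : V} (h : Rch G A s t) (hsep : ¬ Rch G (A \ {r}) s t) :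
    Rch G (insert r {u | Rch G (A \ {r}) s u}) s r := by
  by_cases hsr : s = r
  · subst hsr; exact .refl (Set.mem_insert _ _)
  by_contra hcon
  refine hsep (h.closed {u | Rch G (A \ {r}) s u} (.refl ⟨h.1, hsr⟩) ?_)
  intro x hx y hy e
  by_cases hyr : y = r
  · subst hyr
    exact absurd ((hx.restrict.mono (Set.subset_insert _ _)).tail e (Set.mem_insert _ _)) hcon
  · exact hx.tail e ⟨hy, hyr⟩

/-- Every vertex of `A` which separates `s` from `t` within `A` splits `A` into two sides. -/
theorem Rch.split {A : Set V} {s t r : V} (h : Rch G A s t) (hr : r ∈ A)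
    (hsep : ¬ Rch G (A \ {r}) s t) :
    ∃ A₁ A₂ : Set V, A = insert r (A₁ ∪ A₂) ∧ r ∉ A₁ ∧ r ∉ A₂ ∧ Sep G A₁ A₂ ∧
      Rch G (insert r A₁) s r ∧ Rch G (insert r A₂) r t ∧ (s ≠ r → s ∈ A₁) ∧ (t ≠ r → t ∈ A₂) ∧
      (∀ u, u ∈ A₁ ↔ Rch G (A \ {r}) s u) := by
  refine ⟨{u | Rch G (A \ {r}) s u}, {u | u ∈ A ∧ u ≠ r ∧ ¬ Rch G (A \ {r}) s u}, ?_, ?_, ?_, ?_,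
    h.cut hsep, ?_, ?_, ?_, fun u => Iff.rfl⟩
  · ext u
    simp only [Set.mem_insert_iff, Set.mem_union, Set.mem_ofPred_eq]
    constructor
    · intro hu; tauto
    · rintro (rfl | h1 | h1)
      · exact hr
      · exact h1.right_mem.1
      · exact h1.1
  · intro h1; exact h1.right_mem.2 rfl
  · intro h1; exact h1.2.1 rfl
  · intro x hx y hy
    refine ⟨?_, fun e => hy.2.2 (Rch.tail hx e ⟨hy.1, hy.2.1⟩)⟩
    rintro rfl; exact hy.2.2 hx
  · refine (h.symm.cut fun h' => hsep h'.symm).symm.mono (Set.insert_subset_insert ?_)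
    intro u hu
    have hu' : Rch G (A \ {r}) t u := hu
    exact ⟨hu'.right_mem.1, hu'.right_mem.2, fun h' => hsep (h'.trans hu'.symm)⟩
  · intro h1; exact Rch.refl ⟨h.1, h1⟩
  · intro h1; exact ⟨h.right_mem, h1, hsep⟩

theorem Line.reach {A : Set V} {s t u : V} (h : Line G A s t) (hu : u ∈ A) : Rch G A s u := by
  have := h.eq_of_subset (B := {u | Rch G A s u}) (fun u hu => Rch.right_mem hu) h.1.restrict
  rw [← this] at hu
  exact hu

/-- The first and the last vertex in `T` of a minimal path `A`, and the parts of `A` before and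
after them. -/
theorem Line.ends {A T : Set V} {s t : V} (h : Line G A s t) (hT : ∃ u ∈ A, u ∈ T) :
    ∃ L M : Set V, ∃ p q : V, L ⊆ A ∧ M ⊆ A ∧ p ∈ T ∧ q ∈ T ∧ Rch G L s p ∧ Rch G M q t ∧
      (∀ u ∈ L, u ∈ T → u = p) ∧ (∀ u ∈ M, u ∈ T → u = q) ∧
      (∀ x ∈ L, ∀ y ∈ M, (x = p ∧ y = q) ∨ (p = q ∧ (x = p ∨ y = q)) ∨ x ≠ y ∧ ¬ G.Adj x y) ∧
      (p = q ∨ G.Adj p q → ∀ u ∈ A, u ∈ T → u = p ∨ u = q) := by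
  -- `L` runs from `s` to its first vertex `p` in `T`, and `M` runs backwards from `t` to its first
  -- vertex `q` in `T`. A contact between them other than the allowed ones would be a shortcut
  -- avoiding `p` or `q`, against minimality.
  obtain ⟨w, hwA, hwT⟩ := hT
  obtain ⟨L, hL, p, hp, hLp, hLu, hLr⟩ := (h.reach hwA).first_hit hwT
  obtain ⟨M, hM, q, hq, hMq, hMu, hMr⟩ := (h.symm.reach h.1.right_mem |>.trans
    (h.symm.reach hwA)).first_hit hwT
  have hpA : p ∈ A := hL hLp.right_mem
  have hqA : q ∈ A := hM hMq.right_mem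
  have hLr' : ∀ u ∈ L, u ≠ p → Rch G (A \ T) s u := fun u hu hup =>
    (hLr u hu hup).mono (Set.sdiff_subset_sdiff_left hL)
  have hMr' : ∀ u ∈ M, u ≠ q → Rch G (A \ T) u t := fun u hu hup =>
    ((hMr u hu hup).mono (Set.sdiff_subset_sdiff_left hM)).symm
  refine ⟨L, M, p, q, hL, hM, hp, hq, hLp, hMq.symm, hLu, hMu, ?_, ?_⟩
  · intro x hx y hy
    by_cases hxp : x = p
    · by_cases hyq : y = q
      · exact .inl ⟨hxp, hyq⟩
      · by_cases hpq : p = q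
        · exact .inr (.inl ⟨hpq, .inl hxp⟩)
        · refine .inr (.inr ⟨?_, fun e => ?_⟩)
          · rintro rfl; exact hyq (hMu _ hy (hxp ▸ hp))
          · subst hxp
            have h1 : Rch G (A \ {q}) s x := hLp.mono fun u hu =>
              ⟨hL hu, by rintro rfl; exact hpq (hLu _ hu hq).symm⟩
            have h2 : Rch G (A \ {q}) y t := (hMr' y hy hyq).mono fun u hu =>
              ⟨hu.1, by rintro rfl; exact hu.2 hq⟩
            exact h.2 q hqA ((h1.tail e h2.1).trans h2)
    · have h1 := hLr' x hx hxp
      by_cases hyq : y = q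
      · by_cases hpq : p = q
        · exact .inr (.inl ⟨hpq, .inr hyq⟩)
        · refine .inr (.inr ⟨?_, fun e => ?_⟩)
          · rintro rfl; exact h1.right_mem.2 (hyq ▸ hq)
          · subst hyq
            have h1' : Rch G (A \ {p}) s x := h1.mono fun u hu =>
              ⟨hu.1, by rintro rfl; exact hu.2 hp⟩
            have h2 : Rch G (A \ {p}) y t := hMq.symm.mono fun u hu =>
              ⟨hM hu, by rintro rfl; exact hpq (hMu _ hu hp)⟩
            exact h.2 p hpA ((h1'.tail e h2.1).trans h2)
      · have h2 := hMr' y hy hyq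
        have h3 : ¬ Rch G (A \ T) s t := fun h3 => h.2 p hpA <| h3.mono fun u hu =>
          ⟨hu.1, by rintro rfl; exact hu.2 hp⟩
        refine .inr (.inr ⟨?_, fun e => h3 ((h1.tail e h2.1).trans h2)⟩)
        rintro rfl; exact h3 (h1.trans h2)
  · intro hpq u hu huT
    -- If `p` and `q` coincide or are adjacent, `L ∪ M` already joins `s` to `t`, so by minimality
    -- nothing of `A` lies outside it.
    have : L ∪ M = A := by
      refine h.eq_of_subset (Set.union_subset hL hM) ?_
      refine (hLp.mono Set.subset_union_left).trans
        (Rch.trans ?_ (hMq.symm.mono Set.subset_union_right))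
      rcases hpq with rfl | e
      · exact .refl (.inl hLp.right_mem)
      · exact .of_adj (.inl hLp.right_mem) (.inr hMq.right_mem) e
    rw [← this] at hu
    exact hu.imp (fun hu => hLu u hu huT) fun hu => hMu u hu huT

/-! ### Induced paths and holes as vertex sequences -/

theorem rch_of_walk {A : Set V} {s t : V} (p : G.Walk s t) (h : vset p ⊆ A) : Rch G A s t := by
  induction p with
  | nil => exact .refl (h (by simp [vset]))
  | cons e p ih =>
    exact Rch.head (h (by simp [vset])) e (ih fun z hz => h (by simp [vset] at hz ⊢; tauto))

theorem Rch.exists_walk {A : Set V} {s t : V} (h : Rch G A s t) : ∃ p : G.Walk s t, vset p ⊆ A := by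
  refine h.closed {u | ∃ p : G.Walk s u, vset p ⊆ A} ⟨.nil, ?_⟩ ?_
  · rintro z hz
    obtain rfl : z = s := by simpa [vset] using hz
    exact h.1
  · rintro x ⟨p, hp⟩ y hy e
    refine ⟨p.concat e, fun z hz => ?_⟩
    simp only [vset, SimpleGraph.Walk.support_concat, List.mem_append,
      List.mem_singleton, Set.mem_ofPred_eq] at hz
    rcases hz with hz | rfl
    · exact hp hz
    · exact hy

/-- A shortest walk inside `A` works: repeating a vertex or having a chord would allow a shorter
one. -/
theorem Rch.exists_indPath {A : Set V} {s t : V} (h : Rch G A s t) :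
    ∃ p : G.Walk s t, IsIndPath p ∧ vset p ⊆ A := by
  classical
  obtain ⟨p₀, hp₀⟩ := h.exists_walk
  have hex : ∃ n, ∃ p : G.Walk s t, vset p ⊆ A ∧ p.length = n := ⟨_, p₀, hp₀, rfl⟩
  obtain ⟨p, hp, hlen⟩ := Nat.find_spec hex
  have hmin : ∀ q : G.Walk s t, vset q ⊆ A → p.length ≤ q.length := fun q hq =>
    hlen ▸ Nat.find_min' hex ⟨q, hq, rfl⟩
  refine ⟨p, ⟨?_, ?_⟩, hp⟩
  · have := SimpleGraph.Walk.bypass_eq_self_of_length_le_length_bypass p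
      (hmin p.bypass fun z hz => hp (p.support_bypass_subset_support hz))
    rw [← this]
    exact p.bypass_isPath
  · rw [SimpleGraph.Walk.isChordless_iff_forall_mem_edges]
    have key : ∀ i j, i < j → j ≤ p.length → G.Adj (p.getVert i) (p.getVert j) → i + 1 = j := by
      intro i j hij hj e
      by_contra hne
      have := hmin ((p.take i).append (.cons e (p.drop j))) ?_
      · simp only [SimpleGraph.Walk.length_append, SimpleGraph.Walk.take_length,
          SimpleGraph.Walk.length_cons, SimpleGraph.Walk.drop_length] at this
        omega
      · intro z hz
        apply hp
        simp only [vset, SimpleGraph.Walk.mem_support_append_iff, SimpleGraph.Walk.support_cons,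
          List.mem_cons, Set.mem_ofPred_eq] at hz
        have h1 : ∀ z ∈ (p.take i).support, z ∈ p.support := by
          intro z hz
          obtain ⟨k, rfl, -⟩ := SimpleGraph.Walk.mem_support_iff_exists_getVert.1 hz
          rw [SimpleGraph.Walk.take_getVert]
          exact p.getVert_mem_support _
        rcases hz with hz | rfl | hz
        · exact h1 z hz
        · exact p.getVert_mem_support _
        · obtain ⟨k, rfl, -⟩ := SimpleGraph.Walk.mem_support_iff_exists_getVert.1 hz
          rw [SimpleGraph.Walk.drop_getVert]
          exact p.getVert_mem_support _
    intro u v hu hv e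
    obtain ⟨i, rfl, hi⟩ := SimpleGraph.Walk.mem_support_iff_exists_getVert.1 hu
    obtain ⟨j, rfl, hj⟩ := SimpleGraph.Walk.mem_support_iff_exists_getVert.1 hv
    rw [SimpleGraph.Walk.mk_mem_edges_iff_exists]
    rcases lt_trichotomy i j with hij | rfl | hij
    · obtain rfl := key i j hij hj e
      exact ⟨i, hj, rfl⟩
    · exact absurd rfl e.ne
    · obtain rfl := key j i hij hi e.symm
      exact ⟨j, hi, Sym2.eq_swap⟩

/-- The vertices `f 0, …, f n` form, in this order, an induced path. -/
def IndSeq (G : SimpleGraph V) (f : ℕ → V) (n : ℕ) : Prop :=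
  ∀ i ≤ n, ∀ j ≤ n, (f i = f j → i = j) ∧ (G.Adj (f i) (f j) ↔ i + 1 = j ∨ j + 1 = i)

/-- The vertices `f 0, …, f (n - 1)` form, in this order, an induced cycle. -/
def CycSeq (G : SimpleGraph V) (f : ℕ → V) (n : ℕ) : Prop :=
  ∀ i < n, ∀ j < n, (f i = f j → i = j) ∧
    (G.Adj (f i) (f j) ↔ i + 1 = j ∨ j + 1 = i ∨ (i = 0 ∧ j + 1 = n) ∨ (j = 0 ∧ i + 1 = n))

theorem IsIndPath.indSeq {s t : V} {p : G.Walk s t} (h : IsIndPath p) :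
    IndSeq G p.getVert p.length := by
  intro i hi j hj
  refine ⟨fun e => h.1.getVert_injOn hi hj e, fun e => ?_, ?_⟩
  · have := h.2.mem_edges (p.getVert_mem_support i) (p.getVert_mem_support j) e
    rw [SimpleGraph.Walk.mk_mem_edges_iff_exists] at this
    obtain ⟨k, hk, he⟩ := this
    have hk1 : k + 1 ≤ p.length := hk
    rcases Sym2.eq_iff.1 he with ⟨h1, h2⟩ | ⟨h1, h2⟩
    · have := h.1.getVert_injOn hi hk.le h1.symm
      have := h.1.getVert_injOn hj hk1 h2.symm
      omega
    · have := h.1.getVert_injOn hi hk1 h2.symm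
      have := h.1.getVert_injOn hj hk.le h1.symm
      omega
  · rintro (rfl | rfl)
    · exact p.adj_getVert_succ hj
    · exact (p.adj_getVert_succ hi).symm

theorem vset_eq_image {s t : V} (p : G.Walk s t) : vset p = p.getVert '' {i | i ≤ p.length} := by
  ext z
  simp only [vset, SimpleGraph.Walk.mem_support_iff_exists_getVert, Set.mem_image,
    Set.mem_ofPred_eq]
  exact ⟨fun ⟨k, h1, h2⟩ => ⟨k, h2, h1⟩, fun ⟨k, h1, h2⟩ => ⟨k, h2, h1⟩⟩

theorem cycleGraph_adj_iff {n : ℕ} (hn : 2 ≤ n) (i j : Fin n) :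
    (SimpleGraph.cycleGraph n).Adj i j ↔ (i : ℕ) + 1 = j ∨ (j : ℕ) + 1 = i ∨
      ((i : ℕ) = 0 ∧ (j : ℕ) + 1 = n) ∨ ((j : ℕ) = 0 ∧ (i : ℕ) + 1 = n) := by
  rw [SimpleGraph.cycleGraph_adj']
  rcases lt_trichotomy i j with h | rfl | h
  · rw [Fin.coe_sub_iff_lt.2 h, Fin.coe_sub_iff_le.2 h.le]
    have : (i : ℕ) < j := h
    omega
  · rw [Fin.coe_sub_iff_le.2 le_rfl]
    omega
  · rw [Fin.coe_sub_iff_lt.2 h, Fin.coe_sub_iff_le.2 h.le]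
    have : (j : ℕ) < i := h
    omega

theorem isHole_iff {W : Set V} :
    IsHole G W ↔ ∃ n ≥ 4, ∃ f : ℕ → V, CycSeq G f n ∧ W = f '' {i | i < n} := by
  constructor
  · rintro ⟨n, hn, ⟨φ⟩⟩
    have hn0 : 0 < n := by omega
    refine ⟨n, hn, fun i => if h : i < n then φ ⟨i, h⟩ else φ ⟨0, hn0⟩, ?_, ?_⟩
    · intro i hi j hj
      simp only [hi, hj, dif_pos]
      refine ⟨fun h => ?_, ?_⟩
      · have := φ.injective (Subtype.ext h)
        exact Fin.mk.inj_iff.1 this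
      · rw [← SimpleGraph.comap_adj (f := ((↑) : W → V)), ← cycleGraph_adj_iff (by omega) ⟨i, hi⟩ ⟨j, hj⟩]
        exact φ.map_adj_iff
    · ext w
      constructor
      · intro hw
        obtain ⟨i, hi⟩ := φ.surjective ⟨w, hw⟩
        exact ⟨i, i.2, by simp [hi]⟩
      · rintro ⟨i, hi, rfl⟩
        simp only [Set.mem_ofPred_eq] at hi
        simp only [hi, dif_pos]
        exact (φ _).2
  · rintro ⟨n, hn, f, hf, rfl⟩
    refine ⟨n, hn, ⟨⟨Equiv.ofBijective (fun i : Fin n => ⟨f i, i, i.2, rfl⟩) ⟨?_, ?_⟩, ?_⟩⟩⟩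
    · intro i j h
      exact Fin.ext ((hf i i.2 j j.2).1 (Subtype.ext_iff.1 h))
    · rintro ⟨_, i, hi, rfl⟩
      exact ⟨⟨i, hi⟩, rfl⟩
    · intro i j
      rw [cycleGraph_adj_iff (by omega)]
      exact (hf i i.2 j j.2).2

theorem CycSeq.rotate {f : ℕ → V} {n k : ℕ} (h : CycSeq G f n) (hk : k < n) :
    CycSeq G (fun i => if i + k < n then f (i + k) else f (i + k - n)) n := by
  intro i hi j hj
  dsimp only
  split_ifs with h1 h2 h2
  · have := h (i + k) h1 (j + k) h2
    exact ⟨fun e => by have := this.1 e; omega, by rw [this.2]; omega⟩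
  · have := h (i + k) h1 (j + k - n) (by omega)
    exact ⟨fun e => by have := this.1 e; omega, by rw [this.2]; omega⟩
  · have := h (i + k - n) (by omega) (j + k) h2
    exact ⟨fun e => by have := this.1 e; omega, by rw [this.2]; omega⟩
  · have := h (i + k - n) (by omega) (j + k - n) (by omega)
    exact ⟨fun e => by have := this.1 e; omega, by rw [this.2]; omega⟩

theorem CycSeq.reflect {f : ℕ → V} {n : ℕ} (h : CycSeq G f n) :
    CycSeq G (fun i => f (n - 1 - i)) n := by
  intro i hi j hj
  have := h (n - 1 - i) (by omega) (n - 1 - j) (by omega)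
  exact ⟨fun e => by have := this.1 e; omega, by rw [this.2]; omega⟩

theorem IsHole.exists_seq {W : Set V} {a : V} (h : IsHole G W) (ha : a ∈ W) :
    ∃ n ≥ 4, ∃ f : ℕ → V, CycSeq G f n ∧ W = f '' {i | i < n} ∧ f 0 = a := by
  obtain ⟨n, hn, f, hf, rfl⟩ := isHole_iff.1 h
  obtain ⟨k, hk, rfl⟩ := ha
  simp only [Set.mem_ofPred_eq] at hk
  refine ⟨n, hn, _, hf.rotate hk, ?_, by simp [hk]⟩
  ext w
  constructor
  · rintro ⟨i, hi, rfl⟩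
    simp only [Set.mem_ofPred_eq] at hi
    by_cases hik : k ≤ i
    · refine ⟨i - k, by simp only [Set.mem_ofPred_eq]; omega, ?_⟩
      dsimp only
      rw [if_pos (by omega)]; congr 1; omega
    · refine ⟨i + n - k, by simp only [Set.mem_ofPred_eq]; omega, ?_⟩
      dsimp only
      rw [if_neg (by omega)]; congr 1; omega
  · rintro ⟨i, hi, rfl⟩
    simp only [Set.mem_ofPred_eq] at hi
    dsimp only
    split_ifs
    · exact ⟨_, by simpa using by omega, rfl⟩
    · exact ⟨i + k - n, by simp only [Set.mem_ofPred_eq]; omega, rfl⟩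

theorem IsHole.exists_seq_of_adj {W : Set V} {a b : V} (h : IsHole G W) (ha : a ∈ W) (hb : b ∈ W)
    (hab : G.Adj a b) :
    ∃ n ≥ 4, ∃ f : ℕ → V, CycSeq G f n ∧ W = f '' {i | i < n} ∧ f 0 = a ∧ f (n - 1) = b := by
  obtain ⟨n, hn, f, hf, rfl, rfl⟩ := h.exists_seq ha
  obtain ⟨k, hk, rfl⟩ := hb
  simp only [Set.mem_ofPred_eq] at hk
  rw [(hf 0 (by omega) k hk).2] at hab
  by_cases hk1 : k + 1 = n
  · refine ⟨n, hn, f, hf, rfl, rfl, ?_⟩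
    congr 1; omega
  · have hk1 : k = 1 := by omega
    subst hk1
    refine ⟨n, hn, _, (hf.rotate hk).reflect, ?_, ?_, ?_⟩
    · ext w
      constructor
      · rintro ⟨i, hi, rfl⟩
        simp only [Set.mem_ofPred_eq] at hi
        by_cases hik : 1 ≤ i
        · refine ⟨n - i, by simp only [Set.mem_ofPred_eq]; omega, ?_⟩
          dsimp only
          rw [if_pos (by omega)]; congr 1; omega
        · refine ⟨0, by simp only [Set.mem_ofPred_eq]; omega, ?_⟩
          dsimp only
          rw [if_neg (by omega)]; congr 1; omega
      · rintro ⟨i, hi, rfl⟩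
        simp only [Set.mem_ofPred_eq] at hi
        dsimp only
        split_ifs
        · exact ⟨n - 1 - i + 1, by simp only [Set.mem_ofPred_eq]; omega, rfl⟩
        · exact ⟨n - 1 - i + 1 - n, by simp only [Set.mem_ofPred_eq]; omega, rfl⟩
    · rw [if_neg (by omega)]; congr 1; omega
    · rw [if_pos (by omega)]; congr 1; omega

theorem IndSeq.rch {f : ℕ → V} {n : ℕ} (h : IndSeq G f n) {A : Set V} {i j : ℕ} (hij : i ≤ j)
    (hj : j ≤ n) (hA : ∀ k, i ≤ k → k ≤ j → f k ∈ A) : Rch G A (f i) (f j) := by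
  induction j, hij using Nat.le_induction with
  | base => exact .refl (hA i le_rfl le_rfl)
  | succ j hij ih =>
    exact (ih (by omega) fun k h1 h2 => hA k h1 (by omega)).tail
      ((h j (by omega) (j + 1) hj).2.2 (.inl rfl)) (hA _ (by omega) le_rfl)

theorem IndSeq.line {f : ℕ → V} {n : ℕ} (h : IndSeq G f n) :
    Line G (f '' {i | i ≤ n}) (f 0) (f n) := by
  refine ⟨h.rch (Nat.zero_le _) le_rfl fun k _ hk => ⟨k, hk, rfl⟩, ?_⟩
  rintro _ ⟨r, hr, rfl⟩ hcon
  simp only [Set.mem_ofPred_eq] at hr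
  have h0r : 0 < r := by
    rcases Nat.eq_zero_or_pos r with rfl | h0
    · exact absurd rfl hcon.1.2
    · exact h0
  obtain ⟨i, hi, he⟩ := hcon.closed {u | ∃ i < r, f i = u} ⟨0, h0r, rfl⟩ (by
    rintro _ ⟨i, hi, rfl⟩ _ ⟨⟨j, hj, rfl⟩, hjr⟩ e
    simp only [Set.mem_ofPred_eq] at hj
    rw [(h i (by omega) j hj).2] at e
    have : j ≠ r := by rintro rfl; exact hjr rfl
    exact ⟨j, by omega, rfl⟩)
  have := (h i (by omega) n le_rfl).1 he
  omega

/-- Two non-adjacent vertices of a hole split it into two paths. -/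
theorem IsHole.split {W : Set V} {a b : V} (h : IsHole G W) (ha : a ∈ W) (hb : b ∈ W)
    (hab : a ≠ b) (hnab : ¬ G.Adj a b) :
    ∃ A B : Set V, W = A ∪ B ∪ {a, b} ∧ a ∉ A ∧ a ∉ B ∧ b ∉ A ∧ b ∉ B ∧ Sep G A B ∧
      Line G (A ∪ {a, b}) a b ∧ Line G (B ∪ {a, b}) a b := by
  obtain ⟨n, hn, f, hf, rfl, rfl⟩ := h.exists_seq ha
  obtain ⟨k, hk, rfl⟩ := hb
  simp only [Set.mem_ofPred_eq] at hk
  have hk0 : k ≠ 0 := by rintro rfl; exact hab rfl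
  rw [(hf 0 (by omega) k hk).2] at hnab
  have h1 : IndSeq G f k := by
    intro i hi j hj
    have := hf i (by omega) j (by omega)
    exact ⟨this.1, by rw [this.2]; omega⟩
  -- The second path runs from `f k` up to `f (n - 1)` and closes at index `n - k` with `f 0`.
  have h2 : IndSeq G (fun i => if i + k < n then f (i + k) else f 0) (n - k) := by
    intro i hi j hj
    dsimp only
    split_ifs with h1 h2 h2
    · have := hf (i + k) h1 (j + k) h2
      exact ⟨fun e => by have := this.1 e; omega, by rw [this.2]; omega⟩
    · have := hf (i + k) h1 0 (by omega)
      exact ⟨fun e => by have := this.1 e; omega, by rw [this.2]; omega⟩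
    · have := hf 0 (by omega) (j + k) h2
      exact ⟨fun e => by have := this.1 e; omega, by rw [this.2]; omega⟩
    · have := hf 0 (by omega) 0 (by omega)
      exact ⟨fun e => by omega, by rw [this.2]; omega⟩
  have hmem : ∀ P : ℕ → Prop, (∀ i, P i → i < n) → ∀ k < n, f k ∈ f '' {i | P i} ↔ P k := by
    intro P hP k hk
    constructor
    · rintro ⟨i, hi, e⟩
      rwa [← (hf i (hP i hi) k hk).1 e]
    · intro h
      exact ⟨k, h, rfl⟩
  refine ⟨f '' {i | 0 < i ∧ i < k}, f '' {i | k < i ∧ i < n}, ?_, ?_, ?_, ?_, ?_, ?_, ?_, ?_⟩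
  · ext w
    constructor
    · rintro ⟨i, hi, rfl⟩
      simp only [Set.mem_ofPred_eq] at hi
      by_cases h3 : i = 0
      · right; left; rw [h3]
      by_cases h4 : i = k
      · right; right; rw [h4]; rfl
      left
      by_cases h5 : i < k
      · left; exact ⟨i, ⟨by omega, h5⟩, rfl⟩
      · right; exact ⟨i, ⟨by omega, hi⟩, rfl⟩
    · rintro ((⟨i, ⟨h3, h4⟩, rfl⟩ | ⟨i, ⟨h3, h4⟩, rfl⟩) | rfl | rfl)
      · exact ⟨i, by simp only [Set.mem_ofPred_eq]; omega, rfl⟩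
      · exact ⟨i, by simp only [Set.mem_ofPred_eq]; omega, rfl⟩
      · exact ⟨0, by simp only [Set.mem_ofPred_eq]; omega, rfl⟩
      · exact ⟨k, by simp only [Set.mem_ofPred_eq]; omega, rfl⟩
  · rw [hmem _ (by omega) 0 (by omega)]; omega
  · rw [hmem _ (by omega) 0 (by omega)]; omega
  · rw [hmem _ (by omega) k (by omega)]; omega
  · rw [hmem _ (by omega) k (by omega)]; omega
  · rintro _ ⟨i, ⟨h3, h4⟩, rfl⟩ _ ⟨j, ⟨h5, h6⟩, rfl⟩
    have := hf i (by omega) j (by omega)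
    exact ⟨fun e => by have := this.1 e; omega, by rw [this.2]; omega⟩
  · convert h1.line using 1
    ext w
    constructor
    · rintro (⟨i, ⟨h3, h4⟩, rfl⟩ | rfl | rfl)
      · exact ⟨i, h4.le, rfl⟩
      · exact ⟨0, Nat.zero_le _, rfl⟩
      · exact ⟨k, Nat.le_refl k, rfl⟩
    · rintro ⟨i, hi, rfl⟩
      simp only [Set.mem_ofPred_eq] at hi
      by_cases h3 : i = 0
      · right; left; rw [h3]
      by_cases h4 : i = k
      · right; right; rw [h4]; rfl
      · left; exact ⟨i, ⟨by omega, by omega⟩, rfl⟩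
  · apply Line.symm
    convert h2.line using 1
    · ext w
      constructor
      · rintro (⟨i, ⟨h3, h4⟩, rfl⟩ | rfl | rfl)
        · refine ⟨i - k, by simp only [Set.mem_ofPred_eq]; omega, ?_⟩
          dsimp only
          rw [if_pos (by omega)]; congr 1; omega
        · refine ⟨n - k, by simp, ?_⟩
          dsimp only
          rw [if_neg (by omega)]
        · exact ⟨0, by simp, by simp [hk]⟩
      · rintro ⟨i, hi, rfl⟩
        simp only [Set.mem_ofPred_eq] at hi
        dsimp only
        split_ifs with h3
        · by_cases h4 : i = 0
          · right; right; rw [h4]; simp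
          · left; exact ⟨i + k, ⟨by omega, h3⟩, rfl⟩
        · right; left; rfl
    · simp [hk]
    · rw [if_neg (by omega)]

/-- Two induced paths with the same ends and anticomplete interiors form a hole. -/
theorem isHole_of_indPath {a b : V} {p q : G.Walk a b} (hp : IsIndPath p) (hq : IsIndPath q)
    (hab : a ≠ b) (hnab : ¬ G.Adj a b) (hsep : Sep G (pathInterior p) (pathInterior q)) :
    IsHole G (vset p ∪ vset q) := by
  have hP := hp.indSeq
  have hQ := hq.indSeq
  have hp0 := p.getVert_zero
  have hpl := p.getVert_length
  have hq0 := q.getVert_zero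
  have hql := q.getVert_length
  rw [vset_eq_image p, vset_eq_image q]
  have hcross : ∀ i j, 0 < i → i < p.length → 0 < j → j < q.length →
      p.getVert i ≠ q.getVert j ∧ ¬ G.Adj (p.getVert i) (q.getVert j) := by
    intro i j h1 h2 h3 h4
    refine hsep _ ⟨p.getVert_mem_support i, ?_, ?_⟩ _ ⟨q.getVert_mem_support j, ?_, ?_⟩
    · intro e
      have := (hP i h2.le 0 (Nat.zero_le _)).1 (e.trans hp0.symm); omega
    · intro e
      have := (hP i h2.le _ le_rfl).1 (e.trans hpl.symm); omega
    · intro e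
      have := (hQ j h4.le 0 (Nat.zero_le _)).1 (e.trans hq0.symm); omega
    · intro e
      have := (hQ j h4.le _ le_rfl).1 (e.trans hql.symm); omega
  generalize p.getVert = f at *
  generalize q.getVert = g at *
  generalize p.length = m at *
  generalize q.length = n at *
  subst hp0
  subst hpl
  have hm : 2 ≤ m := by
    by_contra hm
    have : m = 0 ∨ m = 1 := by omega
    rcases this with rfl | rfl
    · exact hab rfl
    · exact hnab ((hP 0 (by omega) 1 le_rfl).2.2 (.inl rfl))
  have hn : 2 ≤ n := by
    by_contra hm
    have : n = 0 ∨ n = 1 := by omega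
    rw [← hq0, ← hql] at hab hnab
    rcases this with rfl | rfl
    · exact hab rfl
    · exact hnab ((hQ 0 (by omega) 1 le_rfl).2.2 (.inl rfl))
  have hG : ∀ j, 0 < j → j < n → ∀ i ≤ m, f i ≠ g j ∧ (G.Adj (f i) (g j) ↔
      (i = 0 ∧ j = 1) ∨ (i = m ∧ j + 1 = n)) := by
    intro j hj hj' i hi
    by_cases h0 : i = 0
    · subst h0
      have := hQ 0 (by omega) j hj'.le
      rw [hq0] at this
      exact ⟨fun e => by have := this.1 e; omega, by rw [this.2]; omega⟩
    by_cases h1 : i = m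
    · subst h1
      have := hQ n le_rfl j hj'.le
      rw [hql] at this
      exact ⟨fun e => by have := this.1 e; omega, by rw [this.2]; omega⟩
    have := hcross i j (by omega) (by omega) hj hj'
    exact ⟨this.1, by simp only [this.2, false_iff]; omega⟩
  rw [isHole_iff]
  -- The cycle follows the first path from index `0` to `m`, then the interior of the second path
  -- backwards, so that index `i > m` is sent to `g (m + n - i)`.
  refine ⟨m + n, by omega, fun i => if i ≤ m then f i else g (m + n - i), ?_, ?_⟩
  · intro i hi j hj
    dsimp only
    split_ifs with h1 h2 h2
    · have := hP i h1 j h2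
      exact ⟨this.1, by rw [this.2]; omega⟩
    · have := hG (m + n - j) (by omega) (by omega) i h1
      exact ⟨fun e => absurd e this.1, by rw [this.2]; omega⟩
    · have := hG (m + n - i) (by omega) (by omega) j h2
      exact ⟨fun e => absurd e.symm this.1, by rw [G.adj_comm, this.2]; omega⟩
    · have := hQ (m + n - i) (by omega) (m + n - j) (by omega)
      exact ⟨fun e => by have := this.1 e; omega, by rw [this.2]; omega⟩
  · ext w
    constructor
    · rintro (⟨i, hi, rfl⟩ | ⟨i, hi, rfl⟩)
      · simp only [Set.mem_ofPred_eq] at hi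
        exact ⟨i, by simp only [Set.mem_ofPred_eq]; omega, by dsimp only; rw [if_pos hi]⟩
      · simp only [Set.mem_ofPred_eq] at hi
        by_cases h0 : i = 0
        · exact ⟨0, by simp only [Set.mem_ofPred_eq]; omega, by simp [h0, hq0]⟩
        by_cases h1 : i = n
        · exact ⟨m, by simp only [Set.mem_ofPred_eq]; omega, by simp [h1, hql]⟩
        · refine ⟨m + n - i, by simp only [Set.mem_ofPred_eq]; omega, ?_⟩
          dsimp only
          rw [if_neg (by omega)]; congr 1; omega
    · rintro ⟨i, hi, rfl⟩
      simp only [Set.mem_ofPred_eq] at hi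
      dsimp only
      split_ifs with h1
      · exact .inl ⟨i, h1, rfl⟩
      · exact .inr ⟨m + n - i, by simp only [Set.mem_ofPred_eq]; omega, rfl⟩

/-! ### Excluded graphs from loosely specified paths -/

theorem rch_vset {s t : V} (p : G.Walk s t) : Rch G (vset p) s t := rch_of_walk p subset_rfl

theorem two_le_length {a b : V} {p : G.Walk a b} (hab : a ≠ b) (hn : ¬ G.Adj a b) :
    2 ≤ p.length := by
  by_contra h
  have : p.length = 0 ∨ p.length = 1 := by omega
  rcases this with h | h
  · exact hab (SimpleGraph.Walk.eq_of_length_eq_zero h)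
  · exact hn (SimpleGraph.Walk.adj_of_length_eq_one h)

/-- Connected sets suffice in place of induced paths: shortest paths inside them are induced and
inherit the separation. The same device serves for pyramids, prisms and pinched prisms below. -/
theorem no_theta (hG : ∀ S, ¬ IsTheta G S) {a b : V} {A B C : Set V} (hab : a ≠ b)
    (hn : ¬ G.Adj a b) (hA : Rch G (A ∪ {a, b}) a b) (hB : Rch G (B ∪ {a, b}) a b)
    (hC : Rch G (C ∪ {a, b}) a b) (hAB : Sep G A B) (hAC : Sep G A C) (hBC : Sep G B C) :
    False := by
  obtain ⟨p, hp, hpA⟩ := hA.exists_indPath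
  obtain ⟨q, hq, hqB⟩ := hB.exists_indPath
  obtain ⟨r, hr, hrC⟩ := hC.exists_indPath
  have key : ∀ {A : Set V} {p : G.Walk a b}, vset p ⊆ A ∪ {a, b} → pathInterior p ⊆ A := by
    rintro A p h z ⟨hz, hza, hzb⟩
    rcases h hz with h | rfl | rfl
    · exact h
    · exact absurd rfl hza
    · exact absurd rfl hzb
  have hpq := hAB.mono (key hpA) (key hqB)
  have hpr := hAC.mono (key hpA) (key hrC)
  have hqr := hBC.mono (key hqB) (key hrC)
  have hsep : ∀ i j : Fin 3, i ≠ j →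
      Sep G (pathInterior (![p, q, r] i)) (pathInterior (![p, q, r] j)) := by
    intro i j hij
    fin_cases i <;> fin_cases j
    all_goals first
      | exact absurd rfl hij | exact hpq | exact hpr | exact hqr | exact hpq.symm
      | exact hpr.symm | exact hqr.symm
  refine hG _ ⟨a, b, ![p, q, r], hab, hn, ?_, fun i j hij => ⟨?_, ?_⟩, rfl⟩
  · intro i
    refine ⟨?_, two_le_length hab hn⟩
    fin_cases i
    · exact hp
    · exact hq
    · exact hr
  · exact Set.disjoint_left.2 fun x hx hx' => (hsep i j hij x hx x hx').1 rfl
  · exact fun x hx y hy => (hsep i j hij x hx y hy).2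

theorem no_pyramid_of_family (hG : ∀ S, ¬ IsPyramid G S) {a : V} {b : Fin 3 → V}
    {A : Fin 3 → Set V} (hb : ∀ i j, i ≠ j → G.Adj (b i) (b j))
    (hR : ∀ i, Rch G (insert a (A i)) a (b i)) (hne : ∀ i, b i ≠ a)
    (hcross : ∀ i j, i ≠ j → ∀ x ∈ A i, ∀ y ∈ A j, x ≠ y ∧ (G.Adj x y → x = b i ∧ y = b j))
    (hone : ∀ i j, i ≠ j → ¬ (G.Adj a (b i) ∧ G.Adj a (b j))) : False := by
  choose p hp hpA using fun i => (hR i).exists_indPath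
  have hpA' : ∀ i, vset (p i) \ {a} ⊆ A i := by
    rintro i z ⟨hz, hza⟩
    rcases hpA i hz with rfl | h
    · exact absurd rfl hza
    · exact h
  refine hG _ ⟨a, b, p, hb, fun i => ⟨hp i, ?_⟩, fun i j hij => ?_, fun i j hij x hx y hy => ?_,
    fun i j hij h => ?_, rfl⟩
  · by_contra h
    exact hne i (SimpleGraph.Walk.eq_of_length_eq_zero (p := p i) (by omega)).symm
  · exact Set.disjoint_left.2 fun x hx hx' => (hcross i j hij x (hpA' i hx) x (hpA' j hx')).1 rfl
  · exact (hcross i j hij x (hpA' i hx) y (hpA' j hy)).2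
  · exact hone i j hij ⟨SimpleGraph.Walk.adj_of_length_eq_one h.1,
      SimpleGraph.Walk.adj_of_length_eq_one h.2⟩

theorem no_pyramid (hG : ∀ S, ¬ IsPyramid G S) {a b₁ b₂ b₃ : V} {A₁ A₂ A₃ : Set V}
    (h₁₂ : G.Adj b₁ b₂) (h₁₃ : G.Adj b₁ b₃) (h₂₃ : G.Adj b₂ b₃)
    (hR₁ : Rch G (insert a A₁) a b₁) (hR₂ : Rch G (insert a A₂) a b₂)
    (hR₃ : Rch G (insert a A₃) a b₃) (hn₁ : b₁ ≠ a) (hn₂ : b₂ ≠ a) (hn₃ : b₃ ≠ a)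
    (hc₁₂ : ∀ x ∈ A₁, ∀ y ∈ A₂, x ≠ y ∧ (G.Adj x y → x = b₁ ∧ y = b₂))
    (hc₁₃ : ∀ x ∈ A₁, ∀ y ∈ A₃, x ≠ y ∧ (G.Adj x y → x = b₁ ∧ y = b₃))
    (hc₂₃ : ∀ x ∈ A₂, ∀ y ∈ A₃, x ≠ y ∧ (G.Adj x y → x = b₂ ∧ y = b₃))
    (ho₁₂ : ¬ (G.Adj a b₁ ∧ G.Adj a b₂)) (ho₁₃ : ¬ (G.Adj a b₁ ∧ G.Adj a b₃))
    (ho₂₃ : ¬ (G.Adj a b₂ ∧ G.Adj a b₃)) : False := by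
  have flip : ∀ {A B : Set V} {c d : V},
      (∀ x ∈ A, ∀ y ∈ B, x ≠ y ∧ (G.Adj x y → x = c ∧ y = d)) →
      ∀ x ∈ B, ∀ y ∈ A, x ≠ y ∧ (G.Adj x y → x = d ∧ y = c) := fun h x hx y hy =>
    ⟨(h y hy x hx).1.symm, fun e => ((h y hy x hx).2 e.symm).symm⟩
  refine no_pyramid_of_family hG (a := a) (b := ![b₁, b₂, b₃]) (A := ![A₁, A₂, A₃]) ?_ ?_ ?_ ?_ ?_
  · intro i j hij
    fin_cases i <;> fin_cases j
    all_goals first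
      | exact absurd rfl hij | exact h₁₂ | exact h₁₃ | exact h₂₃ | exact h₁₂.symm
      | exact h₁₃.symm | exact h₂₃.symm
  · intro i
    fin_cases i
    exacts [hR₁, hR₂, hR₃]
  · intro i
    fin_cases i
    exacts [hn₁, hn₂, hn₃]
  · intro i j hij
    fin_cases i <;> fin_cases j
    all_goals first
      | exact absurd rfl hij | exact hc₁₂ | exact hc₁₃ | exact hc₂₃ | exact flip hc₁₂
      | exact flip hc₁₃ | exact flip hc₂₃
  · intro i j hij
    fin_cases i <;> fin_cases j
    all_goals first
      | exact absurd rfl hij | exact ho₁₂ | exact ho₁₃ | exact ho₂₃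
      | exact fun h => ho₁₂ h.symm | exact fun h => ho₁₃ h.symm | exact fun h => ho₂₃ h.symm

theorem no_prism (hG : ∀ S, ¬ IsPrism G S) {a b : Fin 3 → V} {A : Fin 3 → Set V}
    (ha : ∀ i j, i ≠ j → G.Adj (a i) (a j)) (hb : ∀ i j, i ≠ j → G.Adj (b i) (b j))
    (hR : ∀ i, Rch G (A i) (a i) (b i)) (hne : ∀ i, a i ≠ b i)
    (hcross : ∀ i j, i ≠ j → ∀ x ∈ A i, ∀ y ∈ A j, x ≠ y ∧
      (G.Adj x y → (x = a i ∧ y = a j) ∨ (x = b i ∧ y = b j))) : False := by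
  choose p hp hpA using fun i => (hR i).exists_indPath
  refine hG _ ⟨a, b, p, ha, hb, fun i => ⟨hp i, ?_⟩, fun i j hij => ?_, fun i j hij x hx y hy => ?_,
    rfl⟩
  · by_contra h
    exact hne i (SimpleGraph.Walk.eq_of_length_eq_zero (p := p i) (by omega))
  · exact Set.disjoint_left.2 fun x hx hx' => (hcross i j hij x (hpA i hx) x (hpA j hx')).1 rfl
  · exact (hcross i j hij x (hpA i hx) y (hpA j hy)).2

theorem six_le_ncard {W : Set V} [Finite V] {a b c d e f : V} (ha : a ∈ W) (hb : b ∈ W)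
    (hc : c ∈ W) (hd : d ∈ W) (he : e ∈ W) (hf : f ∈ W)
    (h : [a, b, c, d, e, f].Nodup) : 6 ≤ W.ncard := by
  classical
  have := Set.ncard_le_ncard (s := (↑([a, b, c, d, e, f].toFinset) : Set V)) (t := W) ?_
  · rwa [Set.ncard_coe_finset, List.toFinset_card_of_nodup h] at this
  · intro x hx
    simp at hx
    rcases hx with rfl | rfl | rfl | rfl | rfl | rfl <;> assumption

theorem five_le_ncard {W : Set V} [Finite V] {a b c d e : V} (ha : a ∈ W) (hb : b ∈ W)
    (hc : c ∈ W) (hd : d ∈ W) (he : e ∈ W)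
    (h : [a, b, c, d, e].Nodup) : 5 ≤ W.ncard := by
  classical
  have := Set.ncard_le_ncard (s := (↑([a, b, c, d, e].toFinset) : Set V)) (t := W) ?_
  · rwa [Set.ncard_coe_finset, List.toFinset_card_of_nodup h] at this
  · intro x hx
    simp at hx
    rcases hx with rfl | rfl | rfl | rfl | rfl <;> assumption

theorem no_pinchedPrism [Finite V] (hG : ∀ S, ¬ IsPinchedPrism G S) {c x y z w : V} {A B : Set V}
    (hA : Rch G A x w) (hB : Rch G B y z) (hxy : G.Adj x y) (hzw : G.Adj w z)
    (hcross : ∀ p ∈ A, ∀ q ∈ B, p ≠ q ∧ (G.Adj p q → (p = x ∧ q = y) ∨ (p = w ∧ q = z)))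
    (hcA : c ∉ A) (hcB : c ∉ B) (hx : G.Adj c x) (hy : G.Adj c y) (hz : G.Adj c z) (hw : G.Adj c w)
    (hNA : ∀ u ∈ A, G.Adj c u → u = x ∨ u = w) (hNB : ∀ u ∈ B, G.Adj c u → u = y ∨ u = z)
    (hxw : x ≠ w) (hyz : y ≠ z) (nxw : ¬ G.Adj x w) (nyz : ¬ G.Adj y z) : False := by
  have hxA := hA.left_mem
  have hwA := hA.right_mem
  have hyB := hB.left_mem
  have hzB := hB.right_mem
  have hxz : x ≠ z := (hcross x hxA z hzB).1
  have nxz : ¬ G.Adj x z := fun e => by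
    rcases (hcross x hxA z hzB).2 e with h | h
    · exact hyz h.2.symm
    · exact hxw h.1
  have nwy : ¬ G.Adj w y := fun e => by
    rcases (hcross w hwA y hyB).2 e with h | h
    · exact hxw h.1.symm
    · exact hyz h.2
  -- Both paths are made to run from `x` to `z`: the one in `A` is prolonged by the edge `wz`, the
  -- one in `B` is preceded by the edge `xy`. Together they form the hole around `c`.
  obtain ⟨p, hp, hpA⟩ := ((hA.mono (Set.subset_insert z A)).tail hzw
    (Set.mem_insert _ _)).exists_indPath
  obtain ⟨q, hq, hqB⟩ := (Rch.head (Set.mem_insert _ _) hxy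
    (hB.mono (Set.subset_insert x B))).exists_indPath
  have hcp : c ∉ vset p := fun h => by
    rcases hpA h with rfl | h
    · exact hz.ne rfl
    · exact hcA h
  have hcq : c ∉ vset q := fun h => by
    rcases hqB h with rfl | h
    · exact hx.ne rfl
    · exact hcB h
  have hhole := isHole_of_indPath hp hq hxz nxz (fun u hu u' hu' => by
    rcases hpA hu.1 with rfl | h
    · exact absurd rfl hu.2.2
    rcases hqB hu'.1 with rfl | h'
    · exact absurd rfl hu'.2.1
    refine ⟨(hcross u h u' h').1, fun e => ?_⟩
    rcases (hcross u h u' h').2 e with h | h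
    · exact hu.2.1 h.1
    · exact hu'.2.2 h.2)
  have hwp : w ∈ vset p := by
    obtain ⟨u, hu, huz, e⟩ := (rch_vset p).symm.exists_adj' hxz.symm
    rcases hpA hu with rfl | h
    · exact absurd rfl huz
    rcases (hcross u h z hzB).2 e.symm with h | h
    · exact absurd h.2.symm hyz
    · exact h.1 ▸ hu
  have hyq : y ∈ vset q := by
    obtain ⟨u, hu, hux, e⟩ := (rch_vset q).exists_adj' hxz
    rcases hqB hu with rfl | h
    · exact absurd rfl hux
    rcases (hcross x hxA u h).2 e with h | h
    · exact h.2 ▸ hu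
    · exact absurd h.1 hxw
  -- The neighbor `u` of `x` on `p` and the neighbor `u'` of `z` on `q` are new, since `xw` and `yz`
  -- are non-edges. With `x, y, z, w` they give the six vertices required of the hole.
  obtain ⟨u, hu, hux, eu⟩ := (rch_vset p).exists_adj' hxz
  obtain ⟨u', hu', huz', eu'⟩ := (rch_vset q).symm.exists_adj' hxz.symm
  have huA : u ∈ A := by
    rcases hpA hu with rfl | h
    · exact absurd eu nxz
    · exact h
  have huB' : u' ∈ B := by
    rcases hqB hu' with rfl | h
    · exact absurd eu'.symm nxz
    · exact h
  have huw : u ≠ w := by rintro rfl; exact nxw eu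
  have huy' : u' ≠ y := by rintro rfl; exact nyz eu'.symm
  have hxp : x ∈ vset p := (rch_vset p).left_mem
  have hzp : z ∈ vset p := (rch_vset p).right_mem
  refine hG _ ⟨vset p ∪ vset q, c, hhole, ?_, ?_, ⟨x, y, z, w, ?_, hxy, hzw.symm, ?_, ?_⟩, rfl⟩
  · refine six_le_ncard (a := x) (b := y) (c := z) (d := w) (e := u) (f := u') (.inl hxp)
      (.inr hyq) (.inl hzp) (.inl hwp) (.inl hu) (.inr hu') ?_
    have h1 := (hcross x hxA u' huB').1
    have h2 := (hcross w hwA u' huB').1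
    have h3 := (hcross u huA u' huB').1
    have h4 := (hcross u huA y hyB).1
    have h5 := (hcross u huA z hzB).1
    have h6 := (hcross w hwA y hyB).1
    simp only [List.nodup_cons, List.mem_cons, List.not_mem_nil, or_false, not_or]
    refine ⟨⟨hxy.ne, hxz, hxw, hux.symm, h1⟩, ⟨hyz, h6.symm, h4.symm, huy'.symm⟩,
      ⟨hzw.ne.symm, h5.symm, huz'.symm⟩, ⟨huw.symm, h2⟩, h3, not_false, List.nodup_nil⟩
  · rintro (h | h)
    exacts [hcp h, hcq h]
  · ext v
    constructor
    · rintro ⟨e, h | h⟩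
      · rcases hpA h with rfl | h
        · simp
        · rcases hNA v h e with rfl | rfl <;> simp
      · rcases hqB h with rfl | h
        · simp
        · rcases hNB v h e with rfl | rfl <;> simp
    · rintro (rfl | rfl | rfl | rfl)
      · exact ⟨hx, .inl hxp⟩
      · exact ⟨hy, .inr hyq⟩
      · exact ⟨hz, .inl hzp⟩
      · exact ⟨hw, .inl hwp⟩
  · rw [Set.disjoint_left]
    have h6 := (hcross w hwA y hyB).1
    rintro v (rfl | rfl) (h | h)
    exacts [hxz h, hxw h, hyz h, h6.symm h]
  · rintro v (rfl | rfl) v' (rfl | rfl)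
    exacts [nxz, nxw, nyz, fun e => nwy e.symm]

/-! ### Recognizing hubs -/

/-- The non-neighbor `u` cuts the minimal path in two. Walking from `u` in both directions to the
first neighbor of `c` gives two sector ends, on separated sides of `u` and hence non-adjacent, which
makes the interior non-empty. -/
theorem Line.exists_longSector {L : Set V} {a b c u : V} (h : Line G L a b) (ha : G.Adj c a)
    (hb : G.Adj c b) (hu : u ∈ L) (hcu : ¬ G.Adj c u) :
    ∃ (y y' : V) (s : G.Walk y y'), IsIndPath s ∧ vset s ⊆ L ∧ G.Adj c y ∧ G.Adj c y' ∧
      (∀ z ∈ pathInterior s, ¬ G.Adj c z) ∧ (pathInterior s).Nonempty := by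
  obtain ⟨L₁, L₂, hL, -, -, hsep, h₁, h₂, -, -, -⟩ := h.1.split hu (h.2 u hu)
  obtain ⟨Q₁, hQ₁, y₁, hy₁, hr₁, hn₁, -⟩ := h₁.symm.first_hit (T := G.neighborSet c) ha
  obtain ⟨Q₂, hQ₂, y₂, hy₂, hr₂, hn₂, -⟩ := h₂.first_hit (T := G.neighborSet c) hb
  have h₁' : y₁ ∈ L₁ := by
    rcases hQ₁ hr₁.right_mem with rfl | h
    exacts [absurd hy₁ hcu, h]
  have h₂' : y₂ ∈ L₂ := by
    rcases hQ₂ hr₂.right_mem with rfl | h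
    exacts [absurd hy₂ hcu, h]
  obtain ⟨s, hs, hsQ⟩ := ((hr₁.symm.mono Set.subset_union_left).trans
    (hr₂.mono (Set.subset_union_right (s := Q₁)))).exists_indPath
  refine ⟨y₁, y₂, s, hs, ?_, hy₁, hy₂, ?_, ?_⟩
  · refine hsQ.trans ?_
    rw [hL]
    refine Set.union_subset (hQ₁.trans ?_) (hQ₂.trans ?_)
    · exact Set.insert_subset_insert Set.subset_union_left
    · exact Set.insert_subset_insert Set.subset_union_right
  · rintro z ⟨hz, hz₁, hz₂⟩ e
    rcases hsQ hz with h | h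
    · exact hz₁ (hn₁ z h e)
    · exact hz₂ (hn₂ z h e)
  · obtain ⟨hne, hna⟩ := hsep _ h₁' _ h₂'
    obtain ⟨z, hz, hzy, e⟩ := (rch_vset s).exists_adj' hne
    exact ⟨z, hz, hzy, by rintro rfl; exact hna e⟩

/-- A vertex with two non-adjacent neighbors `a` and `b`, joined by two anticomplete sets none of
which provides a path through neighbors of the vertex, is a hub. -/
theorem mem_hubs [Finite V] (hG : ∀ S, ¬ IsTheta G S) {c a b : V} {A B : Set V}
    (ca : G.Adj c a) (cb : G.Adj c b) (hab : a ≠ b) (hn : ¬ G.Adj a b)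
    (hA : Rch G (A ∪ {a, b}) a b) (hB : Rch G (B ∪ {a, b}) a b) (hAB : Sep G A B)
    (hcA : c ∉ A) (hcB : c ∉ B)
    (hNA : ¬ Rch G (A ∩ G.neighborSet c ∪ {a, b}) a b)
    (hNB : ¬ Rch G (B ∩ G.neighborSet c ∪ {a, b}) a b) : c ∈ hubs G := by
  have key : ∀ {A : Set V}, Rch G (A ∪ {a, b}) a b → c ∉ A →
      ¬ Rch G (A ∩ G.neighborSet c ∪ {a, b}) a b → ∃ p : G.Walk a b, IsIndPath p ∧
      vset p ⊆ A ∪ {a, b} ∧ Line G (vset p) a b ∧ c ∉ vset p ∧ ∃ u ∈ vset p, ¬ G.Adj c u := by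
    intro A hA hcA hN
    obtain ⟨L, hL, hline⟩ := hA.exists_line
    obtain ⟨p, hp, hpL⟩ := hline.1.exists_indPath
    have := hline.eq_of_subset hpL (rch_vset p)
    rw [← this] at hL hline
    refine ⟨p, hp, hL, hline, ?_, ?_⟩
    · intro h
      rcases hL h with h | rfl | rfl
      exacts [hcA h, ca.ne rfl, cb.ne rfl]
    -- A path consisting entirely of neighbors of `c` is what the last two hypotheses forbid.
    · by_contra! hcon
      refine hN ((rch_vset p).mono fun z hz => ?_)
      exact (hL hz).imp (fun h => ⟨h, hcon z hz⟩) id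
  obtain ⟨p, hp, hpA, hpL, hcp, u, hu, hcu⟩ := key hA hcA hNA
  obtain ⟨q, hq, hqB, hqL, hcq, u', hu', hcu'⟩ := key hB hcB hNB
  have hpI : ∀ z ∈ vset p, z ≠ a → z ≠ b → z ∈ A := by
    intro z hz h1 h2
    rcases hpA hz with h | h | h
    exacts [h, absurd h h1, absurd h h2]
  have hqI : ∀ z ∈ vset q, z ≠ a → z ≠ b → z ∈ B := by
    intro z hz h1 h2
    rcases hqB hz with h | h | h
    exacts [h, absurd h h1, absurd h h2]
  have hhole := isHole_of_indPath hp hq hab hn (hAB.mono (fun z hz => hpI z hz.1 hz.2.1 hz.2.2)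
    fun z hz => hqI z hz.1 hz.2.1 hz.2.2)
  -- If `a` and `b` were the only neighbors of `c` on the hole, the path through `c` would complete
  -- a theta with ends `a` and `b`.
  have hthird : ∃ w ∈ vset p ∪ vset q, G.Adj c w ∧ w ≠ a ∧ w ≠ b := by
    by_contra! hcon
    refine no_theta hG (A := vset p \ {a, b}) (B := vset q \ {a, b}) (C := {c}) hab hn
      ((rch_vset p).mono ?_) ((rch_vset q).mono ?_) ?_ ?_ ?_ ?_
    · intro z hz; by_cases h : z ∈ ({a, b} : Set V) <;> simp_all
    · intro z hz; by_cases h : z ∈ ({a, b} : Set V) <;> simp_all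
    · exact (Rch.of_adj (by simp) (by simp) ca.symm).tail cb (by simp)
    · rintro x ⟨hx, hx'⟩ y ⟨hy, hy'⟩
      simp only [Set.mem_insert_iff, Set.mem_singleton_iff, not_or] at hx' hy'
      exact hAB x (hpI x hx hx'.1 hx'.2) y (hqI y hy hy'.1 hy'.2)
    · rintro x ⟨hx, hx'⟩ y rfl
      refine ⟨by rintro rfl; exact hcp hx, fun e => hx' ?_⟩
      by_cases h : x = a
      · exact .inl h
      · exact .inr (hcon x (.inl hx) e.symm h)
    · rintro x ⟨hx, hx'⟩ y rfl
      refine ⟨by rintro rfl; exact hcq hx, fun e => hx' ?_⟩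
      by_cases h : x = a
      · exact .inl h
      · exact .inr (hcon x (.inr hx) e.symm h)
  obtain ⟨w, hw, hcw, hwa, hwb⟩ := hthird
  have hap := (rch_vset p).left_mem
  have hbp := (rch_vset p).right_mem
  have hua : u ≠ a := by rintro rfl; exact hcu ca
  have hub : u ≠ b := by rintro rfl; exact hcu cb
  have hua' : u' ≠ a := by rintro rfl; exact hcu' ca
  have hub' : u' ≠ b := by rintro rfl; exact hcu' cb
  have huw : u ≠ w := by rintro rfl; exact hcu hcw
  have huw' : u' ≠ w := by rintro rfl; exact hcu' hcw
  have huu' := (hAB u (hpI u hu hua hub) u' (hqI u' hu' hua' hub')).1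
  obtain ⟨x, y, s, hs, hsp, hx, hy, hsi, z, hz⟩ := hpL.exists_longSector ca cb hu hcu
  obtain ⟨x', y', s', hs', hsq, hx', hy', hsi', hne'⟩ := hqL.exists_longSector ca cb hu' hcu'
  refine ⟨vset p ∪ vset q, hhole, ?_, ?_, ?_, x, y, x', y', s, s',
    ⟨hs, hsp.trans Set.subset_union_left, hx, hy, hsi, z, hz⟩,
    ⟨hs', hsq.trans Set.subset_union_right, hx', hy', hsi', hne'⟩, ?_⟩
  · refine five_le_ncard (a := a) (b := b) (c := w) (d := u) (e := u') (.inl hap)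
      (.inl hbp) hw (.inl hu) (.inr hu') ?_
    simp only [List.nodup_cons, List.mem_cons, List.not_mem_nil, or_false, not_or]
    exact ⟨⟨hab, hwa.symm, hua.symm, hua'.symm⟩, ⟨hwb.symm, hub.symm, hub'.symm⟩,
      ⟨huw.symm, huw'.symm⟩, huu', not_false, List.nodup_nil⟩
  · rintro (h | h)
    exacts [hcp h, hcq h]
  · have : ({a, b, w} : Set V).ncard = 3 := by
      rw [Set.ncard_eq_three]
      exact ⟨a, b, w, hab, hwa.symm, hwb.symm, rfl⟩
    rw [← this]
    refine Set.ncard_le_ncard ?_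
    rintro v (rfl | rfl | rfl)
    exacts [⟨ca, .inl hap⟩, ⟨cb, .inl hbp⟩, ⟨hcw, hw⟩]
  -- An interior vertex of the first sector lies in `A`; if the sectors had the same vertices, it
  -- would lie in `B` as well.
  · intro heq
    have hza : z ≠ a := by rintro rfl; exact hsi _ hz ca
    have hzb : z ≠ b := by rintro rfl; exact hsi _ hz cb
    have hzs : z ∈ vset s' := heq ▸ hz.1
    exact (hAB z (hpI z (hsp hz.1) hza hzb) z (hqI z (hsq hzs) hza hzb)).1 rfl

/-- Adding `s` to the component of `t` in `A \ {s}` already gives a connection from `s` to `t`, so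
by minimality this is all of `A`. -/
theorem Line.reach_diff {A : Set V} {s t u : V} (h : Line G A s t) (hst : s ≠ t) (hu : u ∈ A)
    (hus : u ≠ s) : Rch G (A \ {s}) u t := by
  obtain ⟨w, hw, -, e, hr⟩ := h.1.exists_adj hst
  have hr' : Rch G {y | Rch G (A \ {s}) t y} t w := hr.symm.restrict
  have := h.eq_of_subset (B := insert s {y | Rch G (A \ {s}) t y}) ?_ ?_
  · rw [← this] at hu
    rcases hu with rfl | hu
    · exact absurd rfl hus
    · exact Rch.symm hu
  · rintro y (rfl | hy)
    · exact h.1.left_mem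
    · exact hy.right_mem.1
  · exact Rch.head (Set.mem_insert _ _) e (hr'.symm.mono (Set.subset_insert _ _))

/-- On each side the only possible successor of `v` is `y₁` or `y₂`, a non-neighbor of `c`; hence no
path from `v` to `r` in a side uses neighbors of `c` only, and `mem_hubs` applies. -/
theorem mem_hubs_of_sides [Finite V] (hG : ∀ S, ¬ IsTheta G S) {c v r y₁ y₂ : V} {S₁ S₂ : Set V}
    (cv : G.Adj c v) (cr : G.Adj c r) (hvr : v ≠ r) (nvr : ¬ G.Adj v r) (hsep : Sep G S₁ S₂)
    (hc₁ : c ∉ S₁) (hc₂ : c ∉ S₂) (hv₁ : G.Adj v y₁) (hv₂ : G.Adj v y₂)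
    (hr₁ : Rch G (insert r S₁) y₁ r) (hr₂ : Rch G (insert r S₂) y₂ r)
    (hu₁ : ∀ u ∈ S₁, G.Adj v u → u = y₁) (hu₂ : ∀ u ∈ S₂, G.Adj v u → u = y₂)
    (hn₁ : ¬ G.Adj c y₁) (hn₂ : ¬ G.Adj c y₂) : c ∈ hubs G := by
  have key : ∀ {S : Set V} {y : V}, G.Adj v y → Rch G (insert r S) y r →
      Rch G (S ∪ {v, r}) v r := fun hv hr => by
    refine Rch.head (by simp) hv (hr.mono ?_)
    rintro z (rfl | hz)
    · simp
    · exact .inl hz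
  have key' : ∀ {S : Set V} {y : V}, (∀ u ∈ S, G.Adj v u → u = y) → ¬ G.Adj c y →
      ¬ Rch G (S ∩ G.neighborSet c ∪ {v, r}) v r := fun hu hn h => by
    obtain ⟨u, hu', huv, e⟩ := h.exists_adj' hvr
    rcases hu' with ⟨h1, h2⟩ | rfl | rfl
    · exact hn (hu u h1 e ▸ h2)
    · exact huv rfl
    · exact nvr e
  exact mem_hubs hG cv cr hvr nvr (key hv₁ hr₁) (key hv₂ hr₂) hsep hc₁ hc₂ (key' hu₁ hn₁)
    (key' hu₂ hn₂)

/-! ### Attachments of a connected set far from `v` -/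

/-- A connected set anticomplete to `v` does not attach to three pairwise non-adjacent neighbors
of `v` none of which is a hub. -/
theorem no_stable_triple [Finite V] {t : ℕ} (hG : InClass t G) {v x₁ x₂ x₃ : V} {D : Set V}
    (hD : ∀ s ∈ D, ∀ t ∈ D, Rch G D s t) (hvD : v ∉ D) (hnD : ∀ d ∈ D, ¬ G.Adj v d)
    (hv₁ : G.Adj v x₁) (hv₂ : G.Adj v x₂) (hv₃ : G.Adj v x₃)
    (hh₁ : x₁ ∉ hubs G) (hh₂ : x₂ ∉ hubs G) (hh₃ : x₃ ∉ hubs G)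
    (h₁₂ : x₁ ≠ x₂) (h₁₃ : x₁ ≠ x₃) (h₂₃ : x₂ ≠ x₃)
    (n₁₂ : ¬ G.Adj x₁ x₂) (n₁₃ : ¬ G.Adj x₁ x₃) (n₂₃ : ¬ G.Adj x₂ x₃)
    (hd₁ : ∃ d ∈ D, G.Adj x₁ d) (hd₂ : ∃ d ∈ D, G.Adj x₂ d) (hd₃ : ∃ d ∈ D, G.Adj x₃ d) :
    False := by
  obtain ⟨d₁, hd₁, e₁⟩ := hd₁
  obtain ⟨d₂, hd₂, e₂⟩ := hd₂
  obtain ⟨d₃, hd₃, e₃⟩ := hd₃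
  have hx₁ : x₁ ∉ D := fun h => hnD _ h hv₁
  have hx₂ : x₂ ∉ D := fun h => hnD _ h hv₂
  have hx₃ : x₃ ∉ D := fun h => hnD _ h hv₃
  have hvne : ∀ d ∈ D, v ≠ d := by rintro d hd rfl; exact hvD hd
  obtain ⟨A, hA, hline⟩ := (show Rch G (D ∪ {x₁, x₃}) x₁ x₃ from
    Rch.head (by simp) e₁ (((hD _ hd₁ _ hd₃).mono Set.subset_union_left).tail e₃.symm
      (by simp))).exists_line
  have hx₁A := hline.1.left_mem
  have hx₃A := hline.1.right_mem
  have hAD : ∀ u ∈ A, u ≠ x₁ → u ≠ x₃ → u ∈ D := by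
    intro u hu h1 h3
    rcases hA hu with h | h | h
    exacts [h, absurd h h1, absurd h h3]
  have hvA : ∀ u ∈ A, G.Adj v u → u = x₁ ∨ u = x₃ := by
    intro u hu e
    rcases hA hu with h | h
    exacts [absurd e (hnD u h), h]
  have hx₂A : x₂ ∉ A := fun h => by
    rcases hA h with h | h | h
    exacts [hx₂ h, h₁₂ h.symm, h₂₃ h]
  -- A neighbor `r` of `x₂` on the minimal path `A` splits it into two sides. Together with `v`
  -- these lead from `v` to `r` through the non-neighbors `x₁` and `x₃` of `x₂`, so `x₂` would be a
  -- hub.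
  have hcA : ∀ r ∈ A, ¬ G.Adj x₂ r := by
    intro r hr e
    have hrx₁ : r ≠ x₁ := by rintro rfl; exact n₁₂ e.symm
    have hrx₃ : r ≠ x₃ := by rintro rfl; exact n₂₃ e
    have hrD : r ∈ D := hAD r hr hrx₁ hrx₃
    obtain ⟨A₁, A₂, rfl, -, -, hsep, hr₁, hr₂, hm₁, hm₂, -⟩ := hline.1.split hr (hline.2 r hr)
    refine hh₂ (mem_hubs_of_sides hG.theta_free hv₂.symm e (hvne r hrD) (hnD r hrD) hsep
      (fun h => hx₂A (by simp [h])) (fun h => hx₂A (by simp [h])) hv₁ hv₃ hr₁ hr₂.symm ?_ ?_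
      (fun e => n₁₂ e.symm) n₂₃)
    · intro u hu e
      rcases hvA u (by simp [hu]) e with rfl | rfl
      · rfl
      · exact absurd rfl (hsep u hu u (hm₂ hrx₃.symm)).1
    · intro u hu e
      rcases hvA u (by simp [hu]) e with rfl | rfl
      · exact absurd rfl (hsep u (hm₁ hrx₁.symm) u hu).1
      · rfl
  obtain ⟨y, hyA, hyx₁, ey⟩ := hline.1.exists_adj' h₁₃
  have hyx₃ : y ≠ x₃ := by rintro rfl; exact n₁₃ ey
  have hyD := hAD y hyA hyx₁ hyx₃
  -- A path leaves `x₂` through `D` and stops at the first vertex `q` that lies in `A ∩ D` or has a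
  -- neighbor there.
  obtain ⟨Q₀, hQ₀, q, hqT, hrQ₀, huQ₀, -⟩ := (show Rch G (insert x₂ D) x₂ y from
    Rch.head (Set.mem_insert _ _) e₂ ((hD _ hd₂ _ hyD).mono (Set.subset_insert _ _))).first_hit
    (T := {z | z ∈ A ∩ D ∨ ∃ y ∈ A ∩ D, G.Adj z y}) (.inl ⟨hyA, hyD⟩)
  obtain ⟨Q, hQ, hlineQ⟩ := hrQ₀.exists_line
  have hQD : ∀ u ∈ Q, u ≠ x₂ → u ∈ D := fun u hu h => by
    rcases hQ₀ (hQ hu) with rfl | h'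
    exacts [absurd rfl h, h']
  have hqx₂ : q ≠ x₂ := by
    rintro rfl
    rcases hqT with h | ⟨y, hy, e⟩
    · exact hx₂ h.2
    · exact hcA y hy.1 e
  have hqD : q ∈ D := hQD q hlineQ.1.right_mem hqx₂
  have hQT : ∀ u ∈ Q, u ≠ q → u ∉ A ∩ D ∧ ∀ y ∈ A ∩ D, ¬ G.Adj u y := fun u hu h =>
    ⟨fun h' => h (huQ₀ u (hQ hu) (.inl h')), fun y hy e => h (huQ₀ u (hQ hu) (.inr ⟨y, hy, e⟩))⟩
  -- If `q` were on `A`, its predecessor on `Q` would already have a neighbor in `A ∩ D`.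
  have hqA : q ∉ A := by
    intro h
    obtain ⟨u, hu, huq, e⟩ := hlineQ.1.symm.exists_adj' hqx₂
    exact (hQT u hu huq).2 q ⟨h, hqD⟩ e.symm
  obtain ⟨y₀, hy₀, ey₀⟩ : ∃ y ∈ A ∩ D, G.Adj q y := by
    rcases hqT with h | h
    exacts [absurd h.1 hqA, h]
  have hQA : ∀ u ∈ Q, u ∉ A := by
    intro u hu h
    have hux₂ : u ≠ x₂ := by rintro rfl; exact hx₂A h
    by_cases huq : u = q
    · exact hqA (huq ▸ h)
    · exact (hQT u hu huq).1 ⟨h, hQD u hu hux₂⟩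
  have hvQ : ∀ u ∈ Q, G.Adj v u → u = x₂ := fun u hu e => by
    by_contra h
    exact hnD u (hQD u hu h) e
  -- Either `Q` touches `x₁` or `x₃`, which makes one of these a hub, or `q` is the only vertex of
  -- `Q` with neighbors on `A`, which gives a theta or a pyramid.
  by_cases hz : ∃ z ∈ Q, G.Adj z x₁ ∨ G.Adj z x₃
  · obtain ⟨z₀, hz₀, hz₀'⟩ := hz
    obtain ⟨Q₁, hQ₁, z, hzT, hrz, hQ₁T, hQ₁r⟩ := (hlineQ.reach hz₀).first_hit
      (T := {z | G.Adj z x₁ ∨ G.Adj z x₃}) hz₀'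
    have hzQ : z ∈ Q := hQ₁ hrz.right_mem
    have hzx₂ : z ≠ x₂ := by
      rintro rfl
      rcases hzT with h | h
      exacts [n₁₂ h.symm, n₂₃ h]
    have hzD := hQD z hzQ hzx₂
    obtain ⟨B₁, B₂, hB, -, -, hsepB, -, hrB, hmB, hmB₂, hB₁⟩ :=
      hlineQ.1.split hzQ (hlineQ.2 z hzQ)
    have hQ₁B : ∀ u ∈ Q₁, u ≠ z → u ∈ B₁ := fun u hu h => (hB₁ u).2 <| by
      refine (hQ₁r u hu h).mono fun w hw => ⟨hQ₁ hw.1, ?_⟩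
      rintro rfl
      exact hw.2 hzT
    have hB₂Q : B₂ ⊆ Q := by rw [hB]; exact fun u hu => .inr (.inr hu)
    -- Here `z` is the first vertex of `Q` adjacent to `x₁` or `x₃`, `x` is such a neighbor and `x'`
    -- the other of the two. The sides joining `v` to `z` are `x₂` followed by the beginning of `Q`,
    -- and `x'` followed by part of `A`, the edge `y₀q` and the end of `Q`. Both start at
    -- non-neighbors of `x`, so `x` is a hub.
    have aux : ∀ x x', G.Adj v x → G.Adj v x' → x ∉ D → x ∉ A ∩ D → x ≠ x' → x ≠ x₂ → x' ≠ x₂ →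
        ¬ G.Adj x x' → ¬ G.Adj x x₂ → x' ∉ Q →
        (∀ u ∈ Q₁, u ≠ z → ¬ G.Adj u x') → Rch G (A ∩ D ∪ {x'}) x' y₀ → G.Adj x z →
        x ∈ hubs G := by
      intro x x' hvx hvx' hxD hxAD hxx' hxx₂ hx'x₂ nxx' nxx₂ hx'Q hQ₁x' hrx' exz
      have hxQ : x ∉ Q := fun h => hxD (hQD x h hxx₂)
      refine mem_hubs_of_sides hG.theta_free (S₁ := Q₁ \ {z}) (S₂ := B₂ ∪ (A ∩ D ∪ {x'}))
        hvx.symm exz (hvne z hzD) (hnD z hzD) ?_ (fun h => hxQ (hQ₁ h.1)) ?_ hv₂ hvx'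
        (hrz.mono ?_) ?_ ?_ ?_ nxx₂ nxx'
      · rintro u ⟨hu, huz⟩ w (hw | hw | rfl)
        · exact hsepB u (hQ₁B u hu huz) w hw
        · have huq : u ≠ q := by
            rintro rfl
            exact (hsepB u (hQ₁B u hu huz) u (hmB₂ fun h => huz h)).1 rfl
          have := hQT u (hQ₁ hu) huq
          exact ⟨by rintro rfl; exact this.1 hw, this.2 w hw⟩
        · exact ⟨by rintro rfl; exact hx'Q (hQ₁ hu), hQ₁x' u hu huz⟩
      · rintro (h | h | h)
        exacts [hxQ (hB₂Q h), hxAD h, hxx' h]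
      · intro u hu
        by_cases h : u = z
        exacts [.inl h, .inr ⟨hu, h⟩]
      · refine (hrx'.mono fun u hu => .inr (.inr hu)).trans ?_
        refine Rch.head (.inr (.inr (.inl hy₀))) ey₀.symm (hrB.symm.mono ?_)
        exact Set.insert_subset_insert Set.subset_union_left
      · exact fun u hu e => hvQ u (hQ₁ hu.1) e
      · rintro u (hu | hu | rfl) e
        · obtain rfl := hvQ u (hB₂Q hu) e
          exact absurd rfl (hsepB u (hmB hzx₂.symm) u hu).1
        · exact absurd e (hnD u hu.2)
        · rfl
    have hAx₁ : Rch G (A ∩ D ∪ {x₁}) x₁ y₀ := by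
      refine (hline.symm.reach_diff h₁₃.symm hy₀.1 ?_).symm.mono ?_
      · rintro rfl; exact hx₃ hy₀.2
      · rintro u ⟨hu, hu'⟩
        by_cases h : u = x₁
        exacts [.inr h, .inl ⟨hu, hAD u hu h hu'⟩]
    have hAx₃ : Rch G (A ∩ D ∪ {x₃}) x₃ y₀ := by
      refine (hline.reach_diff h₁₃ hy₀.1 ?_).symm.mono ?_
      · rintro rfl; exact hx₁ hy₀.2
      · rintro u ⟨hu, hu'⟩
        by_cases h : u = x₃
        exacts [.inr h, .inl ⟨hu, hAD u hu hu' h⟩]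
    rcases hzT with h | h
    · exact hh₁ (aux x₁ x₃ hv₁ hv₃ hx₁ (fun h => hx₁ h.2) h₁₃ h₁₂ h₂₃.symm n₁₃ n₁₂
        (fun h => hx₃ (hQD _ h h₂₃.symm)) (fun u hu huz e => huz (hQ₁T u hu (.inr e))) hAx₃ h.symm)
    · exact hh₃ (aux x₃ x₁ hv₃ hv₁ hx₃ (fun h => hx₃ h.2) h₁₃.symm h₂₃.symm h₁₂
        (fun e => n₁₃ e.symm) (fun e => n₂₃ e.symm)
        (fun h => hx₁ (hQD _ h h₁₂)) (fun u hu huz e => huz (hQ₁T u hu (.inl e))) hAx₁ h.symm)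
  · push Not at hz
    have hQedge : ∀ u ∈ Q, ∀ w ∈ A, u ≠ w ∧ (G.Adj u w → u = q) := by
      intro u hu w hw
      refine ⟨by rintro rfl; exact hQA u hu hw, fun e => ?_⟩
      by_contra huq
      refine (hQT u hu huq).2 w ⟨hw, hAD w hw ?_ ?_⟩ e
      · rintro rfl; exact (hz u hu).1 e
      · rintro rfl; exact (hz u hu).2 e
    have hqQ := hlineQ.1.right_mem
    -- Let `p` and `r` be the first and last neighbors of `q` on `A`. If they are equal, there is a
    -- theta with ends `v` and `p`; if adjacent, a pyramid with apex `v` and triangle `q, p, r`;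
    -- otherwise a theta with ends `v` and `q`.
    obtain ⟨L, M, p, r, hL, hM, hp, hr, hrL, hrM, hLu, hMu, hcross, hall⟩ :=
      hline.ends (T := G.neighborSet q) ⟨y₀, hy₀.1, ey₀⟩
    have hTD : ∀ w ∈ A, G.Adj q w → w ∈ D := by
      intro w hw e
      refine hAD w hw ?_ ?_
      · rintro rfl; exact (hz q hqQ).1 e
      · rintro rfl; exact (hz q hqQ).2 e
    have hpD := hTD p (hL hrL.right_mem) hp
    have hrD := hTD r (hM hrM.left_mem) hr
    by_cases hpr : p = r
    · subst hpr
      refine no_theta hG.theta_free (a := v) (b := p) (A := L \ {p}) (B := M \ {p}) (C := Q)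
        (hvne p hpD) (hnD p hpD) ?_ ?_ ?_ ?_ ?_ ?_
      · refine Rch.head (by simp) hv₁ (hrL.mono fun u hu => ?_)
        by_cases h : u = p <;> simp [h, hu]
      · refine Rch.head (by simp) hv₃ (hrM.symm.mono fun u hu => ?_)
        by_cases h : u = p <;> simp [h, hu]
      · refine Rch.head (by simp) hv₂ ((hlineQ.1.mono Set.subset_union_left).tail hp (by simp))
      · rintro x ⟨hx, hxp⟩ y ⟨hy, hyp⟩
        rcases hcross x hx y hy with h | h | h
        exacts [absurd h.1 hxp, absurd h.2 (not_or.2 ⟨hxp, hyp⟩), h]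
      · rintro x ⟨hx, hxp⟩ u hu
        refine ⟨(hQedge u hu x (hL hx)).1.symm, fun e => ?_⟩
        obtain rfl := (hQedge u hu x (hL hx)).2 e.symm
        exact hxp (hLu x hx e.symm)
      · rintro x ⟨hx, hxp⟩ u hu
        refine ⟨(hQedge u hu x (hM hx)).1.symm, fun e => ?_⟩
        obtain rfl := (hQedge u hu x (hM hx)).2 e.symm
        exact hxp (hMu x hx e.symm)
    · have hcross' : ∀ x ∈ L, ∀ y ∈ M, x ≠ y ∧ (G.Adj x y → x = p ∧ y = r) := by
        intro x hx y hy
        rcases hcross x hx y hy with h | h | h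
        · exact ⟨by rw [h.1, h.2]; exact hpr, fun _ => h⟩
        · exact absurd h.1 hpr
        · exact ⟨h.1, fun e => absurd e h.2⟩
      by_cases epr : G.Adj p r
      · refine no_pyramid hG.pyramid_free (a := v) (A₁ := Q) (A₂ := L) (A₃ := M) hp hr epr
          (Rch.head (by simp) hv₂ (hlineQ.1.mono (Set.subset_insert _ _)))
          (Rch.head (by simp) hv₁ (hrL.mono (Set.subset_insert _ _)))
          (Rch.head (by simp) hv₃ (hrM.symm.mono (Set.subset_insert _ _)))
          (hvne q hqD).symm (hvne p hpD).symm (hvne r hrD).symm ?_ ?_ hcross'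
          (fun h => hnD q hqD h.1) (fun h => hnD q hqD h.1) (fun h => hnD p hpD h.1)
        · intro u hu w hw
          refine ⟨(hQedge u hu w (hL hw)).1, fun e => ?_⟩
          obtain rfl := (hQedge u hu w (hL hw)).2 e
          exact ⟨rfl, hLu w hw e⟩
        · intro u hu w hw
          refine ⟨(hQedge u hu w (hM hw)).1, fun e => ?_⟩
          obtain rfl := (hQedge u hu w (hM hw)).2 e
          exact ⟨rfl, hMu w hw e⟩
      · refine no_theta hG.theta_free (a := v) (b := q) (A := L) (B := M) (C := Q \ {q})
          (hvne q hqD) (hnD q hqD) ?_ ?_ ?_ ?_ ?_ ?_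
        · exact Rch.head (by simp) hv₁ ((hrL.mono Set.subset_union_left).tail hp.symm (by simp))
        · exact Rch.head (by simp) hv₃
            ((hrM.symm.mono Set.subset_union_left).tail hr.symm (by simp))
        · refine Rch.head (by simp) hv₂ (hlineQ.1.mono fun u hu => ?_)
          by_cases h : u = q <;> simp [h, hu]
        · intro x hx y hy
          refine ⟨(hcross' x hx y hy).1, fun e => epr ?_⟩
          obtain ⟨rfl, rfl⟩ := (hcross' x hx y hy).2 e
          exact e
        · rintro x hx u ⟨hu, huq⟩
          exact ⟨(hQedge u hu x (hL hx)).1.symm, fun e => huq ((hQedge u hu x (hL hx)).2 e.symm)⟩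
        · rintro x hx u ⟨hu, huq⟩
          exact ⟨(hQedge u hu x (hM hx)).1.symm, fun e => huq ((hQedge u hu x (hM hx)).2 e.symm)⟩

/-! ### Three paths whose ends need not form triangles -/

theorem fin_three_others (i : Fin 3) :
    ∃ j k : Fin 3, j ≠ i ∧ k ≠ i ∧ j ≠ k ∧ ∀ l, l = i ∨ l = j ∨ l = k := by
  decide +revert

theorem fin_three_avoid (i l : Fin 3) : ∃ k : Fin 3, k ≠ i ∧ k ≠ l := by
  decide +revert

/-- Among the three vertices, exactly the two edges at `a i` are present. -/
def MidAt (G : SimpleGraph V) (a : Fin 3 → V) (i : Fin 3) : Prop :=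
  (∀ j, j ≠ i → G.Adj (a i) (a j)) ∧ ∀ j k, j ≠ i → k ≠ i → ¬ G.Adj (a j) (a k)

theorem triangle_or_midAt {a : Fin 3 → V} (h : ∃ i, ∀ j, j ≠ i → G.Adj (a i) (a j)) :
    (∀ i j, i ≠ j → G.Adj (a i) (a j)) ∨ ∃ i, MidAt G a i := by
  obtain ⟨i, hi⟩ := h
  obtain ⟨j, k, hji, hki, hjk, hall⟩ := fin_three_others i
  by_cases e : G.Adj (a j) (a k)
  · left
    have hj := hi j hji
    have hk := hi k hki
    intro l m hlm
    rcases hall l with rfl | rfl | rfl <;> rcases hall m with rfl | rfl | rfl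
    all_goals first
      | exact absurd rfl hlm | exact hj | exact hk | exact e | exact hj.symm | exact hk.symm
      | exact e.symm
  · refine .inr ⟨i, hi, fun l m hl hm => ?_⟩
    rcases hall l with rfl | rfl | rfl <;> rcases hall m with rfl | rfl | rfl
    all_goals first
      | exact absurd rfl hl | exact absurd rfl hm | exact e | exact fun h => e h.symm
      | exact G.loopless.irrefl _

/-- Three paths, from `a i` to `b i`, with no edges between them other than those between the
`a i` and between the `b i`. -/
structure ThreePaths (G : SimpleGraph V) (a b : Fin 3 → V) (A : Fin 3 → Set V) : Prop where
  rch : ∀ i, Rch G (A i) (a i) (b i)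
  cross : ∀ i j, i ≠ j → ∀ x ∈ A i, ∀ y ∈ A j, x ≠ y ∧
      (G.Adj x y → (x = a i ∧ y = a j) ∨ (x = b i ∧ y = b j))

theorem ThreePaths.symm {a b : Fin 3 → V} {A : Fin 3 → Set V} (h : ThreePaths G a b A) :
    ThreePaths G b a A :=
  ⟨fun i => (h.rch i).symm, fun i j hij x hx y hy =>
    ⟨(h.cross i j hij x hx y hy).1, fun e => ((h.cross i j hij x hx y hy).2 e).symm⟩⟩

/-- All three paths are non-trivial, or one is trivial and the two others have length at least
two. -/
def Proper (G : SimpleGraph V) (a b : Fin 3 → V) : Prop :=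
  (∀ i, a i ≠ b i) ∨ ∃ i, a i = b i ∧ (∀ j, j ≠ i → a j ≠ b j ∧ ¬ G.Adj (a j) (b j)) ∧
    ∀ j k, j ≠ i → k ≠ i → j ≠ k → G.Adj (a j) (a k) ∧ G.Adj (b j) (b k)

theorem Proper.symm {a b : Fin 3 → V} (h : Proper G a b) : Proper G b a := by
  rcases h with h | ⟨i, h1, h2, h3⟩
  · exact .inl fun i => (h i).symm
  · exact .inr ⟨i, h1.symm, fun j hj => ⟨(h2 j hj).1.symm, fun e => (h2 j hj).2 e.symm⟩,
      fun j k hj hk hjk => (h3 j k hj hk hjk).symm⟩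

theorem Proper.ne_of_midAt {a b : Fin 3 → V} {i : Fin 3} (h : Proper G a b) (hi : MidAt G a i) :
    a i ≠ b i := by
  rcases h with h | ⟨l, h1, h2, h3⟩
  · exact h i
  · by_cases hl : i = l
    · subst hl
      obtain ⟨j, k, hj, hk, hjk, -⟩ := fin_three_others i
      exact absurd (h3 j k hj hk hjk).1 (hi.2 j k hj hk)
    · exact (h2 i hl).1

/-- This supplies the requirement that at most one path of a pyramid has length one. -/
theorem Proper.unique {a b : Fin 3 → V} {i j : Fin 3} (h : Proper G a b) (hi : a i = b i)
    (hj : a j = b j ∨ G.Adj (a j) (b j)) : i = j := by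
  rcases h with h | ⟨l, h1, h2, h3⟩
  · exact absurd hi (h i)
  · have hil : i = l := by
      by_contra hne
      exact (h2 i hne).1 hi
    have hjl : j = l := by
      by_contra hne
      exact hj.elim (h2 j hne).1 (h2 j hne).2
    rw [hil, hjl]

/-- The middle vertex `a i` is the apex of a pyramid with base `b`: one path is the given one, the
other two start with the edges from `a i` to the remaining `a j`. An apex adjacent to `b l` for some
`l ≠ i` forces `a l = b l`, so two short paths would contradict `Proper`. -/
theorem ThreePaths.false_of_midAt_of_triangle {t : ℕ} (hG : InClass t G)
    {a b : Fin 3 → V} {A : Fin 3 → Set V} (h : ThreePaths G a b A) (hp : Proper G a b) {i : Fin 3}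
    (ha : MidAt G a i) (hb : ∀ i j, i ≠ j → G.Adj (b i) (b j)) : False := by
  obtain ⟨j, k, hji, hki, hjk, -⟩ := fin_three_others i
  have hm := fun l => (h.rch l).left_mem
  have hm' := fun l => (h.rch l).right_mem
  have hne := hp.ne_of_midAt ha
  have key : ∀ l, l ≠ i → Rch G (insert (a i) (A l)) (a i) (b l) := fun l hl =>
    Rch.head (by simp) (ha.1 l hl) ((h.rch l).mono (Set.subset_insert _ _))
  have hadj : ∀ l, l ≠ i → G.Adj (a i) (b l) → a l = b l := by
    intro l hl e
    rcases (h.cross i l hl.symm _ (hm i) _ (hm' l)).2 e with h' | h'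
    exacts [h'.2.symm, absurd h'.1 hne]
  have hcr : ∀ l, l ≠ i → ∀ x ∈ A i \ {a i}, ∀ y ∈ A l, x ≠ y ∧ (G.Adj x y → x = b i ∧ y = b l) := by
    intro l hl x hx y hy
    have := h.cross i l hl.symm x hx.1 y hy
    exact ⟨this.1, fun e => (this.2 e).resolve_left fun h' => hx.2 h'.1⟩
  refine no_pyramid hG.pyramid_free (a := a i) (A₁ := A i \ {a i}) (A₂ := A j) (A₃ := A k)
    (hb i j hji.symm) (hb i k hki.symm) (hb j k hjk)
    ((h.rch i).mono fun u hu => ?_) (key j hji) (key k hki) hne.symm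
    (h.cross j i hji _ (hm' j) _ (hm i)).1 (h.cross k i hki _ (hm' k) _ (hm i)).1
    (hcr j hji) (hcr k hki) ?_ ?_ ?_ ?_
  · by_cases hu' : u = a i <;> simp [hu', hu]
  · intro x hx y hy
    have := h.cross j k hjk x hx y hy
    refine ⟨this.1, fun e => (this.2 e).resolve_left ?_⟩
    rintro ⟨rfl, rfl⟩
    exact ha.2 j k hji hki e
  · rintro ⟨e, e'⟩
    exact hji (hp.unique (hadj j hji e') (.inr e))
  · rintro ⟨e, e'⟩
    exact hki (hp.unique (hadj k hki e') (.inr e))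
  · rintro ⟨e, e'⟩
    exact hjk (hp.unique (hadj j hji e) (.inl (hadj k hki e')))

/-- There is a theta with ends `a i` and `b l`. When `i = l` its paths are the three given ones, two
of them prolonged at both ends. When `i ≠ l`, path `i` is prolonged by `b i b l`, path `l` by `a i a
l`, and the third at both ends. The ends of the theta are adjacent only in the excluded case. -/
theorem ThreePaths.false_of_midAt_of_midAt {t : ℕ} (hG : InClass t G)
    {a b : Fin 3 → V} {A : Fin 3 → Set V} (h : ThreePaths G a b A) (hp : Proper G a b) {i l : Fin 3}
    (ha : MidAt G a i) (hb : MidAt G b l) (hil : ¬ (i = l ∧ G.Adj (a i) (b i))) : False := by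
  have hm := fun l => (h.rch l).left_mem
  have hm' := fun l => (h.rch l).right_mem
  have hne := hp.ne_of_midAt ha
  have hne' := hp.symm.ne_of_midAt hb
  have sep : ∀ j k, j ≠ k → ∀ X ⊆ A j, ∀ Y ⊆ A k,
      ¬ (a j ∈ X ∧ a k ∈ Y ∧ G.Adj (a j) (a k)) → ¬ (b j ∈ X ∧ b k ∈ Y ∧ G.Adj (b j) (b k)) →
      Sep G X Y := by
    intro j k hjk X hX Y hY h1 h2 x hx y hy
    have := h.cross j k hjk x (hX hx) y (hY hy)
    refine ⟨this.1, fun e => ?_⟩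
    rcases this.2 e with ⟨rfl, rfl⟩ | ⟨rfl, rfl⟩
    exacts [h1 ⟨hx, hy, e⟩, h2 ⟨hx, hy, e⟩]
  by_cases hil' : i = l
  · subst hil'
    have nab : ¬ G.Adj (a i) (b i) := fun e => hil ⟨rfl, e⟩
    obtain ⟨j, k, hji, hki, hjk, -⟩ := fin_three_others i
    have key : ∀ l, l ≠ i → Rch G (A l ∪ {a i, b i}) (a i) (b i) := fun l hl =>
      Rch.head (by simp) (ha.1 l hl) (((h.rch l).mono Set.subset_union_left).tail
        (hb.1 l hl).symm (by simp))
    refine no_theta hG.theta_free (A := A i \ {a i, b i}) (B := A j) (C := A k) hne nab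
      ((h.rch i).mono fun u hu => ?_) (key j hji) (key k hki) ?_ ?_ ?_
    · by_cases hu' : u ∈ ({a i, b i} : Set V)
      exacts [.inr hu', .inl ⟨hu, hu'⟩]
    · exact sep i j hji.symm _ Set.sdiff_subset _ subset_rfl (fun h => by simp at h)
        fun h => by simp at h
    · exact sep i k hki.symm _ Set.sdiff_subset _ subset_rfl (fun h => by simp at h)
        fun h => by simp at h
    · exact sep j k hjk _ subset_rfl _ subset_rfl (fun h => ha.2 j k hji hki h.2.2)
        fun h => hb.2 j k hji hki h.2.2
  · have hli : l ≠ i := Ne.symm hil'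
    obtain ⟨k, hki, hkl⟩ : ∃ k : Fin 3, k ≠ i ∧ k ≠ l := fin_three_avoid i l
    refine no_theta hG.theta_free (a := a i) (b := b l) (A := A i \ {a i}) (B := A l \ {b l})
      (C := A k) (h.cross i l hil' _ (hm i) _ (hm' l)).1 (fun e => ?_) ?_ ?_ ?_ ?_ ?_ ?_
    · rcases (h.cross i l hil' _ (hm i) _ (hm' l)).2 e with h' | h'
      exacts [hne' h'.2, hne h'.1]
    · refine Rch.tail ((h.rch i).mono fun u hu => ?_) (hb.1 i hil').symm (by simp)
      by_cases hu' : u = a i <;> simp [hu', hu]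
    · refine Rch.head (by simp) (ha.1 l hli) ((h.rch l).mono fun u hu => ?_)
      by_cases hu' : u = b l <;> simp [hu', hu]
    · exact Rch.head (by simp) (ha.1 k hki) (((h.rch k).mono Set.subset_union_left).tail
        (hb.1 k hkl).symm (by simp))
    · exact sep i l hil' _ Set.sdiff_subset _ Set.sdiff_subset (fun h => by simp at h)
        fun h => by simp at h
    · exact sep i k hki.symm _ Set.sdiff_subset _ subset_rfl (fun h => by simp at h)
        fun h => hb.2 i k hil' hkl h.2.2
    · exact sep l k hkl.symm _ Set.sdiff_subset _ subset_rfl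
        (fun h => ha.2 l k hli hki h.2.2) fun h => by simp at h

/-- Three non-trivial paths form a prism; a trivial one is the center of a pinched prism whose hole
consists of the two others. -/
theorem ThreePaths.false_of_triangle [Finite V] {t : ℕ} (hG : InClass t G)
    {a b : Fin 3 → V} {A : Fin 3 → Set V} (h : ThreePaths G a b A) (hp : Proper G a b)
    (ha : ∀ i j, i ≠ j → G.Adj (a i) (a j)) (hb : ∀ i j, i ≠ j → G.Adj (b i) (b j)) : False := by
  rcases hp with hne | ⟨i, hi, hne, -⟩
  · exact no_prism hG.prism_free ha hb h.rch hne h.cross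
  · obtain ⟨j, k, hji, hki, hjk, -⟩ := fin_three_others i
    have hN : ∀ l, l ≠ i → ∀ u ∈ A l, G.Adj (a i) u → u = a l ∨ u = b l := fun l hl u hu e =>
      ((h.cross i l hl.symm _ (h.rch i).left_mem u hu).2 e).imp And.right And.right
    exact no_pinchedPrism hG.pinchedPrism_free (c := a i) (h.rch j) (h.rch k) (ha j k hjk)
      (hb j k hjk) (h.cross j k hjk)
      (fun h' => (h.cross i j hji.symm _ (h.rch i).left_mem _ h').1 rfl)
      (fun h' => (h.cross i k hki.symm _ (h.rch i).left_mem _ h').1 rfl)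
      (ha i j hji.symm) (ha i k hki.symm) (hi ▸ hb i k hki.symm) (hi ▸ hb i j hji.symm)
      (hN j hji) (hN k hki) (hne j hji).1 (hne k hki).1 (hne j hji).2 (hne k hki).2

/-- What survives after excluding prisms, pinched prisms, pyramids and thetas: the same path is in
the middle at both ends, and its two ends are adjacent. -/
theorem ThreePaths.exists_midAt [Finite V] {t : ℕ} (hG : InClass t G)
    {a b : Fin 3 → V} {A : Fin 3 → Set V} (h : ThreePaths G a b A) (hp : Proper G a b)
    (ha : ∃ i, ∀ j, j ≠ i → G.Adj (a i) (a j)) (hb : ∃ i, ∀ j, j ≠ i → G.Adj (b i) (b j)) :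
    ∃ i, MidAt G a i ∧ MidAt G b i ∧ G.Adj (a i) (b i) := by
  rcases triangle_or_midAt ha with ha | ⟨i, hi⟩ <;> rcases triangle_or_midAt hb with hb | ⟨j, hj⟩
  · exact (h.false_of_triangle hG hp ha hb).elim
  · exact (h.symm.false_of_midAt_of_triangle hG hp.symm hj ha).elim
  · exact (h.false_of_midAt_of_triangle hG hp hi hb).elim
  · by_contra hcon
    refine h.false_of_midAt_of_midAt hG hp hi hj ?_
    rintro ⟨rfl, e⟩
    exact hcon ⟨i, hi, hj, e⟩

/-! ### Lifting thetas, pyramids, prisms and cliques through a contraction -/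

variable {W : Type*} {H : SimpleGraph W}

/-- The union of the fibers over `A`. -/
def pre (fib : W → Set V) (A : Set W) : Set V := {x | ∃ w ∈ A, x ∈ fib w}

theorem pre_union_pair_subset {fib : W → Set V} {A : Set W} {a b : W} {x y : V}
    (ha : fib a = {x}) (hb : fib b = {y}) : pre fib (A ∪ {a, b}) ⊆ pre fib A ∪ {x, y} := by
  rintro z ⟨w, hw | rfl | rfl, hz⟩
  · exact .inl ⟨w, hw, hz⟩
  · rw [ha] at hz; exact .inr (.inl hz)
  · rw [hb] at hz; exact .inr (.inr hz)

/-- The graph `H` arises from an induced subgraph of `G` by contracting the connected sets `fib w`;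
only the sets `fib w` with `w ∈ X` may have more than one vertex. These are anticomplete to `v`,
and all of their neighbors are neighbors of `v` other than hubs. -/
structure Contraction (G : SimpleGraph V) (H : SimpleGraph W) (v : V) (fib : W → Set V)
    (X : Set W) : Prop where
  conn : ∀ w, ∀ s ∈ fib w, ∀ t ∈ fib w, Rch G (fib w) s t
  disj : ∀ {w w' x y}, w ≠ w' → x ∈ fib w → y ∈ fib w' → x ≠ y
  adj : ∀ {w w' x y}, w ≠ w' → x ∈ fib w → y ∈ fib w' → G.Adj x y → H.Adj w w'
  exists_adj : ∀ {w w'}, H.Adj w w' → ∃ x ∈ fib w, ∃ y ∈ fib w', G.Adj x y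
  single : ∀ {w}, w ∉ X → ∃ u, fib w = {u}
  far : ∀ {w}, w ∈ X → v ∉ fib w ∧ ∀ d ∈ fib w, ¬ G.Adj v d
  nbr : ∀ {w w'}, w ∈ X → H.Adj w w' → w' ∉ X ∧ ∃ u, fib w' = {u} ∧ G.Adj v u ∧ u ∉ hubs G

namespace Contraction

variable {v : V} {fib : W → Set V} {X : Set W}

/-- Each edge of `H` comes from an edge between the two fibers, and connectedness of the fibers
bridges the gaps between consecutive edges. -/
theorem lift (C : Contraction G H v fib X) {A : Set W} {w w' : W} {s t : V} (h : Rch H A w w')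
    (hs : s ∈ fib w) (ht : t ∈ fib w') : Rch G (pre fib A) s t := by
  refine (h.closed {w | w ∈ A ∧ ∀ t ∈ fib w, Rch G (pre fib A) s t} ⟨h.left_mem, fun t ht => ?_⟩
    ?_).2 t ht
  · exact (C.conn w s hs t ht).mono fun x hx => ⟨w, h.left_mem, hx⟩
  · rintro x ⟨-, hx⟩ y hy e
    obtain ⟨p, hp, q, hq, e'⟩ := C.exists_adj e
    exact ⟨hy, fun t ht => ((hx p hp).tail e' ⟨y, hy, hq⟩).trans
      ((C.conn y q hq t ht).mono fun x hx => ⟨y, hy, hx⟩)⟩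

theorem proj (C : Contraction G H v fib X) {A : Set W} {w w' : W} {s t : V}
    (h : Rch G (pre fib A) s t) (hs : s ∈ fib w) (ht : t ∈ fib w') : Rch H A w w' := by
  have eq_of : ∀ {w w' x}, x ∈ fib w → x ∈ fib w' → w = w' := fun h h' => by
    by_contra hne
    exact C.disj hne h h' rfl
  have hw : w ∈ A := by
    obtain ⟨w₀, h0, h1⟩ := h.left_mem
    exact eq_of h1 hs ▸ h0
  obtain ⟨z, hz, hr⟩ := h.closed {x | ∃ z, x ∈ fib z ∧ Rch H A w z} ⟨w, hs, .refl hw⟩ (by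
    rintro x ⟨z, hx, hr⟩ y ⟨z', hz', hy⟩ e
    by_cases hzz : z = z'
    · exact ⟨z', hy, hzz ▸ hr⟩
    · exact ⟨z', hy, hr.tail (C.adj hzz hx hy e) hz'⟩)
  exact eq_of hz ht ▸ hr

theorem sep (C : Contraction G H v fib X) {A B : Set W} (h : Sep H A B) :
    Sep G (pre fib A) (pre fib B) := by
  rintro x ⟨w, hw, hx⟩ y ⟨w', hw', hy⟩
  have := h w hw w' hw'
  exact ⟨C.disj this.1 hx hy, fun e => this.2 (C.adj this.1 hx hy e)⟩

theorem adj_iff (C : Contraction G H v fib X) {w w' : W} {x y : V} (hw : fib w = {x})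
    (hw' : fib w' = {y}) (hne : w ≠ w') : G.Adj x y ↔ H.Adj w w' := by
  refine ⟨C.adj hne (by simp [hw]) (by simp [hw']), fun e => ?_⟩
  obtain ⟨p, hp, q, hq, e'⟩ := C.exists_adj e
  rw [hw] at hp
  rw [hw'] at hq
  rwa [← show p = x from hp, ← show q = y from hq]

theorem no_triple [Finite V] {t : ℕ} (C : Contraction G H v fib X) (hG : InClass t G)
    {w x₁ x₂ x₃ : W} (hw : w ∈ X) (h₁ : H.Adj w x₁) (h₂ : H.Adj w x₂) (h₃ : H.Adj w x₃)
    (h₁₂ : x₁ ≠ x₂) (h₁₃ : x₁ ≠ x₃) (h₂₃ : x₂ ≠ x₃)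
    (n₁₂ : ¬ H.Adj x₁ x₂) (n₁₃ : ¬ H.Adj x₁ x₃) (n₂₃ : ¬ H.Adj x₂ x₃) : False := by
  have att : ∀ {x y}, H.Adj w x → fib x = {y} → ∃ d ∈ fib w, G.Adj y d := fun h hy => by
    obtain ⟨p, hp, q, hq, e⟩ := C.exists_adj h
    rw [hy] at hq
    exact ⟨p, hp, by rw [← show q = _ from hq]; exact e.symm⟩
  obtain ⟨-, y₁, hy₁, v₁, u₁⟩ := C.nbr hw h₁
  obtain ⟨-, y₂, hy₂, v₂, u₂⟩ := C.nbr hw h₂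
  obtain ⟨-, y₃, hy₃, v₃, u₃⟩ := C.nbr hw h₃
  obtain ⟨hv, hn⟩ := C.far hw
  exact no_stable_triple hG (C.conn w) hv hn v₁ v₂ v₃ u₁ u₂ u₃
    (C.disj h₁₂ (by simp [hy₁]) (by simp [hy₂])) (C.disj h₁₃ (by simp [hy₁]) (by simp [hy₃]))
    (C.disj h₂₃ (by simp [hy₂]) (by simp [hy₃]))
    (fun e => n₁₂ ((C.adj_iff hy₁ hy₂ h₁₂).1 e)) (fun e => n₁₃ ((C.adj_iff hy₁ hy₃ h₁₃).1 e))
    (fun e => n₂₃ ((C.adj_iff hy₂ hy₃ h₂₃).1 e)) (att h₁ hy₁) (att h₂ hy₂) (att h₃ hy₃)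

/-- A clique of `H` has at most one vertex in `X`, and all neighbors of that vertex are neighbors of
`v`; so replacing it by `v` yields a clique of `G` of the same size. -/
theorem cliqueFree {t : ℕ} (C : Contraction G H v fib X) (hG : G.CliqueFree t) :
    H.CliqueFree t := by
  classical
  by_contra hcon
  have : Nonempty V := ⟨v⟩
  obtain ⟨f⟩ := SimpleGraph.not_cliqueFree_iff_top_isContained t |>.1 hcon
  have hadj : ∀ i j, i ≠ j → H.Adj (f i) (f j) := fun i j h => f.toHom.map_adj h
  choose! g hg using fun w (hw : w ∉ X) => C.single hw
  have key : ∀ i j, i ≠ j → f j ∉ X → G.Adj (if f i ∈ X then v else g (f i)) (g (f j)) := by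
    intro i j h hj
    have e := hadj i j h
    split_ifs with hi
    · obtain ⟨-, u, hu, hv, -⟩ := C.nbr hi e
      rw [hg _ hj] at hu
      rwa [Set.singleton_injective hu]
    · exact (C.adj_iff (hg _ hi) (hg _ hj) e.ne).2 e
  have hom : ∀ i j, i ≠ j → G.Adj (if f i ∈ X then v else g (f i))
      (if f j ∈ X then v else g (f j)) := by
    intro i j h
    by_cases hj : f j ∈ X
    · have hi : f i ∉ X := fun hi => (C.nbr hi (hadj i j h)).1 hj
      have := key j i h.symm hi
      rw [if_neg hi]
      exact this.symm
    · rw [if_neg hj]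
      exact key i j h hj
  refine (SimpleGraph.not_cliqueFree_iff_top_isContained t).2
    ⟨⟨⟨fun i => if f i ∈ X then v else g (f i), fun {i j} h => hom i j h⟩, fun i j h => ?_⟩⟩ hG
  by_contra hne
  exact (hom i j hne).ne h

/-- An end in `X` would have a stable triple of neighbors, one on each path. If neither end is in
`X`, both ends lift to single vertices and the interiors to separated connecting sets. -/
theorem theta_free [Finite V] {t : ℕ} (C : Contraction G H v fib X) (hG : InClass t G) (S : Set W) :
    ¬ IsTheta H S := by
  rintro ⟨a, b, p, hab, hnab, hp, hsep, -⟩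
  have hR : ∀ i, Rch H (pathInterior (p i) ∪ {a, b}) a b := fun i => by
    refine (rch_vset (p i)).mono fun z hz => ?_
    by_cases h : z ∈ ({a, b} : Set W)
    · exact .inr h
    · exact .inl ⟨hz, fun e => h (.inl e), fun e => h (.inr e)⟩
  have hS : ∀ i j, i ≠ j → Sep H (pathInterior (p i)) (pathInterior (p j)) := by
    intro i j hij x hx y hy
    refine ⟨?_, (hsep i j hij).2 x hx y hy⟩
    rintro rfl
    exact Set.disjoint_left.1 (hsep i j hij).1 hx hy
  have key : ∀ c ∈ X, (∀ i, ∃ x ∈ pathInterior (p i), H.Adj c x) → False := by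
    intro c hc h
    choose x hx e using h
    have h01 := hS 0 1 (by decide) _ (hx 0) _ (hx 1)
    have h02 := hS 0 2 (by decide) _ (hx 0) _ (hx 2)
    have h12 := hS 1 2 (by decide) _ (hx 1) _ (hx 2)
    exact C.no_triple hG hc (e 0) (e 1) (e 2) h01.1 h02.1 h12.1 h01.2 h02.2 h12.2
  by_cases ha : a ∈ X
  · refine key a ha fun i => ?_
    obtain ⟨x, hx, hxa, e⟩ := (hR i).exists_adj' hab
    rcases hx with hx | rfl | rfl
    exacts [⟨x, hx, e⟩, absurd rfl hxa, absurd e hnab]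
  by_cases hb : b ∈ X
  · refine key b hb fun i => ?_
    obtain ⟨x, hx, hxa, e⟩ := (hR i).symm.exists_adj' hab.symm
    rcases hx with hx | rfl | rfl
    exacts [⟨x, hx, e⟩, absurd e.symm hnab, absurd rfl hxa]
  obtain ⟨a', ha'⟩ := C.single ha
  obtain ⟨b', hb'⟩ := C.single hb
  have hR' : ∀ i, Rch G (pre fib (pathInterior (p i)) ∪ {a', b'}) a' b' := fun i =>
    (C.lift (hR i) (by simp [ha']) (by simp [hb'])).mono (pre_union_pair_subset ha' hb')
  exact no_theta hG.theta_free (C.disj hab (by simp [ha']) (by simp [hb']))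
    (fun e => hnab ((C.adj_iff ha' hb' hab).1 e)) (hR' 0) (hR' 1) (hR' 2)
    (C.sep (hS 0 1 (by decide))) (C.sep (hS 0 2 (by decide))) (C.sep (hS 1 2 (by decide)))

/-- A non-hub `c` whose non-neighbors on a hole are disconnected. -/
theorem rch_of_hole [Finite V] {t : ℕ} (C : Contraction G H v fib X) (hG : InClass t G)
    {Z : Set W} {c u₁ u₂ : W} {x : V} (hZ : IsHole H Z) (hcZ : c ∉ Z) (hx : fib c = {x})
    (hxh : x ∉ hubs G) (hu₁ : u₁ ∈ Z) (hu₂ : u₂ ∈ Z) (n₁ : ¬ H.Adj c u₁) (n₂ : ¬ H.Adj c u₂) :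
    Rch H (Z \ H.neighborSet c) u₁ u₂ := by
  by_contra hcon
  have hne : u₁ ≠ u₂ := by
    rintro rfl
    exact hcon (.refl ⟨hu₁, n₁⟩)
  have hna : ¬ H.Adj u₁ u₂ := fun e => hcon (.of_adj ⟨hu₁, n₁⟩ ⟨hu₂, n₂⟩ e)
  obtain ⟨R, R', rfl, h₁R, h₁R', h₂R, h₂R', hsep, hl, hl'⟩ := hZ.split hu₁ hu₂ hne hna
  -- On either part of the hole, `c` has a neighbor outside `X`. If the neighbor `a` found first is
  -- in `X`, then `c` and the two neighbors of `a` on the path are neighbors of `a`. They are not a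
  -- stable triple, so `c` is adjacent to one of those two, which is outside `X`.
  have choose_end : ∀ P : Set W, P ∪ {u₁, u₂} ⊆ R ∪ R' ∪ {u₁, u₂} → Line H (P ∪ {u₁, u₂}) u₁ u₂ →
      ∃ a ∈ P, H.Adj c a ∧ a ∉ X := by
    intro P hP hl
    have hN : ∀ w ∈ P ∪ {u₁, u₂}, H.Adj c w → w ∈ P := by
      rintro w (hw | rfl | rfl) e
      exacts [hw, absurd e n₁, absurd e n₂]
    obtain ⟨a, ha, e⟩ : ∃ a ∈ P, H.Adj c a := by
      by_contra! h
      refine hcon (hl.1.mono fun z hz => ⟨hP hz, fun e => h z (hN z hz e) e⟩)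
    by_cases haX : a ∈ X
    swap
    · exact ⟨a, ha, e, haX⟩
    have hau₁ : u₁ ≠ a := by rintro rfl; exact n₁ e
    have hau₂ : u₂ ≠ a := by rintro rfl; exact n₂ e
    obtain ⟨P₁, P₂, hPe, -, -, hs, hr₁, hr₂, -, -, -⟩ := hl.1.split (.inl ha) (hl.2 a (.inl ha))
    obtain ⟨w₁, hw₁, hwa₁, e₁⟩ := hr₁.symm.exists_adj' hau₁.symm
    obtain ⟨w₂, hw₂, hwa₂, e₂⟩ := hr₂.exists_adj' hau₂.symm
    replace hw₁ := hw₁.resolve_left hwa₁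
    replace hw₂ := hw₂.resolve_left hwa₂
    have hm₁ : w₁ ∈ P ∪ {u₁, u₂} := by rw [hPe]; exact .inr (.inl hw₁)
    have hm₂ : w₂ ∈ P ∪ {u₁, u₂} := by rw [hPe]; exact .inr (.inr hw₂)
    by_cases f₁ : H.Adj c w₁
    · exact ⟨w₁, hN w₁ hm₁ f₁, f₁, (C.nbr haX e₁).1⟩
    by_cases f₂ : H.Adj c w₂
    · exact ⟨w₂, hN w₂ hm₂ f₂, f₂, (C.nbr haX e₂).1⟩
    have := hs w₁ hw₁ w₂ hw₂
    exact (C.no_triple hG haX e.symm e₁ e₂ (by rintro rfl; exact hcZ (hP hm₁))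
      (by rintro rfl; exact hcZ (hP hm₂)) this.1 f₁ f₂ this.2).elim
  have hRZ : R ∪ {u₁, u₂} ⊆ R ∪ R' ∪ {u₁, u₂} :=
    Set.union_subset_union_left _ Set.subset_union_left
  have hRZ' : R' ∪ {u₁, u₂} ⊆ R ∪ R' ∪ {u₁, u₂} :=
    Set.union_subset_union_left _ Set.subset_union_right
  obtain ⟨a, haR, ca, haX⟩ := choose_end R hRZ hl
  obtain ⟨b, hbR, cb, hbX⟩ := choose_end R' hRZ' hl'
  have hau₁ : u₁ ≠ a := by rintro rfl; exact n₁ ca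
  have hau₂ : u₂ ≠ a := by rintro rfl; exact n₂ ca
  have hbu₁ : u₁ ≠ b := by rintro rfl; exact n₁ cb
  have hbu₂ : u₂ ≠ b := by rintro rfl; exact n₂ cb
  -- The hole is cut again, now at `a` and `b`: the two sides are the part through `u₁`, namely `P₁
  -- ∪ P₁'`, and the part through `u₂`, namely `P₂ ∪ P₂'`.
  obtain ⟨P₁, P₂, hP, -, -, hs, hr₁, hr₂, hm₁, hm₂, -⟩ :=
    hl.1.split (.inl haR) (hl.2 a (.inl haR))
  obtain ⟨P₁', P₂', hP', -, -, hs', hr₁', hr₂', hm₁', hm₂', -⟩ :=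
    hl'.1.split (.inl hbR) (hl'.2 b (.inl hbR))
  replace hm₁ := hm₁ hau₁
  replace hm₂ := hm₂ hau₂
  replace hm₁' := hm₁' hbu₁
  replace hm₂' := hm₂' hbu₂
  have memP : ∀ y, y ∈ P₁ ∪ P₂ → y ∈ R ∨ y = u₁ ∨ y = u₂ := fun y hy => by
    have : y ∈ R ∪ {u₁, u₂} := by rw [hP]; exact .inr hy
    exact this
  have memP' : ∀ y, y ∈ P₁' ∪ P₂' → y ∈ R' ∨ y = u₁ ∨ y = u₂ := fun y hy => by
    have : y ∈ R' ∪ {u₁, u₂} := by rw [hP']; exact .inr hy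
    exact this
  have hsepA : Sep H (P₁ ∪ P₁') (P₂ ∪ P₂') := by
    rintro y (hy | hy) z (hz | hz)
    · exact hs y hy z hz
    · rcases memP y (.inl hy) with h | rfl | rfl
      · rcases memP' z (.inr hz) with h' | rfl | rfl
        · exact hsep y h z h'
        · exact absurd rfl (hs' _ hm₁' _ hz).1
        · exact hs y hy _ hm₂
      · exact hs' _ hm₁' z hz
      · exact absurd rfl (hs _ hy _ hm₂).1
    · rcases memP' y (.inl hy) with h | rfl | rfl
      · rcases memP z (.inr hz) with h' | rfl | rfl
        · exact hsep.symm y h z h'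
        · exact absurd rfl (hs _ hm₁ _ hz).1
        · exact hs' y hy _ hm₂'
      · exact hs _ hm₁ z hz
      · exact absurd rfl (hs' _ hy _ hm₂').1
    · exact hs' y hy z hz
  have hRR : ¬ Rch H (R ∪ R') a b := by
    intro h
    have := h.closed R haR ?_
    · exact (hsep b this b hbR).1 rfl
    · rintro y hy z (hz | hz) e
      exacts [hz, absurd e (hsep y hy z hz).2]
  -- Neighbors of `c` avoid `u₁` and `u₂`, hence lie in `R ∪ R'`, where `a` and `b` are not
  -- connected. Lifted to `G`, this is the last condition of `mem_hubs`, so `x` would be a hub.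
  have hN : ∀ P ⊆ P₁ ∪ P₂, ∀ P' ⊆ P₁' ∪ P₂',
      ¬ Rch H ((P ∪ P') ∩ H.neighborSet c ∪ {a, b}) a b := by
    refine fun P hPP P' hPP' h => hRR (h.mono ?_)
    rintro y (⟨hy | hy, e⟩ | rfl | rfl)
    · rcases memP y (hPP hy) with h | rfl | rfl
      exacts [.inl h, absurd e n₁, absurd e n₂]
    · rcases memP' y (hPP' hy) with h | rfl | rfl
      exacts [.inr h, absurd e n₁, absurd e n₂]
    · exact .inl haR
    · exact .inr hbR
  have hcR : ∀ y, y ∈ P₁ ∪ P₂ ∨ y ∈ P₁' ∪ P₂' → y ≠ c := by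
    rintro y (hy | hy) rfl
    · exact hcZ (hRZ (by rw [hP]; exact .inr hy))
    · exact hcZ (hRZ' (by rw [hP']; exact .inr hy))
  have hab := hsep a haR b hbR
  obtain ⟨a', ha'⟩ := C.single haX
  obtain ⟨b', hb'⟩ := C.single hbX
  have hlift : ∀ A : Set W, Rch H (A ∪ {a, b}) a b → Rch G (pre fib A ∪ {a', b'}) a' b' :=
    fun A h => (C.lift h (by simp [ha']) (by simp [hb'])).mono (pre_union_pair_subset ha' hb')
  have hlow : ∀ A : Set W, (∀ y ∈ A, y ≠ c) → ¬ Rch H (A ∩ H.neighborSet c ∪ {a, b}) a b →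
      ¬ Rch G (pre fib A ∩ G.neighborSet x ∪ {a', b'}) a' b' := by
    refine fun A hA h h' => h (C.proj (h'.mono ?_) (by simp [ha']) (by simp [hb']))
    rintro y (⟨⟨w, hw, hy⟩, e⟩ | rfl | rfl)
    · exact ⟨w, .inl ⟨hw, C.adj (hA w hw).symm (by simp [hx]) hy e⟩, hy⟩
    · exact ⟨a, by simp, by simp [ha']⟩
    · exact ⟨b, by simp, by simp [hb']⟩
  have hnot : ∀ A : Set W, (∀ y ∈ A, y ≠ c) → x ∉ pre fib A := by
    rintro A hA ⟨w, hw, h⟩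
    exact C.disj (hA w hw) h (by simp [hx]) rfl
  have hcA : ∀ y ∈ P₁ ∪ P₁', y ≠ c := by
    rintro y (hy | hy)
    exacts [hcR y (.inl (.inl hy)), hcR y (.inr (.inl hy))]
  have hcB : ∀ y ∈ P₂ ∪ P₂', y ≠ c := by
    rintro y (hy | hy)
    exacts [hcR y (.inl (.inr hy)), hcR y (.inr (.inr hy))]
  refine hxh (mem_hubs hG.theta_free (A := pre fib (P₁ ∪ P₁')) (B := pre fib (P₂ ∪ P₂'))
    ((C.adj_iff hx ha' ca.ne).2 ca) ((C.adj_iff hx hb' cb.ne).2 cb)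
    (C.disj hab.1 (by simp [ha']) (by simp [hb'])) (fun e => hab.2 ((C.adj_iff ha' hb' hab.1).1 e))
    (hlift _ ?_) (hlift _ ?_) (C.sep hsepA) (hnot _ hcA) (hnot _ hcB)
    (hlow _ hcA (hN _ Set.subset_union_left _ Set.subset_union_left))
    (hlow _ hcB (hN _ Set.subset_union_right _ Set.subset_union_right)))
  · refine (hr₁.symm.mono ?_).trans (hr₁'.mono ?_)
    · rintro y (rfl | hy) <;> simp [*]
    · rintro y (rfl | hy) <;> simp [*]
  · refine (hr₂.mono ?_).trans (hr₂'.symm.mono ?_)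
    · rintro y (rfl | hy) <;> simp [*]
    · rintro y (rfl | hy) <;> simp [*]

theorem eq_of_mem (C : Contraction G H v fib X) {w w' : W} {x : V} (h : x ∈ fib w)
    (h' : x ∈ fib w') : w = w' := by
  by_contra hne
  exact C.disj hne h h' rfl

/-- An apex in `X` has a stable triple of neighbors. If no base vertex is in `X`, the pyramid lifts
directly. If `b i` is in `X`, the other base vertices lift to non-hubs `y` and `z`, and the lift of
path `i` is cut at its first vertex `q` adjacent to `y` or `z`. The outcome depends on which of them
`q` sees. -/
theorem pyramid_free [Finite V] {t : ℕ} (C : Contraction G H v fib X) (hG : InClass t G)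
    (S : Set W) : ¬ IsPyramid H S := by
  rintro ⟨a, b, p, hb, hp, hdisj, hcross, hlen, -⟩
  have hseq := fun i => (hp i).1.indSeq
  have hba : ∀ i, b i ≠ a := fun i e => by
    have := (hseq i 0 (Nat.zero_le _) _ le_rfl).1
    rw [SimpleGraph.Walk.getVert_zero, SimpleGraph.Walk.getVert_length] at this
    have := this e.symm
    have := (hp i).2
    omega
  have hlen1 : ∀ i, H.Adj a (b i) → (p i).length = 1 := fun i e => by
    have := (hseq i 0 (Nat.zero_le _) _ le_rfl).2
    rw [SimpleGraph.Walk.getVert_zero, SimpleGraph.Walk.getVert_length] at this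
    have := this.1 e
    omega
  have hone : ∀ i j, i ≠ j → ¬ (H.Adj a (b i) ∧ H.Adj a (b j)) := fun i j hij h =>
    hlen i j hij ⟨hlen1 i h.1, hlen1 j h.2⟩
  obtain ⟨A, hA⟩ : ∃ A : Fin 3 → Set W, ∀ i, A i = vset (p i) \ {a} := ⟨_, fun _ => rfl⟩
  have hcr : ∀ i j, i ≠ j → ∀ x ∈ A i, ∀ y ∈ A j,
      x ≠ y ∧ (H.Adj x y → x = b i ∧ y = b j) := by
    intro i j hij x hx y hy
    rw [hA] at hx hy
    refine ⟨?_, hcross i j hij x hx y hy⟩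
    rintro rfl
    exact Set.disjoint_left.1 (hdisj i j hij) hx hy
  have hR : ∀ i, Rch H (insert a (A i)) a (b i) := fun i => by
    refine (rch_vset (p i)).mono fun z hz => ?_
    by_cases h : z = a
    · exact .inl h
    · exact .inr (by rw [hA]; exact ⟨hz, h⟩)
  have hbA : ∀ i, b i ∈ A i := fun i => (hR i).right_mem.resolve_left (hba i)
  have haA : ∀ i, a ∉ A i := fun i h => by rw [hA] at h; exact h.2 rfl
  clear hA
  by_cases ha : a ∈ X
  · choose x hx hxa e using fun i => (hR i).exists_adj' (hba i).symm
    have h : ∀ i j, i ≠ j → x i ≠ x j ∧ ¬ H.Adj (x i) (x j) := by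
      intro i j hij
      have := hcr i j hij _ ((hx i).resolve_left (hxa i)) _ ((hx j).resolve_left (hxa j))
      refine ⟨this.1, fun e' => hone i j hij ?_⟩
      rw [← (this.2 e').1, ← (this.2 e').2]
      exact ⟨e i, e j⟩
    have h01 := h 0 1 (by decide)
    have h02 := h 0 2 (by decide)
    have h12 := h 1 2 (by decide)
    exact C.no_triple hG ha (e 0) (e 1) (e 2) h01.1 h02.1 h12.1 h01.2 h02.2 h12.2
  obtain ⟨a', ha'⟩ := C.single ha
  have haa : a' ∈ fib a := by simp [ha']
  have hcrG : ∀ i j, i ≠ j → ∀ x ∈ pre fib (A i), ∀ y ∈ pre fib (A j),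
      x ≠ y ∧ (G.Adj x y → x ∈ fib (b i) ∧ y ∈ fib (b j)) := by
    rintro i j hij x ⟨w, hw, hx⟩ y ⟨w', hw', hy⟩
    have := hcr i j hij w hw w' hw'
    refine ⟨C.disj this.1 hx hy, fun e => ?_⟩
    obtain ⟨rfl, rfl⟩ := this.2 (C.adj this.1 hx hy e)
    exact ⟨hx, hy⟩
  have hRG : ∀ i, ∀ d ∈ fib (b i), Rch G (insert a' (pre fib (A i))) a' d := by
    intro i d hd
    refine (C.lift (hR i) haa hd).mono ?_
    rintro z ⟨w, rfl | hw, hz⟩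
    · rw [ha'] at hz; exact .inl hz
    · exact .inr ⟨w, hw, hz⟩
  have hmem : ∀ i, ∀ d ∈ fib (b i), d ∈ pre fib (A i) := fun i d hd => ⟨_, hbA i, hd⟩
  have ha'A : ∀ i, a' ∉ pre fib (A i) := by
    rintro i ⟨w, hw, h⟩
    exact haA i (C.eq_of_mem haa h ▸ hw)
  by_cases hspec : ∃ i, b i ∈ X
  · obtain ⟨i, hi⟩ := hspec
    have hsing : ∀ j, j ≠ i → ∃ u, fib (b j) = {u} ∧ u ∉ hubs G := fun j hj => by
      obtain ⟨-, u, h1, -, h2⟩ := C.nbr hi (hb i j hj.symm)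
      exact ⟨u, h1, h2⟩
    obtain ⟨j, k, hji, hki, hjk, -⟩ := fin_three_others i
    obtain ⟨y, hy, hyh⟩ := hsing j hji
    obtain ⟨z, hz, hzh⟩ := hsing k hki
    have hatt : ∀ l, l ≠ i → ∀ u, fib (b l) = {u} → ∃ d ∈ fib (b i), G.Adj d u := by
      intro l hl u hu
      obtain ⟨d, hd, u', hu', e⟩ := C.exists_adj (hb i l hl.symm)
      rw [hu] at hu'
      exact ⟨d, hd, by rw [← show u' = u from hu']; exact e⟩
    obtain ⟨d, hd, edy⟩ := hatt j hji y hy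
    have had : a' ≠ d := C.disj (hba i).symm haa hd
    obtain ⟨s, -, -, eas, hs⟩ := (hRG i d hd).exists_adj had
    replace hs : Rch G (pre fib (A i)) s d :=
      hs.mono fun u hu => hu.1.resolve_left hu.2
    obtain ⟨Q, hQ, q, hq, hsq, hQT, -⟩ :=
      hs.first_hit (T := {u | G.Adj u y ∨ G.Adj u z}) (.inl edy)
    have hqA := hQ hsq.right_mem
    have hyA : y ∈ pre fib (A j) := hmem j y (by simp [hy])
    have hzA : z ∈ pre fib (A k) := hmem k z (by simp [hz])
    have hQne : ∀ u ∈ Q, u ≠ a' := by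
      rintro u hu rfl
      exact ha'A i (hQ hu)
    -- The case where `q` sees only `y`. If `a'` and `y` are non-adjacent, they are the ends of a
    -- theta. Otherwise `y` has the non-adjacent neighbors `a'` and `z`, joined through the lifts of
    -- paths `i` and `k`, which makes `y` a hub.
    have aux : ∀ j k y z, j ≠ i → k ≠ i → j ≠ k → fib (b j) = {y} → fib (b k) = {z} →
        y ∉ hubs G → (∀ u ∈ Q, G.Adj u z → u = q) → G.Adj q y → ¬ G.Adj q z → False := by
      intro j k y z hji hki hjk hy hz hyh hQz eqy nqz
      have hyb : y ∈ fib (b j) := by simp [hy]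
      have hzb : z ∈ fib (b k) := by simp [hz]
      have hay : a' ≠ y := C.disj (hba j).symm haa hyb
      have haz : a' ≠ z := C.disj (hba k).symm haa hzb
      by_cases eay : G.Adj a' y
      · have Hay := C.adj (hba j).symm haa hyb eay
        have naz : ¬ G.Adj a' z := fun e =>
          hone j k hjk ⟨Hay, C.adj (hba k).symm haa hzb e⟩
        obtain ⟨d, hd, edz⟩ := hatt k hki z hz
        have eyz : G.Adj y z := (C.adj_iff hy hz (hb j k hjk).ne).2 (hb j k hjk)
        refine hyh (mem_hubs hG.theta_free (a := a') (b := z) (A := pre fib (A i))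
          (B := pre fib (A k) \ {z}) eay.symm eyz haz naz ?_ ?_ ?_ ?_ ?_ ?_ ?_)
        · refine ((hRG i d hd).mono ?_).tail edz (by simp)
          rintro u (rfl | hu) <;> simp [*]
        · refine (hRG k z hzb).mono ?_
          rintro u (rfl | hu)
          · simp
          · by_cases h : u = z <;> simp [h, hu]
        · rintro u hu w ⟨hw, hwz⟩
          have := hcrG i k hki.symm u hu w hw
          refine ⟨this.1, fun e => hwz ?_⟩
          have := (this.2 e).2
          rwa [hz] at this
        · exact fun h => (hcrG i j hji.symm y h y (hmem j y hyb)).1 rfl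
        · exact fun h => (hcrG k j hjk.symm y h.1 y (hmem j y hyb)).1 rfl
        · intro h
          obtain ⟨u, hu, hua, e⟩ := h.exists_adj' haz
          rcases hu with ⟨hu, e'⟩ | rfl | rfl
          · have := ((hcrG j i hji y (hmem j y hyb) u hu).2 e').2
            exact hone i j hji.symm ⟨C.adj (hba i).symm haa this e, Hay⟩
          · exact hua rfl
          · exact naz e
        · intro h
          obtain ⟨u, hu, hua, e⟩ := h.exists_adj' haz
          rcases hu with ⟨⟨hu, huz⟩, e'⟩ | rfl | rfl
          · have := ((hcrG j k hjk y (hmem j y hyb) u hu).2 e').2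
            rw [hz] at this
            exact huz this
          · exact hua rfl
          · exact naz e
      · refine no_theta hG.theta_free (a := a') (b := y) (A := Q) (B := pre fib (A j) \ {y})
          (C := pre fib (A k)) hay eay ?_ ?_ ?_ ?_ ?_ ?_
        · exact Rch.head (by simp) eas ((hsq.mono Set.subset_union_left).tail eqy (by simp))
        · refine (hRG j y hyb).mono ?_
          rintro u (rfl | hu)
          · simp
          · by_cases h : u = y <;> simp [h, hu]
        · refine ((hRG k z hzb).mono ?_).tail
            ((C.adj_iff hz hy (hb k j hjk.symm).ne).2 (hb k j hjk.symm)) (by simp)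
          rintro u (rfl | hu) <;> simp [*]
        · rintro u hu w ⟨hw, hwy⟩
          have := hcrG i j hji.symm u (hQ hu) w hw
          refine ⟨this.1, fun e => hwy ?_⟩
          have := (this.2 e).2
          rwa [hy] at this
        · intro u hu w hw
          have := hcrG i k hki.symm u (hQ hu) w hw
          refine ⟨this.1, fun e => ?_⟩
          have h2 := (this.2 e).2
          rw [hz] at h2
          obtain rfl : w = z := h2
          exact nqz (hQz u hu e ▸ e)
        · rintro u ⟨hu, huy⟩ w hw
          have := hcrG j k hjk u hu w hw
          refine ⟨this.1, fun e => huy ?_⟩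
          have := (this.2 e).1
          rwa [hy] at this
    have hQy : ∀ u ∈ Q, G.Adj u y → u = q := fun u hu e => hQT u hu (.inl e)
    have hQz : ∀ u ∈ Q, G.Adj u z → u = q := fun u hu e => hQT u hu (.inr e)
    by_cases eqy : G.Adj q y
    · by_cases eqz : G.Adj q z
      · have hyb : y ∈ fib (b j) := by simp [hy]
        have hzb : z ∈ fib (b k) := by simp [hz]
        have hqb : q ∈ fib (b i) := ((hcrG i j hji.symm q hqA y hyA).2 eqy).1
        have hcase : ∀ j y, j ≠ i → fib (b j) = {y} → (∀ u ∈ Q, G.Adj u y → u = q) →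
            ∀ u ∈ Q, ∀ w ∈ pre fib (A j), u ≠ w ∧ (G.Adj u w → u = q ∧ w = y) := by
          intro j y hji hy hQy u hu w hw
          have := hcrG i j hji.symm u (hQ hu) w hw
          refine ⟨this.1, fun e => ?_⟩
          have h2 := (this.2 e).2
          rw [hy] at h2
          obtain rfl : w = y := h2
          exact ⟨hQy u hu e, rfl⟩
        -- When `q` sees both `y` and `z`, the triangle survives with `q` in place of the contracted
        -- vertex.
        refine no_pyramid hG.pyramid_free (a := a') (b₁ := q) (b₂ := y) (b₃ := z) (A₁ := Q)
          (A₂ := pre fib (A j)) (A₃ := pre fib (A k)) eqy eqz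
          ((C.adj_iff hy hz (hb j k hjk).ne).2 (hb j k hjk))
          (Rch.head (by simp) eas (hsq.mono (Set.subset_insert _ _)))
          (hRG j y hyb) (hRG k z hzb) (hQne q hsq.right_mem) (C.disj (hba j) hyb haa)
          (C.disj (hba k) hzb haa) (hcase j y hji hy hQy) (hcase k z hki hz hQz) ?_ ?_ ?_ ?_
        · intro u hu w hw
          have := hcrG j k hjk u hu w hw
          refine ⟨this.1, fun e => ?_⟩
          have h2 := this.2 e
          rw [hy, hz] at h2
          exact h2
        · exact fun h => hone i j hji.symm
            ⟨C.adj (hba i).symm haa hqb h.1, C.adj (hba j).symm haa hyb h.2⟩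
        · exact fun h => hone i k hki.symm
            ⟨C.adj (hba i).symm haa hqb h.1, C.adj (hba k).symm haa hzb h.2⟩
        · exact fun h => hone j k hjk
            ⟨C.adj (hba j).symm haa hyb h.1, C.adj (hba k).symm haa hzb h.2⟩
      · exact aux j k y z hji hki hjk hy hz hyh hQz eqy eqz
    · exact aux k j z y hki hji hjk.symm hz hy hzh hQy (hq.resolve_left eqy) eqy
  · push Not at hspec
    choose y hy using fun i => C.single (hspec i)
    have hyb : ∀ i, y i ∈ fib (b i) := fun i => by simp [hy]
    refine no_pyramid_of_family hG.pyramid_free (a := a') (b := y) (A := fun i => pre fib (A i))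
      (fun i j hij => (C.adj_iff (hy i) (hy j) (hb i j hij).ne).2 (hb i j hij))
      (fun i => hRG i _ (hyb i)) (fun i => C.disj (hba i) (hyb i) haa) ?_ ?_
    · intro i j hij u hu w hw
      have := hcrG i j hij u hu w hw
      refine ⟨this.1, fun e => ?_⟩
      have h2 := this.2 e
      rw [hy, hy] at h2
      exact h2
    · exact fun i j hij h => hone i j hij
        ⟨C.adj (hba i).symm haa (hyb i) h.1, C.adj (hba j).symm haa (hyb j) h.2⟩

/-- At most one vertex of the triangle is in `X`, so the only possible missing edges are at the
vertex chosen in that fiber. It sees at least one of the two others, and that one is adjacent to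
both. -/
theorem exists_center (C : Contraction G H v fib X) {α : Fin 3 → W} {a : Fin 3 → V}
    (hα : ∀ i j, i ≠ j → H.Adj (α i) (α j)) (ha : ∀ i, a i ∈ fib (α i))
    (hatt : ∀ i, ∃ j, j ≠ i ∧ ∃ w ∈ fib (α j), G.Adj (a i) w) :
    ∃ i, ∀ j, j ≠ i → G.Adj (a i) (a j) := by
  have hsing : ∀ i, α i ∉ X → fib (α i) = {a i} := by
    intro i hi
    obtain ⟨u, hu⟩ := C.single hi
    have := ha i
    rw [hu] at this
    rw [hu, show a i = u from this]
  have hadj : ∀ i j, i ≠ j → α i ∉ X → α j ∉ X → G.Adj (a i) (a j) := fun i j hij hi hj =>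
    (C.adj_iff (hsing i hi) (hsing j hj) (hα i j hij).ne).2 (hα i j hij)
  by_cases hX : ∃ i, α i ∈ X
  · obtain ⟨i, hi⟩ := hX
    have hn : ∀ j, j ≠ i → α j ∉ X := fun j hj => (C.nbr hi (hα i j hj.symm)).1
    obtain ⟨j, hj, w, hw, e⟩ := hatt i
    rw [hsing j (hn j hj)] at hw
    obtain rfl : w = a j := hw
    refine ⟨j, fun k hk => ?_⟩
    by_cases hki : k = i
    · exact hki ▸ e.symm
    · exact hadj j k hk.symm (hn j hj) (hn k hki)
  · push Not at hX
    exact ⟨0, fun j hj => hadj 0 j hj.symm (hX 0) (hX j)⟩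

/-- Covers prisms, and pinched prisms with the center as a trivial path. The triangles may lose
edges in the lift; `ThreePaths.exists_midAt` leaves one configuration, in which a non-hub neighbor
of `v` turns out to be a hub. -/
theorem not_threePaths [Finite V] {t : ℕ} (C : Contraction G H v fib X) (hG : InClass t G)
    {α β : Fin 3 → W} {A : Fin 3 → Set W} (h : ThreePaths H α β A)
    (hα : ∀ i j, i ≠ j → H.Adj (α i) (α j)) (hβ : ∀ i j, i ≠ j → H.Adj (β i) (β j))
    (hp : Proper H α β) (hX : ∀ i, α i = β i → ∀ j, j ≠ i → α j ∉ X ∧ β j ∉ X) : False := by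
  -- Each lift is trimmed to a piece with only one vertex in the `α i` fiber attaching to another
  -- `α` fiber, and likewise for `β`. So all edges between different pieces join their ends.
  have hQ : ∀ i, ∃ Q ⊆ pre fib (A i),
      ∃ p ∈ {u | u ∈ fib (α i) ∧ ∃ j, j ≠ i ∧ ∃ w ∈ fib (α j), G.Adj u w},
      ∃ q ∈ {u | u ∈ fib (β i) ∧ ∃ j, j ≠ i ∧ ∃ w ∈ fib (β j), G.Adj u w},
      Rch G Q p q ∧
      (∀ u ∈ Q, u ∈ {u | u ∈ fib (α i) ∧ ∃ j, j ≠ i ∧ ∃ w ∈ fib (α j), G.Adj u w} → u = p) ∧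
      (∀ u ∈ Q, u ∈ {u | u ∈ fib (β i) ∧ ∃ j, j ≠ i ∧ ∃ w ∈ fib (β j), G.Adj u w} → u = q) := by
    intro i
    obtain ⟨j, k, hj, -⟩ := fin_three_others i
    obtain ⟨s, hs, w, hw, e⟩ := C.exists_adj (hα i j hj.symm)
    obtain ⟨s', hs', w', hw', e'⟩ := C.exists_adj (hβ i j hj.symm)
    exact (C.lift (h.rch i) hs hs').two_hits ⟨hs, j, hj, w, hw, e⟩ ⟨hs', j, hj, w', hw', e'⟩
  choose Q hQA a ha b hb hr hua hub using hQ
  have haf : ∀ i, a i ∈ fib (α i) := fun i => (ha i).1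
  have hbf : ∀ i, b i ∈ fib (β i) := fun i => (hb i).1
  have hcrG : ∀ i j, i ≠ j → ∀ x ∈ pre fib (A i), ∀ y ∈ pre fib (A j), x ≠ y ∧
      (G.Adj x y → (x ∈ fib (α i) ∧ y ∈ fib (α j)) ∨ (x ∈ fib (β i) ∧ y ∈ fib (β j))) := by
    rintro i j hij x ⟨w, hw, hx⟩ y ⟨w', hw', hy⟩
    have := h.cross i j hij w hw w' hw'
    refine ⟨C.disj this.1 hx hy, fun e => ?_⟩
    rcases this.2 (C.adj this.1 hx hy e) with ⟨rfl, rfl⟩ | ⟨rfl, rfl⟩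
    exacts [.inl ⟨hx, hy⟩, .inr ⟨hx, hy⟩]
  have h' : ThreePaths G a b Q := by
    refine ⟨hr, fun i j hij x hx y hy => ?_⟩
    have := hcrG i j hij x (hQA i hx) y (hQA j hy)
    refine ⟨this.1, fun e => ?_⟩
    rcases this.2 e with ⟨h1, h2⟩ | ⟨h1, h2⟩
    · exact .inl ⟨hua i x hx ⟨h1, j, hij.symm, y, h2, e⟩, hua j y hy ⟨h2, i, hij, x, h1, e.symm⟩⟩
    · exact .inr ⟨hub i x hx ⟨h1, j, hij.symm, y, h2, e⟩, hub j y hy ⟨h2, i, hij, x, h1, e.symm⟩⟩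
  have hsing : ∀ {w x}, w ∉ X → x ∈ fib w → fib w = {x} := fun hw hx => by
    obtain ⟨u, hu⟩ := C.single hw
    rw [hu] at hx
    rw [hu, show _ = u from hx]
  have hp' : Proper G a b := by
    rcases hp with hne | ⟨i, hi, hne, -⟩
    · exact .inl fun i => C.disj (hne i) (haf i) (hbf i)
    -- A trivial path of `H` may lift to one with different ends inside its fiber; then all three
    -- lifted paths are non-trivial.
    · by_cases hab : a i = b i
      · refine .inr ⟨i, hab, fun j hj => ⟨C.disj (hne j hj).1 (haf j) (hbf j), fun e =>
          (hne j hj).2 (C.adj (hne j hj).1 (haf j) (hbf j) e)⟩, fun j k hj hk hjk => ?_⟩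
        have hj' := hX i hi j hj
        have hk' := hX i hi k hk
        exact ⟨(C.adj_iff (hsing hj'.1 (haf j)) (hsing hk'.1 (haf k)) (hα j k hjk).ne).2
          (hα j k hjk), (C.adj_iff (hsing hj'.2 (hbf j)) (hsing hk'.2 (hbf k)) (hβ j k hjk).ne).2
          (hβ j k hjk)⟩
      · refine .inl fun j => ?_
        by_cases hj : j = i
        · exact hj ▸ hab
        · exact C.disj (hne j hj).1 (haf j) (hbf j)
  obtain ⟨i, hai, hbi, eab⟩ := h'.exists_midAt hG hp'
    (C.exists_center hα haf fun i => (ha i).2) (C.exists_center hβ hbf fun i => (hb i).2)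
  -- The edge opposite `a i` is missing in the lift although present in `H`, so one of its ends
  -- comes from `X`; hence `a i` is a non-hub neighbor of `v`.
  obtain ⟨j, hji, hj⟩ : ∃ j, j ≠ i ∧ α j ∈ X := by
    obtain ⟨j, k, hji, hki, hjk, -⟩ := fin_three_others i
    by_contra! hcon
    exact hai.2 j k hji hki ((C.adj_iff (hsing (hcon j hji) (haf j)) (hsing (hcon k hki) (haf k))
      (hα j k hjk).ne).2 (hα j k hjk))
  have hne : ∀ l, α l ≠ β l := by
    rcases hp with hne | ⟨l, hl, hne, -⟩
    · exact hne
    · exfalso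
      by_cases hil : i = l
      · exact (hX l hl j (hil ▸ hji)).1 hj
      · exact (hne i hil).2 (C.adj (hne i hil).1 (haf i) (hbf i) eab)
  have hneG : ∀ l, a l ≠ b l := fun l => C.disj (hne l) (haf l) (hbf l)
  obtain ⟨k, hki, hkj⟩ := fin_three_avoid i j
  obtain ⟨-, x, hx, -, hxh⟩ := C.nbr hj (hα j i hji)
  have hxa : a i = x := by
    have := haf i
    rw [hx] at this
    exact this
  subst hxa
  have hkX := (C.nbr hj (hα j k hkj.symm)).1
  have hk := hsing hkX (haf k)
  obtain ⟨d, hd, a', ha', eda⟩ := C.exists_adj (hα j k hkj.symm)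
  rw [hk] at ha'
  obtain rfl : a' = a k := ha'
  have hma := fun l => (hr l).left_mem
  have hmb := fun l => (hr l).right_mem
  have hαA : ∀ l, fib (α l) ⊆ pre fib (A l) := fun l u hu => ⟨_, (h.rch l).left_mem, hu⟩
  have nba : ¬ G.Adj (b i) (a k) := fun e => by
    rcases (h'.cross i k hki.symm _ (hmb i) _ (hma k)).2 e with h | h
    exacts [hneG i h.1.symm, hneG k h.2]
  -- The non-adjacent neighbors `b i` and `a k` of `a i` are joined through path `k`, and through
  -- path `j` continued within the fiber of `α j` to a vertex adjacent to `a k`. In both sets no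
  -- neighbor of `b i` is adjacent to `a i`, so `a i` is a hub.
  refine hxh (mem_hubs hG.theta_free (a := b i) (b := a k) (A := Q j ∪ fib (α j))
    (B := Q k \ {a k}) eab (hai.1 k hki) (h'.cross i k hki.symm _ (hmb i) _ (hma k)).1 nba
    ?_ ?_ ?_ ?_ ?_ ?_ ?_)
  · refine Rch.head (by simp) (hbi.1 j hji) (((hr j).symm.mono ?_).trans
      (((C.conn _ _ (haf j) d hd).mono ?_).tail eda (by simp)))
    · intro u hu; exact .inl (.inl hu)
    · intro u hu; exact .inl (.inr hu)
  · refine Rch.head (by simp) (hbi.1 k hki) ((hr k).symm.mono fun u hu => ?_)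
    by_cases hu' : u = a k <;> simp [hu', hu]
  · rintro u (hu | hu) w ⟨hw, hwk⟩
    · have := h'.cross j k hkj.symm u hu w hw
      refine ⟨this.1, fun e => ?_⟩
      rcases this.2 e with h | ⟨rfl, rfl⟩
      exacts [hwk h.2, hbi.2 j k hji hki e]
    · have := hcrG j k hkj.symm u (hαA j hu) w (hQA k hw)
      refine ⟨this.1, fun e => ?_⟩
      rcases this.2 e with h | h
      · have := h.2
        rw [hk] at this
        exact hwk this
      · exact hne j (C.eq_of_mem hu h.1)
  · rintro (h | h)
    · exact (h'.cross i j hji.symm _ (hma i) _ h).1 rfl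
    · exact C.disj (hα i j hji.symm).ne (haf i) h rfl
  · exact fun h => (h'.cross i k hki.symm _ (hma i) _ h.1).1 rfl
  · intro hR
    obtain ⟨u, hu, hub, e⟩ := hR.exists_adj' (h'.cross i k hki.symm _ (hmb i) _ (hma k)).1
    rcases hu with ⟨hu | hu, e'⟩ | rfl | rfl
    · rcases (h'.cross i j hji.symm _ (hmb i) _ hu).2 e with h1 | ⟨-, rfl⟩
      · exact hneG i h1.1.symm
      · rcases (h'.cross i j hji.symm _ (hma i) _ hu).2 e' with h2 | h2
        exacts [hneG j h2.2.symm, hneG i h2.1]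
    · rcases (hcrG i j hji.symm _ (hQA i (hmb i)) u (hαA j hu)).2 e with h1 | h1
      · exact hne i (C.eq_of_mem h1.1 (hbf i))
      · exact hne j (C.eq_of_mem hu h1.2)
    · exact hub rfl
    · exact nba e
  · intro hR
    obtain ⟨u, hu, hub, e⟩ := hR.exists_adj' (h'.cross i k hki.symm _ (hmb i) _ (hma k)).1
    rcases hu with ⟨⟨hu, huk⟩, e'⟩ | rfl | rfl
    · rcases (h'.cross i k hki.symm _ (hma i) _ hu).2 e' with h1 | h1
      exacts [huk h1.2, hneG i h1.1]
    · exact hub rfl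
    · exact nba e

theorem prism_free [Finite V] {t : ℕ} (C : Contraction G H v fib X) (hG : InClass t G)
    (S : Set W) : ¬ IsPrism H S := by
  rintro ⟨a, b, p, ha, hb, hp, hdisj, hcross, -⟩
  have hne : ∀ i, a i ≠ b i := fun i e => by
    have := ((hp i).1.indSeq 0 (Nat.zero_le _) _ le_rfl).1
    rw [SimpleGraph.Walk.getVert_zero, SimpleGraph.Walk.getVert_length] at this
    have := this e
    have := (hp i).2
    omega
  refine C.not_threePaths hG (α := a) (β := b) (A := fun i => vset (p i))
    ⟨fun i => rch_vset (p i), fun i j hij x hx y hy => ⟨?_, hcross i j hij x hx y hy⟩⟩ ha hb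
    (.inl hne) fun i hi => absurd hi (hne i)
  rintro rfl
  exact Set.disjoint_left.1 (hdisj i j hij) hx hy

end Contraction

/-! ### A center with two paths -/

theorem threePaths_of_center {c x y z w : V} {P Q : Set V} (hP : Rch G P x w) (hQ : Rch G Q y z)
    (hcross : ∀ p ∈ P, ∀ q ∈ Q, p ≠ q ∧ (G.Adj p q → (p = x ∧ q = y) ∨ (p = w ∧ q = z)))
    (hcP : c ∉ P) (hcQ : c ∉ Q) (hNP : ∀ u ∈ P, G.Adj c u → u = x ∨ u = w)
    (hNQ : ∀ u ∈ Q, G.Adj c u → u = y ∨ u = z) :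
    ThreePaths G ![c, x, y] ![c, w, z] ![{c}, P, Q] := by
  have flip : ∀ {A B : Set V} {a b a' b' : V},
      (∀ p ∈ A, ∀ q ∈ B, p ≠ q ∧ (G.Adj p q → (p = a ∧ q = b) ∨ (p = a' ∧ q = b'))) →
      ∀ p ∈ B, ∀ q ∈ A, p ≠ q ∧ (G.Adj p q → (p = b ∧ q = a) ∨ (p = b' ∧ q = a')) :=
    fun h p hp q hq => ⟨(h q hq p hp).1.symm, fun e => ((h q hq p hp).2 e.symm).imp And.symm
      And.symm⟩
  have center : ∀ {B : Set V} {b b' : V}, c ∉ B → (∀ u ∈ B, G.Adj c u → u = b ∨ u = b') →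
      ∀ p ∈ ({c} : Set V), ∀ q ∈ B, p ≠ q ∧ (G.Adj p q → (p = c ∧ q = b) ∨ (p = c ∧ q = b')) := by
    rintro B b b' hc hN p rfl q hq
    exact ⟨by rintro rfl; exact hc hq, fun e => (hN q hq e).imp (⟨rfl, ·⟩) (⟨rfl, ·⟩)⟩
  refine ⟨fun i => ?_, fun i j hij => ?_⟩
  · fin_cases i
    exacts [.refl rfl, hP, hQ]
  · fin_cases i <;> fin_cases j
    all_goals first
      | exact absurd rfl hij | exact hcross | exact flip hcross | exact center hcP hNP
      | exact center hcQ hNQ | exact flip (center hcP hNP) | exact flip (center hcQ hNQ)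

theorem triangle_of_center {c x y : V} (hx : G.Adj c x) (hy : G.Adj c y) (hxy : G.Adj x y)
    (i j : Fin 3) (hij : i ≠ j) : G.Adj (![c, x, y] i) (![c, x, y] j) := by
  fin_cases i <;> fin_cases j
  all_goals first
    | exact absurd rfl hij | exact hx | exact hy | exact hxy | exact hx.symm | exact hy.symm
    | exact hxy.symm

theorem proper_of_center {c x y z w : V} (hxy : G.Adj x y) (hwz : G.Adj w z) (hxw : x ≠ w)
    (hyz : y ≠ z) (nxw : ¬ G.Adj x w) (nyz : ¬ G.Adj y z) : Proper G ![c, x, y] ![c, w, z] := by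
  refine .inr ⟨0, rfl, fun j hj => ?_, fun j k hj hk hjk => ?_⟩
  · fin_cases j
    exacts [absurd rfl hj, ⟨hxw, nxw⟩, ⟨hyz, nyz⟩]
  · fin_cases j <;> fin_cases k
    all_goals first
      | exact absurd rfl hj | exact absurd rfl hk | exact absurd rfl hjk | exact ⟨hxy, hwz⟩
      | exact ⟨hxy.symm, hwz.symm⟩

/-- The two paths of a pinched prism. -/
theorem IsPinchedPrism.exists_paths {S : Set V} (h : IsPinchedPrism G S) :
    ∃ (c x y z w : V) (P Q : Set V), IsHole G (P ∪ Q) ∧ c ∉ P ∪ Q ∧ Rch G P x w ∧ Rch G Q y z ∧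
      G.Adj x y ∧ G.Adj w z ∧
      (∀ p ∈ P, ∀ q ∈ Q, p ≠ q ∧ (G.Adj p q → (p = x ∧ q = y) ∨ (p = w ∧ q = z))) ∧
      (∀ u ∈ P ∪ Q, G.Adj c u ↔ u = x ∨ u = y ∨ u = z ∨ u = w) ∧
      x ≠ w ∧ ¬ G.Adj x w ∧ y ≠ z ∧ ¬ G.Adj y z ∧ (∃ u ∈ P, ¬ G.Adj c u) ∧
      ∃ u ∈ Q, ¬ G.Adj c u := by
  obtain ⟨Z, c, hZ, -, hcZ, ⟨x, y, z, w, hN, hxy, hzw, hdisj, hanti⟩, -⟩ := h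
  have hmem : ∀ u, (G.Adj c u ∧ u ∈ Z) ↔ u = x ∨ u = y ∨ u = z ∨ u = w := fun u => by
    have : u ∈ G.neighborSet c ∩ Z ↔ u ∈ ({x, y, z, w} : Set V) := by rw [hN]
    exact this
  have hxZ := ((hmem x).2 (.inl rfl)).2
  have hyZ := ((hmem y).2 (.inr (.inl rfl))).2
  have hzZ := ((hmem z).2 (.inr (.inr (.inl rfl)))).2
  have hwZ := ((hmem w).2 (.inr (.inr (.inr rfl)))).2
  -- The hole is numbered with `x` first and `y` last, so that `xy` is the closing edge. Then `z`
  -- and `w` are consecutive in some order, and deleting both edges leaves the two paths.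
  obtain ⟨n, hn, f, hf, rfl, rfl, rfl⟩ := hZ.exists_seq_of_adj hxZ hyZ hxy
  have aux : ∀ i, i + 1 < n → i ≠ 0 → i + 2 ≠ n → ¬ G.Adj (f 0) (f i) →
      ¬ G.Adj (f (n - 1)) (f (i + 1)) →
      (∀ u, (G.Adj c u ∧ u ∈ f '' {i | i < n}) ↔
        u = f 0 ∨ u = f (n - 1) ∨ u = f (i + 1) ∨ u = f i) →
      ∃ (c x y z w : V) (P Q : Set V), IsHole G (P ∪ Q) ∧ c ∉ P ∪ Q ∧ Rch G P x w ∧ Rch G Q y z ∧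
      G.Adj x y ∧ G.Adj w z ∧
      (∀ p ∈ P, ∀ q ∈ Q, p ≠ q ∧ (G.Adj p q → (p = x ∧ q = y) ∨ (p = w ∧ q = z))) ∧
      (∀ u ∈ P ∪ Q, G.Adj c u ↔ u = x ∨ u = y ∨ u = z ∨ u = w) ∧
      x ≠ w ∧ ¬ G.Adj x w ∧ y ≠ z ∧ ¬ G.Adj y z ∧ (∃ u ∈ P, ¬ G.Adj c u) ∧
      ∃ u ∈ Q, ¬ G.Adj c u := by
    intro i hi hi0 hin n1 n2 hmem
    -- Since the ends of each path are non-adjacent, each path has an interior vertex. These are the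
    -- promised non-neighbors `f 1` and `f (i + 2)` of the center.
    have hi1 : i ≠ 1 := by
      rintro rfl
      exact n1 ((hf 0 (by omega) 1 (by omega)).2.2 (.inl rfl))
    have hi3 : i + 3 ≠ n := by
      rintro rfl
      exact n2 ((hf _ (by omega) _ (by omega)).2.2 (.inr (.inl (by omega))))
    have hPQ : f '' {k | k ≤ i} ∪ f '' {k | i < k ∧ k < n} = f '' {k | k < n} := by
      rw [← Set.image_union]
      congr 1
      ext k
      simp only [Set.mem_union, Set.mem_ofPred_eq]
      omega
    have hnc : ∀ k < n, k ≠ 0 → k ≠ n - 1 → k ≠ i → k ≠ i + 1 → ¬ G.Adj c (f k) := by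
      intro k hk h0 h1 h2 h3 e
      rcases (hmem (f k)).1 ⟨e, k, hk, rfl⟩ with h | h | h | h
      · exact h0 ((hf k hk _ (by omega)).1 h)
      · exact h1 ((hf k hk _ (by omega)).1 h)
      · exact h3 ((hf k hk _ (by omega)).1 h)
      · exact h2 ((hf k hk _ (by omega)).1 h)
    have hseq : IndSeq G f i := by
      intro j hj k hk
      have := hf j (by omega) k (by omega)
      exact ⟨this.1, by rw [this.2]; omega⟩
    have hseq' : IndSeq G (fun k => f (k + (i + 1))) (n - i - 2) := by
      intro j hj k hk
      have := hf (j + (i + 1)) (by omega) (k + (i + 1)) (by omega)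
      exact ⟨fun e => by have := this.1 e; omega, by rw [this.2]; omega⟩
    refine ⟨c, f 0, f (n - 1), f (i + 1), f i, f '' {k | k ≤ i}, f '' {k | i < k ∧ k < n}, ?_, ?_,
      hseq.rch (Nat.zero_le _) le_rfl fun k _ hk => ⟨k, hk, rfl⟩, ?_, hxy,
      (hf _ (by omega) _ (by omega)).2.2 (.inl rfl), ?_, ?_, ?_, n1, ?_, n2,
      ⟨f 1, ⟨1, by simp only [Set.mem_ofPred_eq]; omega, rfl⟩, hnc 1 ?_ ?_ ?_ ?_ ?_⟩,
      ⟨f (i + 2), ⟨i + 2, by simp only [Set.mem_ofPred_eq]; omega, rfl⟩,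
        hnc (i + 2) ?_ ?_ ?_ ?_ ?_⟩⟩
    case refine_1 => rwa [hPQ]
    case refine_2 => rwa [hPQ]
    case refine_3 =>
      have := hseq'.rch (A := f '' {k | i < k ∧ k < n}) (Nat.zero_le _) le_rfl
        fun k _ hk => ⟨k + (i + 1), by simp only [Set.mem_ofPred_eq]; omega, rfl⟩
      rw [zero_add, show n - i - 2 + (i + 1) = n - 1 by omega] at this
      exact this.symm
    case refine_4 =>
      rintro _ ⟨j, hj, rfl⟩ _ ⟨k, ⟨hk, hk'⟩, rfl⟩
      simp only [Set.mem_ofPred_eq] at hj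
      have := hf j (by omega) k hk'
      refine ⟨fun e => by have := this.1 e; omega, fun e => ?_⟩
      have := this.2.1 e
      rcases (show (j = 0 ∧ k = n - 1) ∨ (j = i ∧ k = i + 1) by omega) with ⟨rfl, rfl⟩ | ⟨rfl, rfl⟩
      exacts [.inl ⟨rfl, rfl⟩, .inr ⟨rfl, rfl⟩]
    case refine_5 =>
      intro u hu
      rw [hPQ] at hu
      rw [← hmem u]
      exact ⟨fun e => ⟨e, hu⟩, And.left⟩
    case refine_6 =>
      intro e
      have := (hf _ (by omega) _ (by omega)).1 e
      omega
    case refine_7 =>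
      intro e
      have := (hf _ (by omega) _ (by omega)).1 e
      omega
    all_goals omega
  have hxz := hanti (f 0) (.inl rfl) z (.inl rfl)
  have hxw := hanti (f 0) (.inl rfl) w (.inr rfl)
  have hyz := hanti (f (n - 1)) (.inr rfl) z (.inl rfl)
  have hyw := hanti (f (n - 1)) (.inr rfl) w (.inr rfl)
  rw [Set.disjoint_left] at hdisj
  obtain ⟨i, hi, rfl⟩ := hzZ
  obtain ⟨j, hj, rfl⟩ := hwZ
  simp only [Set.mem_ofPred_eq] at hi hj
  have hi0 : i ≠ 0 := by rintro rfl; exact hdisj (.inl rfl) (.inl rfl)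
  have hj0 : j ≠ 0 := by rintro rfl; exact hdisj (.inl rfl) (.inr rfl)
  have hin : i ≠ n - 1 := by rintro rfl; exact hdisj (.inr rfl) (.inl rfl)
  have hjn : j ≠ n - 1 := by rintro rfl; exact hdisj (.inr rfl) (.inr rfl)
  have hij := (hf i hi j hj).2.1 hzw
  rcases (show j = i + 1 ∨ i = j + 1 by omega) with rfl | rfl
  · refine aux i hj hi0 (by omega) hxz hyw fun u => (hmem u).trans ?_
    tauto
  · exact aux j hi hj0 (by omega) hxw hyz hmem

/-- The three paths form a pyramid with apex `a` and triangle `c, p, q`; the path from `a` to `c` is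
the single edge, and the two others are longer. -/
theorem false_of_apex {t : ℕ} (hG : InClass t G) {c a p q : V} {P Q : Set V} (hP : Rch G P p a)
    (hQ : Rch G Q q a) (hpq : G.Adj p q) (hca : G.Adj c a) (hcp : G.Adj c p) (hcq : G.Adj c q)
    (hNP : ∀ u ∈ P, G.Adj c u → u = p ∨ u = a) (hNQ : ∀ u ∈ Q, G.Adj c u → u = q ∨ u = a)
    (hpa : p ≠ a) (hqa : q ≠ a) (npa : ¬ G.Adj p a) (nqa : ¬ G.Adj q a) (hcP : c ∉ P) (hcQ : c ∉ Q)
    (hcross : ∀ x ∈ P \ {a}, ∀ y ∈ Q \ {a}, x ≠ y ∧ (G.Adj x y → x = p ∧ y = q)) : False := by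
  have key : ∀ {P : Set V} {p : V}, (∀ u ∈ P, G.Adj c u → u = p ∨ u = a) → c ∉ P →
      ∀ x ∈ ({c} : Set V), ∀ y ∈ P \ {a}, x ≠ y ∧ (G.Adj x y → x = c ∧ y = p) := by
    rintro P p hN hc x rfl y ⟨hy, hya⟩
    exact ⟨by rintro rfl; exact hc hy, fun e => ⟨rfl, (hN y hy e).resolve_right hya⟩⟩
  have key' : ∀ {P : Set V} {p : V}, Rch G P p a → Rch G (insert a (P \ {a})) a p := fun h => by
    refine h.symm.mono fun u hu => ?_
    by_cases hu' : u = a <;> simp [hu', hu]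
  exact no_pyramid hG.pyramid_free (a := a) (A₁ := {c}) (A₂ := P \ {a}) (A₃ := Q \ {a}) hcp hcq hpq
    (Rch.of_adj (by simp) (by simp) hca.symm) (key' hP) (key' hQ) hca.ne hpa hqa (key hNP hcP)
    (key hNQ hcQ) hcross (fun h => npa h.2.symm) (fun h => nqa h.2.symm) (fun h => npa h.1.symm)

/-- A vertex `c` and two paths, such that the neighbors of `c` on the paths are the ends of the
paths, and the ends of the two paths are equal or adjacent. -/
theorem false_of_two_paths [Finite V] {t : ℕ} (hG : InClass t G) {c p q p' q' : V} {P Q : Set V}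
    (hP : Rch G P p p') (hQ : Rch G Q q q') (hcP : c ∉ P) (hcQ : c ∉ Q) (hp : G.Adj c p)
    (hq : G.Adj c q) (hp' : G.Adj c p') (hq' : G.Adj c q')
    (hNP : ∀ u ∈ P, G.Adj c u → u = p ∨ u = p') (hNQ : ∀ u ∈ Q, G.Adj c u → u = q ∨ u = q')
    (hpq : p = q ∨ G.Adj p q) (hpq' : p' = q' ∨ G.Adj p' q') (hsep : Sep G {p, q} {p', q'})
    (hcross : ∀ x ∈ P, ∀ y ∈ Q, (x = p ∧ y = q) ∨ (x = p' ∧ y = q') ∨ (p = q ∧ (x = p ∨ y = q)) ∨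
      (p' = q' ∧ (x = p' ∨ y = q')) ∨ (x ≠ y ∧ ¬ G.Adj x y)) : False := by
  have hpp' := hsep p (.inl rfl) p' (.inl rfl)
  have hqq' := hsep q (.inr rfl) q' (.inr rfl)
  have hpq₂ := hsep p (.inl rfl) q' (.inr rfl)
  have hqp₂ := hsep q (.inr rfl) p' (.inl rfl)
  -- With both pairs of ends equal there is a theta, with exactly one equal a pyramid, with both
  -- adjacent a pinched prism.
  by_cases h : p = q <;> by_cases h' : p' = q'
  · subst h h'
    refine no_theta hG.theta_free (A := P \ {p, p'}) (B := Q \ {p, p'}) (C := {c}) hpp'.1 hpp'.2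
      (hP.mono fun u hu => ?_) (hQ.mono fun u hu => ?_) ?_ ?_ ?_ ?_
    · by_cases hu' : u ∈ ({p, p'} : Set V)
      exacts [.inr hu', .inl ⟨hu, hu'⟩]
    · by_cases hu' : u ∈ ({p, p'} : Set V)
      exacts [.inr hu', .inl ⟨hu, hu'⟩]
    · exact (Rch.of_adj (by simp) (by simp) hp.symm).tail hp' (by simp)
    · rintro x ⟨hx, hx'⟩ y ⟨hy, hy'⟩
      simp only [Set.mem_insert_iff, Set.mem_singleton_iff, not_or] at hx' hy'
      have := hcross x hx y hy
      tauto
    · rintro x ⟨hx, hx'⟩ y rfl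
      exact ⟨by rintro rfl; exact hcP hx, fun e => hx' (hNP x hx e.symm)⟩
    · rintro x ⟨hx, hx'⟩ y rfl
      exact ⟨by rintro rfl; exact hcQ hx, fun e => hx' (hNQ x hx e.symm)⟩
  · subst h
    refine false_of_apex hG hP.symm hQ.symm (hpq'.resolve_left h') hp hp' hq'
      (fun u hu e => (hNP u hu e).symm) (fun u hu e => (hNQ u hu e).symm) hpp'.1.symm hqq'.1.symm
      (fun e => hpp'.2 e.symm) (fun e => hqq'.2 e.symm) hcP hcQ ?_
    rintro x ⟨hx, hx'⟩ y ⟨hy, hy'⟩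
    simp only [Set.mem_singleton_iff] at hx' hy'
    rcases hcross x hx y hy with h1 | h1 | h1 | h1 | h1
    · exact absurd h1.1 hx'
    · exact ⟨by rw [h1.1, h1.2]; exact h', fun _ => h1⟩
    · exact absurd h1.2 (not_or.2 ⟨hx', hy'⟩)
    · exact absurd h1.1 h'
    · exact ⟨h1.1, fun e => absurd e h1.2⟩
  · subst h'
    refine false_of_apex hG hP hQ (hpq.resolve_left h) hp' hp hq hNP hNQ hpp'.1 hqq'.1 hpp'.2
      hqq'.2 hcP hcQ ?_
    rintro x ⟨hx, hx'⟩ y ⟨hy, hy'⟩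
    simp only [Set.mem_singleton_iff] at hx' hy'
    rcases hcross x hx y hy with h1 | h1 | h1 | h1 | h1
    · exact ⟨by rw [h1.1, h1.2]; exact h, fun _ => h1⟩
    · exact absurd h1.1 hx'
    · exact absurd h1.1 h
    · exact absurd h1.2 (not_or.2 ⟨hx', hy'⟩)
    · exact ⟨h1.1, fun e => absurd e h1.2⟩
  · refine (threePaths_of_center hP hQ ?_ hcP hcQ hNP hNQ).false_of_triangle hG
      (proper_of_center (hpq.resolve_left h) (hpq'.resolve_left h') hpp'.1 hqq'.1 hpp'.2 hqq'.2)
      (triangle_of_center hp hq (hpq.resolve_left h))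
      (triangle_of_center hp' hq' (hpq'.resolve_left h'))
    intro x hx y hy
    rcases hcross x hx y hy with h1 | h1 | h1 | h1 | h1
    · exact ⟨by rw [h1.1, h1.2]; exact h, fun _ => .inl h1⟩
    · exact ⟨by rw [h1.1, h1.2]; exact h', fun _ => .inr h1⟩
    · exact absurd h1.1 h
    · exact absurd h1.1 h'
    · exact ⟨h1.1, fun e => absurd e h1.2⟩

/-! ### Long sectors and disconnected non-neighbors -/

theorem IsHole.eq_or_eq_of_adj {Z : Set V} {u w₁ w₂ w₃ : V} (hZ : IsHole G Z) (hu : u ∈ Z)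
    (h₁ : w₁ ∈ Z) (h₂ : w₂ ∈ Z) (h₃ : w₃ ∈ Z) (e₁ : G.Adj u w₁) (e₂ : G.Adj u w₂)
    (e₃ : G.Adj u w₃) (h₁₂ : w₁ ≠ w₂) : w₃ = w₁ ∨ w₃ = w₂ := by
  obtain ⟨n, hn, f, hf, rfl, rfl⟩ := hZ.exists_seq hu
  have key : ∀ w ∈ f '' {i | i < n}, G.Adj (f 0) w → w = f 1 ∨ w = f (n - 1) := by
    rintro _ ⟨i, hi, rfl⟩ e
    simp only [Set.mem_ofPred_eq] at hi
    have := (hf 0 (by omega) i hi).2.1 e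
    rcases (show i = 1 ∨ i = n - 1 by omega) with rfl | rfl
    exacts [.inl rfl, .inr rfl]
  rcases key _ h₁ e₁ with rfl | rfl <;> rcases key _ h₂ e₂ with rfl | rfl <;>
    rcases key _ h₃ e₃ with rfl | rfl <;> simp_all

/-- An interior vertex has two neighbors on the sector, and a vertex of a hole has only two
neighbors on the hole. -/
theorem IsLongSector.mem_vset {Z : Set V} {c x y u w : V} {p : G.Walk x y} (hZ : IsHole G Z)
    (hp : IsLongSector G Z c p) (hu : u ∈ pathInterior p) (hw : w ∈ Z) (e : G.Adj u w) :
    w ∈ vset p := by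
  obtain ⟨hu, hux, huy⟩ := hu
  obtain ⟨i, rfl, hi⟩ := SimpleGraph.Walk.mem_support_iff_exists_getVert.1 hu
  have h0 : i ≠ 0 := by rintro rfl; exact hux p.getVert_zero
  have hl : i ≠ p.length := by rintro rfl; exact huy p.getVert_length
  have hs := hp.1.indSeq
  have hZp := fun k => hp.2.1 (show p.getVert k ∈ vset p from p.getVert_mem_support k)
  rcases hZ.eq_or_eq_of_adj (hZp i) (hZp (i - 1)) (hZp (i + 1)) hw
    ((hs i hi _ (by omega)).2.2 (by omega)) ((hs i hi _ (by omega)).2.2 (by omega)) e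
    (fun h => by have := (hs _ (by omega) _ (by omega)).1 h; omega) with rfl | rfl
  exacts [p.getVert_mem_support _, p.getVert_mem_support _]

/-- A walk along non-neighbors of `c` cannot leave the interior of a long sector, because the ends
of the sector are neighbors of `c`. So the interior of `p` lies in that of `q`, and the ends of `p`
follow as neighbors of interior vertices. -/
theorem IsLongSector.subset {Z : Set V} {c x y x' y' : V} {p : G.Walk x y} {q : G.Walk x' y'}
    (hZ : IsHole G Z) (hp : IsLongSector G Z c p) (hq : IsLongSector G Z c q)
    (h : ∀ u ∈ pathInterior p, ∀ w ∈ pathInterior q, Rch G (Z \ G.neighborSet c) w u) :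
    vset p ⊆ vset q := by
  have hint : pathInterior p ⊆ pathInterior q := by
    intro u hu
    obtain ⟨w, hw⟩ := hq.2.2.2.2.2
    refine (h u hu w hw).closed (pathInterior q) hw fun a ha b hb e => ?_
    refine ⟨hq.mem_vset hZ ha hb.1 e, ?_, ?_⟩
    · rintro rfl; exact hb.2 hq.2.2.1
    · rintro rfl; exact hb.2 hq.2.2.2.1
  have hends : ∀ z ∈ vset p, (z = x ∨ z = y) → z ∈ vset q := by
    intro z hz hxy
    obtain ⟨w, hw⟩ := hp.2.2.2.2.2
    have hzw : z ≠ w := by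
      rintro rfl
      exact hxy.elim hw.2.1 hw.2.2
    have hs := hp.1.indSeq
    obtain ⟨u, hu, e⟩ : ∃ u ∈ pathInterior p, G.Adj u z := by
      obtain ⟨i, rfl, hi⟩ := SimpleGraph.Walk.mem_support_iff_exists_getVert.1 hw.1
      have h0 : i ≠ 0 := by rintro rfl; exact hw.2.1 p.getVert_zero
      have hl : i ≠ p.length := by rintro rfl; exact hw.2.2 p.getVert_length
      have hmem : ∀ k, 0 < k → k < p.length → p.getVert k ∈ pathInterior p := by
        intro k hk hk'
        refine ⟨p.getVert_mem_support _, fun e => ?_, fun e => ?_⟩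
        · have := (hs k hk'.le 0 (by omega)).1 (e.trans p.getVert_zero.symm); omega
        · have := (hs k hk'.le _ le_rfl).1 (e.trans p.getVert_length.symm); omega
      rcases hxy with rfl | rfl
      · refine ⟨p.getVert 1, hmem 1 (by omega) (by omega), ?_⟩
        have := (hs 1 (by omega) 0 (by omega)).2.2 (by omega)
        rwa [p.getVert_zero] at this
      · refine ⟨p.getVert (p.length - 1), hmem _ (by omega) (by omega), ?_⟩
        have := (hs (p.length - 1) (by omega) p.length le_rfl).2.2 (by omega)
        rwa [p.getVert_length] at this
    exact hq.mem_vset hZ (hint hu) (hp.2.1 hz) e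
  intro z hz
  by_cases hx : z = x
  · exact hends z hz (.inl hx)
  by_cases hy : z = y
  · exact hends z hz (.inr hy)
  exact (hint ⟨hz, hx, hy⟩).1

/-- The non-neighbors of the center of a wheel on its hole are disconnected. -/
theorem IsWheel.exists_not_rch {Z : Set V} {c : V} (h : IsWheel G Z c) :
    ∃ u₁ ∈ Z, ∃ u₂ ∈ Z, ¬ G.Adj c u₁ ∧ ¬ G.Adj c u₂ ∧
      ¬ Rch G (Z \ G.neighborSet c) u₁ u₂ := by
  obtain ⟨hZ, -, -, -, x, y, x', y', p, q, hp, hq, hpq⟩ := h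
  by_contra! hcon
  have key : ∀ u ∈ pathInterior p, ∀ w ∈ pathInterior q,
      Rch G (Z \ G.neighborSet c) u w := fun u hu w hw =>
    hcon u (hp.2.1 hu.1) w (hq.2.1 hw.1) (hp.2.2.2.2.1 u hu) (hq.2.2.2.2.1 w hw)
  exact hpq (Set.Subset.antisymm (hp.subset hZ hq fun u hu w hw => (key u hu w hw).symm)
    (hq.subset hZ hp fun u hu w hw => key w hw u hu))

/-! ### Pinched prisms and wheels in the contracted graph -/

namespace Contraction

variable {v : V} {fib : W → Set V} {X : Set W}

/-- If no neighbor of the center on the hole is in `X`, `not_threePaths` applies. Otherwise the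
center is adjacent to a vertex of `X` and so comes from a non-hub; then `rch_of_hole` fails, as
non-neighbors of the center on the two paths are separated by the path ends. -/
theorem pinchedPrism_free [Finite V] {t : ℕ} (C : Contraction G H v fib X) (hG : InClass t G)
    (S : Set W) : ¬ IsPinchedPrism H S := by
  intro h
  obtain ⟨c, x, y, z, w, P, Q, hZ, hcZ, hP, hQ, hxy, hwz, hcross, hN, hxw, nxw, hyz, nyz,
    ⟨u₁, hu₁, n₁⟩, u₂, hu₂, n₂⟩ := h.exists_paths
  have hx := (hN x (.inl hP.left_mem)).2 (.inl rfl)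
  have hy := (hN y (.inr hQ.left_mem)).2 (.inr (.inl rfl))
  have hz := (hN z (.inr hQ.right_mem)).2 (.inr (.inr (.inl rfl)))
  have hw := (hN w (.inl hP.right_mem)).2 (.inr (.inr (.inr rfl)))
  have hNP : ∀ u ∈ P, H.Adj c u → u = x ∨ u = w := by
    intro u hu e
    rcases (hN u (.inl hu)).1 e with h | rfl | rfl | h
    exacts [.inl h, absurd rfl (hcross _ hu _ hQ.left_mem).1,
      absurd rfl (hcross _ hu _ hQ.right_mem).1, .inr h]
  have hNQ : ∀ u ∈ Q, H.Adj c u → u = y ∨ u = z := by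
    intro u hu e
    rcases (hN u (.inr hu)).1 e with rfl | h | h | rfl
    exacts [absurd rfl (hcross _ hP.left_mem _ hu).1, .inl h, .inr h,
      absurd rfl (hcross _ hP.right_mem _ hu).1]
  by_cases hX : x ∉ X ∧ y ∉ X ∧ z ∉ X ∧ w ∉ X
  · obtain ⟨hxX, hyX, hzX, hwX⟩ := hX
    refine C.not_threePaths hG (threePaths_of_center hP hQ hcross (fun h => hcZ (.inl h))
      (fun h => hcZ (.inr h)) hNP hNQ) (triangle_of_center hx hy hxy) (triangle_of_center hw hz hwz)
      (proper_of_center hxy hwz hxw hyz nxw nyz) fun i hi j hj => ?_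
    fin_cases i
    · fin_cases j
      exacts [absurd rfl hj, ⟨hxX, hwX⟩, ⟨hyX, hzX⟩]
    · exact absurd hi hxw
    · exact absurd hi hyz
  · obtain ⟨s, hsX, hcs⟩ : ∃ s ∈ X, H.Adj c s := by
      by_contra! hcon
      exact hX ⟨fun h => hcon x h hx, fun h => hcon y h hy, fun h => hcon z h hz,
        fun h => hcon w h hw⟩
    obtain ⟨-, c', hc', -, hch⟩ := C.nbr hsX hcs.symm
    have := (C.rch_of_hole hG hZ hcZ hc' hch (.inl hu₁) (.inr hu₂) n₁ n₂).closed
      (P \ H.neighborSet c) ⟨hu₁, n₁⟩ ?_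
    · exact (hcross _ this.1 _ hu₂).1 rfl
    · rintro a ⟨ha, hca⟩ b ⟨hb | hb, hcb⟩ e
      · exact ⟨hb, hcb⟩
      · rcases (hcross a ha b hb).2 e with h | h
        · exact absurd (h.1 ▸ hx) hca
        · exact absurd (h.1 ▸ hw) hca

theorem inClass [Finite V] {t : ℕ} (C : Contraction G H v fib X) (hG : InClass t G) :
    InClass t H :=
  ⟨C.theta_free hG, C.pyramid_free hG, C.prism_free hG, C.pinchedPrism_free hG,
    C.cliqueFree hG.cliqueFree⟩

/-- The first and last neighbors of `c` on one part of the hole must be equal or adjacent, since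
otherwise they form a stable triple with a neighbor on the other part. Cutting there gives two
paths, through `u₁` and through `u₂`, as in `false_of_two_paths`, which is applied to `H` itself. -/
theorem rch_of_hole_of_mem [Finite V] [Finite W] {t : ℕ} (C : Contraction G H v fib X)
    (hG : InClass t G) {Z : Set W} {c u₁ u₂ : W} (hZ : IsHole H Z) (hcZ : c ∉ Z) (hcX : c ∈ X)
    (hu₁ : u₁ ∈ Z) (hu₂ : u₂ ∈ Z) (n₁ : ¬ H.Adj c u₁) (n₂ : ¬ H.Adj c u₂) :
    Rch H (Z \ H.neighborSet c) u₁ u₂ := by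
  by_contra hcon
  have hne : u₁ ≠ u₂ := by
    rintro rfl
    exact hcon (.refl ⟨hu₁, n₁⟩)
  have hna : ¬ H.Adj u₁ u₂ := fun e => hcon (.of_adj ⟨hu₁, n₁⟩ ⟨hu₂, n₂⟩ e)
  obtain ⟨R, R', rfl, h₁R, h₁R', h₂R, h₂R', hsep, hl, hl'⟩ := hZ.split hu₁ hu₂ hne hna
  have hRZ : R ∪ {u₁, u₂} ⊆ R ∪ R' ∪ {u₁, u₂} :=
    Set.union_subset_union_left _ Set.subset_union_left
  have hRZ' : R' ∪ {u₁, u₂} ⊆ R ∪ R' ∪ {u₁, u₂} :=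
    Set.union_subset_union_left _ Set.subset_union_right
  have hex : ∀ P ⊆ R ∪ R' ∪ {u₁, u₂}, Rch H P u₁ u₂ → ∃ a ∈ P, a ∈ H.neighborSet c := by
    intro P hP h
    by_contra! hn
    exact hcon (h.mono fun z hz => ⟨hP hz, hn z hz⟩)
  obtain ⟨L, M, p, q, hL, hM, hp, hq, hrL, hrM, hLu, hMu, hcr, hall⟩ :=
    hl.ends (hex _ hRZ hl.1)
  obtain ⟨L', M', p', q', hL', hM', hp', hq', hrL', hrM', hLu', hMu', hcr', hall'⟩ :=
    hl'.ends (hex _ hRZ' hl'.1)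
  have mem : ∀ {P : Set W} {a : W}, a ∈ P ∪ {u₁, u₂} → H.Adj c a → a ∈ P := by
    rintro P a (h | rfl | rfl) e
    exacts [h, absurd e n₁, absurd e n₂]
  have hpR := mem (hL hrL.right_mem) hp
  have hqR := mem (hM hrM.left_mem) hq
  have hpR' := mem (hL' hrL'.right_mem) hp'
  have hqR' := mem (hM' hrM'.left_mem) hq'
  have hpq : p = q ∨ H.Adj p q := by
    by_contra! hcon
    have h1 := hsep p hpR p' hpR'
    have h2 := hsep q hqR p' hpR'
    exact C.no_triple hG hcX hp hq hp' hcon.1 h1.1 h2.1 hcon.2 h1.2 h2.2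
  have hpq' : p' = q' ∨ H.Adj p' q' := by
    by_contra! hcon
    have h1 := hsep p hpR p' hpR'
    have h2 := hsep p hpR q' hqR'
    exact C.no_triple hG hcX hp hp' hq' h1.1 h2.1 hcon.1 h1.2 h2.2 hcon.2
  have hnL : ∀ {L M : Set W} {p q : W}, H.Adj c p → H.Adj c q → Rch H L u₁ p → Rch H M q u₂ →
      (∀ x ∈ L, ∀ y ∈ M, (x = p ∧ y = q) ∨ (p = q ∧ (x = p ∨ y = q)) ∨ x ≠ y ∧ ¬ H.Adj x y) →
      u₂ ∉ L ∧ u₁ ∉ M := by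
    intro L M p q hp hq hL hM h
    have hne : ∀ {u r}, ¬ H.Adj c u → H.Adj c r → u ≠ r := by
      rintro u r hu hr rfl
      exact hu hr
    constructor
    · intro hu
      rcases h _ hu _ hM.right_mem with h | ⟨-, h | h⟩ | h
      exacts [hne n₂ hp h.1, hne n₂ hp h, hne n₂ hq h, h.1 rfl]
    · intro hu
      rcases h _ hL.left_mem _ hu with h | ⟨-, h | h⟩ | h
      exacts [hne n₁ hp h.1, hne n₁ hp h, hne n₁ hq h, h.1 rfl]
  -- The pieces before the first neighbor of `c` stay away from `u₂` and those after the last stay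
  -- away from `u₁`; so pieces of different parts can be compared by `hsep` except at the shared
  -- vertices `u₁` and `u₂`.
  obtain ⟨h₂L, h₁M⟩ := hnL hp hq hrL hrM hcr
  obtain ⟨h₂L', h₁M'⟩ := hnL hp' hq' hrL' hrM' hcr'
  refine false_of_two_paths (C.inClass hG) (c := c) (P := L ∪ L') (Q := M ∪ M')
    ((hrL.symm.mono Set.subset_union_left).trans (hrL'.mono Set.subset_union_right))
    ((hrM.mono Set.subset_union_left).trans (hrM'.symm.mono Set.subset_union_right))
    ?_ ?_ hp hq hp' hq' ?_ ?_ hpq hpq' (hsep.mono ?_ ?_) ?_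
  · rintro (h | h)
    exacts [hcZ (hRZ (hL h)), hcZ (hRZ' (hL' h))]
  · rintro (h | h)
    exacts [hcZ (hRZ (hM h)), hcZ (hRZ' (hM' h))]
  · rintro u (hu | hu) e
    exacts [.inl (hLu u hu e), .inr (hLu' u hu e)]
  · rintro u (hu | hu) e
    exacts [.inl (hMu u hu e), .inr (hMu' u hu e)]
  · rintro u (rfl | rfl) <;> assumption
  · rintro u (rfl | rfl) <;> assumption
  · have in₁ : ∀ x ∈ L, ∀ y ∈ M, (x = p ∧ y = q) ∨ (x = p' ∧ y = q') ∨
        (p = q ∧ (x = p ∨ y = q)) ∨ (p' = q' ∧ (x = p' ∨ y = q')) ∨ (x ≠ y ∧ ¬ H.Adj x y) := by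
      intro x hx y hy
      rcases hcr x hx y hy with h | h | h
      exacts [.inl h, .inr (.inr (.inl h)), .inr (.inr (.inr (.inr h)))]
    have in₂ : ∀ x ∈ L', ∀ y ∈ M', (x = p ∧ y = q) ∨ (x = p' ∧ y = q') ∨
        (p = q ∧ (x = p ∨ y = q)) ∨ (p' = q' ∧ (x = p' ∨ y = q')) ∨ (x ≠ y ∧ ¬ H.Adj x y) := by
      intro x hx y hy
      rcases hcr' x hx y hy with h | h | h
      exacts [.inr (.inl h), .inr (.inr (.inr (.inl h))), .inr (.inr (.inr (.inr h)))]
    rintro x (hx | hx) y (hy | hy)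
    · exact in₁ x hx y hy
    · rcases hL hx with hxR | rfl | rfl
      · rcases hM' hy with hyR | rfl | rfl
        · exact .inr (.inr (.inr (.inr (hsep x hxR y hyR))))
        · exact absurd hy h₁M'
        · exact in₁ x hx _ hrM.right_mem
      · exact in₂ _ hrL'.left_mem y hy
      · exact absurd hx h₂L
    · rcases hL' hx with hxR | rfl | rfl
      · rcases hM hy with hyR | rfl | rfl
        · exact .inr (.inr (.inr (.inr (hsep.symm x hxR y hyR))))
        · exact absurd hy h₁M
        · exact in₂ x hx _ hrM'.right_mem
      · exact in₁ _ hrL.left_mem y hy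
      · exact absurd hx h₂L'
    · exact in₂ x hx y hy

end Contraction

/-! ### The graph of the theorem as a contraction -/

/-- The sets contracted to the vertices of `contractedWith G v`. -/
def fiber (G : SimpleGraph V) (v : V) : Option (ContractedVertex G v) → Set V
  | none => {v}
  | some (.inl x) => {x.1}
  | some (.inr D) => Subtype.val '' D.supp

theorem rch_of_reachable {s : Set V} {a b : s} (h : (G.induce s).Reachable a b) :
    Rch G {x | ∃ y : s, (G.induce s).Reachable a y ∧ x = y} a b := by
  obtain ⟨p⟩ := h
  induction p with
  | nil => exact .refl ⟨_, .rfl, rfl⟩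
  | cons e p ih =>
    refine Rch.head ⟨_, .rfl, rfl⟩ e (ih.mono ?_)
    rintro x ⟨y, hy, rfl⟩
    exact ⟨y, e.reachable.trans hy, rfl⟩

theorem contraction_contractedWith (G : SimpleGraph V) (v : V) :
    Contraction G (contractedWith G v) v (fiber G v)
      {w | ∃ D : FarComponent G v, w = some (.inr D)} where
  conn := by
    rintro (_ | x | D) s hs t ht
    · obtain rfl : s = v := hs
      obtain rfl : t = s := ht
      exact .refl rfl
    · obtain rfl : s = x.1 := hs
      obtain rfl : t = x.1 := ht
      exact .refl rfl
    · obtain ⟨a, ha, rfl⟩ := hs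
      obtain ⟨b, hb, rfl⟩ := ht
      rw [SimpleGraph.ConnectedComponent.mem_supp_iff] at ha hb
      refine (rch_of_reachable (SimpleGraph.ConnectedComponent.exact (ha.trans hb.symm))).mono ?_
      rintro _ ⟨y, hy, rfl⟩
      refine ⟨y, ?_, rfl⟩
      rw [SimpleGraph.ConnectedComponent.mem_supp_iff, ← ha]
      exact (SimpleGraph.ConnectedComponent.sound hy).symm
  disj := by
    rintro (_ | x | D) (_ | y | E) a b hne ha hb rfl
    · exact hne rfl
    · exact y.2.1.ne ((show a = v from ha).symm.trans hb)
    · obtain ⟨b, -, rfl⟩ := hb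
      exact b.2.1 ha
    · exact x.2.1.ne ((show a = v from hb).symm.trans ha)
    · exact hne (by rw [Subtype.ext ((show a = x.1 from ha).symm.trans hb)])
    · obtain ⟨b, -, rfl⟩ := hb
      exact b.2.2 ((show (b : V) = x.1 from ha) ▸ x.2.1)
    · obtain ⟨b, -, rfl⟩ := ha
      exact b.2.1 hb
    · obtain ⟨b, -, rfl⟩ := ha
      exact b.2.2 ((show (b : V) = y.1 from hb) ▸ y.2.1)
    · obtain ⟨b, hb', rfl⟩ := ha
      obtain ⟨c, hc', h⟩ := hb
      obtain rfl := Subtype.ext h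
      rw [SimpleGraph.ConnectedComponent.mem_supp_iff] at hb' hc'
      exact hne (by rw [← hb', ← hc'])
  adj := by
    rintro (_ | x | D) (_ | y | E) a b hne ha hb e
    · exact hne rfl
    · trivial
    · obtain ⟨b, -, rfl⟩ := hb
      obtain rfl : a = v := ha
      exact b.2.2 e
    · trivial
    · obtain rfl : a = x.1 := ha
      obtain rfl : b = y.1 := hb
      exact e
    · obtain rfl : a = x.1 := ha
      obtain ⟨b, hb', rfl⟩ := hb
      exact ⟨b, hb', e⟩
    · obtain ⟨a, -, rfl⟩ := ha
      obtain rfl : b = v := hb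
      exact a.2.2 e.symm
    · obtain rfl : b = y.1 := hb
      obtain ⟨a, ha', rfl⟩ := ha
      exact ⟨a, ha', e.symm⟩
    · obtain ⟨a, ha', rfl⟩ := ha
      obtain ⟨b, hb', rfl⟩ := hb
      rw [SimpleGraph.ConnectedComponent.mem_supp_iff] at ha' hb'
      refine hne ?_
      rw [← ha', ← hb', SimpleGraph.ConnectedComponent.sound
        (SimpleGraph.Adj.reachable (show (G.induce _).Adj a b from e))]
  exists_adj := by
    rintro (_ | x | D) (_ | y | E) h
    · exact h.elim
    · exact ⟨v, rfl, y.1, rfl, y.2.1⟩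
    · exact h.elim
    · exact ⟨x.1, rfl, v, rfl, x.2.1.symm⟩
    · exact ⟨x.1, rfl, y.1, rfl, h⟩
    · obtain ⟨d, hd, e⟩ := h
      exact ⟨x.1, rfl, d, ⟨d, hd, rfl⟩, e⟩
    · exact h.elim
    · obtain ⟨d, hd, e⟩ := h
      exact ⟨d, ⟨d, hd, rfl⟩, y.1, rfl, e.symm⟩
    · exact h.elim
  single := by
    rintro (_ | x | D) h
    · exact ⟨v, rfl⟩
    · exact ⟨x.1, rfl⟩
    · exact absurd ⟨D, rfl⟩ h
  far := by
    rintro w ⟨D, rfl⟩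
    refine ⟨?_, ?_⟩
    · rintro ⟨d, -, hd⟩
      exact d.2.1 hd
    · rintro _ ⟨d, -, rfl⟩
      exact d.2.2
  nbr := by
    rintro w (_ | y | E) ⟨D, rfl⟩ h
    · exact h.elim
    · refine ⟨?_, y.1, rfl, y.2.1, y.2.2⟩
      rintro ⟨D, hD⟩
      simp at hD
    · exact h.elim

theorem IsHole.some_image {v : V} {Z : Set (ContractedVertex G v)}
    (h : IsHole (contracted G v) Z) : IsHole (contractedWith G v) (some '' Z) := by
  obtain ⟨n, hn, f, hf, rfl⟩ := isHole_iff.1 h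
  exact isHole_iff.2 ⟨n, hn, fun i => some (f i),
    fun i hi j hj => ⟨fun e => (hf i hi j hj).1 (Option.some_injective _ e), (hf i hi j hj).2⟩,
    (Set.image_image _ _ _)⟩

theorem Rch.of_some {v : V} {A : Set (ContractedVertex G v)} {s t : ContractedVertex G v}
    (h : Rch (contractedWith G v) (some '' A) (some s) (some t)) : Rch (contracted G v) A s t := by
  have hc : some t ∈ {y | ∃ u, some u = y ∧ Rch (contracted G v) A s u} := by
    refine h.closed _ ?_ ?_
    · obtain ⟨a, ha, e⟩ := h.left_mem
      exact ⟨s, rfl, .refl (Option.some_injective _ e ▸ ha)⟩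
    · rintro _ ⟨u, rfl, hu⟩ _ ⟨w, hw, rfl⟩ e
      exact ⟨w, rfl, hu.tail e hw⟩
  obtain ⟨a, ha, hr⟩ := hc
  exact Option.some_injective _ ha ▸ hr

end HubContraction

theorem theorem5p1 {V : Type*} [Finite V] (t : ℕ) (ht : 1 ≤ t) (G : SimpleGraph V) (v : V)
    (hG : HubContraction.InClass t G) :
    HubContraction.InClass t (HubContraction.contractedWith G v) ∧
      HubContraction.WheelFree (HubContraction.contracted G v) := by
  have C := HubContraction.contraction_contractedWith G v
  refine ⟨C.inClass hG, fun Z c hw => ?_⟩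
  -- A wheel of `H` has a center with disconnected non-neighbors on its hole. The hole is viewed in
  -- `H ∪ {v}`, where the two connectivity lemmas apply: the center is a non-hub neighbor of `v` or
  -- a contracted component, never `v` itself.
  obtain ⟨u₁, hu₁, u₂, hu₂, n₁, n₂, hr⟩ := hw.exists_not_rch
  have hZ := hw.1.some_image
  have hcZ : some c ∉ some '' Z := by
    rintro ⟨d, hd, e⟩
    exact hw.2.2.1 (Option.some_injective _ e ▸ hd)
  have : HubContraction.Rch (HubContraction.contractedWith G v)
      (some '' Z \ (HubContraction.contractedWith G v).neighborSet (some c))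
      (some u₁) (some u₂) := by
    rcases c with x | D
    · exact C.rch_of_hole hG hZ hcZ rfl x.2.2 ⟨_, hu₁, rfl⟩ ⟨_, hu₂, rfl⟩ n₁ n₂
    · exact C.rch_of_hole_of_mem hG hZ hcZ ⟨D, rfl⟩ ⟨_, hu₁, rfl⟩ ⟨_, hu₂, rfl⟩ n₁ n₂
  refine hr (HubContraction.Rch.of_some (this.mono ?_))
  rintro _ ⟨⟨w, hw, rfl⟩, h⟩
  exact ⟨w, ⟨hw, h⟩, rfl⟩
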